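/- **Setting.** Let $\mathcal X$ be a Polish space, $\mathcal Y,\mathcal H_1$ real separable Hilbert spaces, $\mathcal H_2$ a separable reproducing kernel Hilbert space of functions $\mathcal X\to\mathcal Y$ with point evaluations $S_x:\mathcal H_2\to\mathcal Y$ and $K_x=S_x^*$. Let $\rho$ be a probability measure on $\mathcal X\times\mathcal Y$ with $\mathcal X$-marginal $\mu$ and conditional laws $\rho(\cdot|x)$, and let $(x_j,y_j)_{j\le n}$ be i.i.d. from $\rho$. Let $A:\mathcal D(A)\subset\mathcal H_1\to\mathcal H_2$ be a (nonlinear) operator, $g_1\in\mathcal D(A)$, let $S:\mathcal H_2\to L^2(\mathcal X,\mu;\mathcal Y)$ be the inclusion, and let $\mathcal B_d(f^\dagger)\subset\mathcal H_1$ be the open ball of radius $d$ around $f^\dagger$. Assume: 1. $f^\dagger\in\operatorname{int}\mathcal D(A)$, $\mathcal B_d(f^\dagger)\subset\mathcal D(A)$, and $[A(f^\dagger)](x)=\int y\,\rho(dy|x)$ for $\mu$-almost all $x$. 2. For $\mu$-almost all $x$ and all integers $l\ge2$: $\int\|y-A(f^\dagger)(x)\|^l\,\rho(dy|x)\le\frac12\,l!\,\Sigma^2M^{l-2}$.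 3. $\sup_x\operatorname{Tr}(K_x^*K_x)\le\kappa_0^2<\infty$, and $(x,x')\mapsto\langle K_xy,K_{x'}y'\rangle$ is measurable for all $y,y'\in\mathcal Y$. 4. $A$ is Fréchet differentiable on $\mathcal D(A)$, with $\|A'(f)\|\le\ell$ for $f\in\mathcal B_d(f^\dagger)\cap\mathcal D(A)$. 5. $0<\eta<1/(\kappa_0\ell)^2$. 6. With $\alpha\in(0,\frac12)$, for all $f,\tilde f\in\mathcal B_d(f^\dagger)\cap\mathcal D(A)$: $\|S(A(f)-A(\tilde f)-A'(\tilde f)(f-\tilde f))\|_{L^2}\le\alpha\|S(A(f)-A(\tilde f))\|_{L^2}$; and there are bounded operators $R_f$ on $L^2(\mathcal X,\mu;\mathcal Y)$ with $SA'(f)=R_fSA'(f^\dagger)$, $\|R_f\|\le\widetilde C_R$ and $\|R_f-I\|\le C_R\|f-f^\dagger\|$ for these $f$. 7. $f^\dagger-g_1=T^rg$ for some $g\in\mathcal H_1$ with $\|g\|\le D$, where $r>0$ and $T=B^*B$, $B=SA'(f^\dagger)$. 8. For some $\nu\in(0,1)$: $\operatorname{Tr}((L+\lambda I)^{-1}L)\le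 C_\nu^2\lambda^{-\nu}$ for all $\lambda>0$, where $L=S^*S$. Let $g_{t+1}=g_t-\frac{\eta}{n}\sum_{j=1}^n(S_{x_j}A'(g_t))^*([A(g_t)](x_j)-y_j)$, $t\ge1$, be the gradient descent iterates, and $T_n=\lfloor\eta^{-1}n^{1/(\min\{2r,1\}+\nu+1)}\rfloor$. **Claim.** Let $u\in\{0,\frac12\}$. There is a constant $C_\star>0$, depending only on $u,r,\nu,\eta,M,\Sigma,\kappa_0,\ell,\alpha,C_R,\widetilde C_R,D,C_\nu$, such that for every $d>0$ there is an $N$, depending only on these quantities and $d$, such that in every setting as above, for all $\delta$ with $6\exp(-\frac{d}{C_\star}\eta^{\min\{r,1/2\}})\le\delta\le1$ and all $n\ge N$, with probability at least $1-\delta$ the iterates $g_1,\dots,g_{T_n}$ are well defined (they lie in $\mathcal D(A)$) and $$\|T^u(g_{T_n}-f^\dagger)\|_{\mathcal H_1}\le C_\star\left(\frac1n\right)^{\frac{\min\{r,1/2\}+u}{2\min\{r,1/2\}+\nu+1}}\log\left(\frac6\delta\right).$$ -/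

import Mathlib

open MeasureTheory Filter Topology
open scoped ENNReal RealInnerProductSpace InnerProduct

noncomputable section

/-! ### Traces and real powers of operators on a real Hilbert space -/

section HilbertSpace

variable {H : Type*} [NormedAddCommGroup H] [InnerProductSpace ℝ H] [CompleteSpace H]

/-- A set which is an orthonormal basis of the Hilbert space `H` (a fixed choice). -/
def stdBasisSet (H : Type*) [NormedAddCommGroup H] [InnerProductSpace ℝ H] [CompleteSpace H] :
    Set H :=
  (exists_hilbertBasis ℝ H).choose

/-- The orthonormal basis of `H` with underlying set `stdBasisSet H`. -/
def stdBasis (H : Type*) [NormedAddCommGroup H] [InnerProductSpace ℝ H] [CompleteSpace H] :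
    HilbertBasis (stdBasisSet H) ℝ H :=
  (exists_hilbertBasis ℝ H).choose_spec.choose

/-- The trace `Tr P = ∑ ⟨e, P e⟩ ∈ [0, ∞]` of a positive bounded operator `P`, the sum being over
an orthonormal basis. It is used for positive operators only; for these it does not depend on the
basis. -/
def opTrace (P : H →L[ℝ] H) : ℝ≥0∞ :=
  ∑' i : stdBasisSet H, ENNReal.ofReal ⟪stdBasis H i, P (stdBasis H i)⟫

/-- The power `T ^ s` of a compact self-adjoint positive operator `T` by spectral calculus:
`T ^ s x = ∑ μ ^ s P_μ x`, the sum being over the eigenvalues `μ` of `T`, with `P_μ` the orthogonal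
projection onto `ker (T - μ)`. (The projection vanishes if `μ` is not an eigenvalue, so the sum can
be indexed by all real numbers. As `0 ^ 0 = 1`, `T ^ 0` is the identity; for `s > 0` the kernel of
`T` does not contribute.) -/
def opPow (T : H →L[ℝ] H) (s : ℝ) (x : H) : H :=
  ∑' μ : ℝ, μ ^ s • (T - μ • ContinuousLinearMap.id ℝ H).ker.starProjection x

/-- The effective dimension `Tr ((L + λ)⁻¹ L)` of a positive operator `L`. -/
def effectiveDim (L : H →L[ℝ] H) (lam : ℝ) : ℝ≥0∞ :=
  opTrace (Ring.inverse (L + lam • (1 : H →L[ℝ] H)) * L)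

end HilbertSpace

/-! ### The vector-valued reproducing kernel Hilbert space and its inclusion into `L²` -/

section Kernel

variable {X Y H₂ : Type*} [MeasurableSpace X]
  [NormedAddCommGroup Y] [InnerProductSpace ℝ Y] [CompleteSpace Y]
  [NormedAddCommGroup H₂] [InnerProductSpace ℝ H₂] [CompleteSpace H₂] [RKHS ℝ H₂ X Y]

/-- The conditions on the kernel of the reproducing kernel Hilbert space `H₂` of functions
`X → Y`; `RKHS.kerFun H₂ x` is the operator `K_x : Y → H₂`, the adjoint of the evaluation at `x`. -/
structure KernelCondition (H₂ : Type*) {X Y : Type*} [MeasurableSpace X]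
    [NormedAddCommGroup Y] [InnerProductSpace ℝ Y] [CompleteSpace Y]
    [NormedAddCommGroup H₂] [InnerProductSpace ℝ H₂] [CompleteSpace H₂] [RKHS ℝ H₂ X Y]
    (κ₀ : ℝ) : Prop where
  /-- `K_x` is Hilbert-Schmidt with `Tr (K_x^* K_x) ≤ κ₀ ^ 2`. -/
  trace_le : ∀ x : X, opTrace ((RKHS.kerFun H₂ x)† ∘L RKHS.kerFun H₂ x) ≤ ENNReal.ofReal (κ₀ ^ 2)
  /-- `(x, x') ↦ ⟨K_x y, K_x' y'⟩` is measurable. -/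
  measurable : ∀ y y' : Y,
    Measurable fun p : X × X => ⟪RKHS.kerFun H₂ p.1 y, RKHS.kerFun H₂ p.2 y'⟫

/-- The point evaluation `S_x : H₂ → Y` as a bounded operator. -/
def evalOp (H₂ : Type*) {X Y : Type*}
    [NormedAddCommGroup Y] [InnerProductSpace ℝ Y]
    [NormedAddCommGroup H₂] [InnerProductSpace ℝ H₂] [RKHS ℝ H₂ X Y] (x : X) : H₂ →L[ℝ] Y :=
  .proj x ∘L RKHS.coeCLM ℝ

lemma KernelCondition.norm_apply_le {κ₀ : ℝ} (hK : KernelCondition H₂ (X := X) (Y := Y) κ₀)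
    (h : H₂) (x : X) : ‖h x‖ ≤ |κ₀| * ‖h‖ := by
  have hb := hK.trace_le x
  set b := stdBasis Y
  have key : ENNReal.ofReal (‖h x‖ ^ 2) ≤ ENNReal.ofReal ((|κ₀| * ‖h‖) ^ 2) := by
    have h1 : HasSum (fun i => ⟪h x, b i⟫ * ⟪b i, h x⟫) ⟪h x, h x⟫ :=
      b.hasSum_inner_mul_inner (h x) (h x)
    have h0 : ∀ i, 0 ≤ ⟪h x, b i⟫ * ⟪b i, h x⟫ := fun i => by
      rw [real_inner_comm]; exact mul_self_nonneg _
    rw [← real_inner_self_eq_norm_sq, ← h1.tsum_eq, ENNReal.ofReal_tsum_of_nonneg h0 h1.summable]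
    calc ∑' i, ENNReal.ofReal (⟪h x, b i⟫ * ⟪b i, h x⟫)
        ≤ ∑' i, ENNReal.ofReal (‖h‖ ^ 2) *
            ENNReal.ofReal ⟪b i, ((RKHS.kerFun H₂ x)† ∘L RKHS.kerFun H₂ x) (b i)⟫ := by
          refine ENNReal.tsum_le_tsum fun i => ?_
          rw [← ENNReal.ofReal_mul (by positivity)]
          refine ENNReal.ofReal_le_ofReal ?_
          rw [ContinuousLinearMap.comp_apply, ContinuousLinearMap.adjoint_inner_right,
            real_inner_self_eq_norm_sq, ← RKHS.inner_kerFun, ← RKHS.kerFun_inner,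
            real_inner_comm, ← mul_pow, ← pow_two, mul_comm, ← sq_abs]
          have := abs_real_inner_le_norm (RKHS.kerFun H₂ x (b i)) h
          gcongr
      _ = ENNReal.ofReal (‖h‖ ^ 2) *
            opTrace ((RKHS.kerFun H₂ x)† ∘L RKHS.kerFun H₂ x) := ENNReal.tsum_mul_left
      _ ≤ ENNReal.ofReal (‖h‖ ^ 2) * ENNReal.ofReal (κ₀ ^ 2) := by gcongr
      _ = ENNReal.ofReal ((|κ₀| * ‖h‖) ^ 2) := by
          rw [← ENNReal.ofReal_mul (by positivity), mul_pow, sq_abs, mul_comm]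
  rw [ENNReal.ofReal_le_ofReal_iff (by positivity)] at key
  exact (sq_le_sq₀ (norm_nonneg _) (by positivity)).mp key

lemma KernelCondition.measurable_kerFun {κ₀ : ℝ}
    (hK : KernelCondition H₂ (X := X) (Y := Y) κ₀) (y v : Y) (x' : X) :
    Measurable fun x : X => ⟪y, (RKHS.kerFun H₂ x' v) x⟫ := by
  have h1 : (fun x : X => ⟪y, (RKHS.kerFun H₂ x' v) x⟫) =
      (fun p : X × X => ⟪RKHS.kerFun H₂ p.1 y, RKHS.kerFun H₂ p.2 v⟫) ∘ fun x => (x, x') :=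
    funext fun x => (RKHS.kerFun_inner x y (RKHS.kerFun H₂ x' v)).symm
  rw [h1]
  exact (hK.measurable y v).comp measurable_prodMk_right

lemma KernelCondition.measurable_apply [MeasurableSpace Y] [BorelSpace Y]
    [SecondCountableTopology Y] {κ₀ : ℝ} (hK : KernelCondition H₂ (X := X) (Y := Y) κ₀)
    (h : H₂) : Measurable fun x : X => h x := by
  have hw : ∀ y : Y, Measurable fun x : X => ⟪y, h x⟫ := by
    intro y
    have hmem : h ∈ (Submodule.span ℝ {RKHS.kerFun H₂ x v | (x : X) (v : Y)}).topologicalClosure :=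
      RKHS.kerFun_dense H₂ ▸ Submodule.mem_top
    rw [← SetLike.mem_coe, Submodule.topologicalClosure_coe, mem_closure_iff_seq_limit] at hmem
    obtain ⟨u, hu, hlim⟩ := hmem
    refine measurable_of_tendsto_metrizable (f := fun n x => ⟪y, u n x⟫) (fun n => ?_) ?_
    · have key : ∀ g ∈ Submodule.span ℝ {RKHS.kerFun H₂ x v | (x : X) (v : Y)},
          Measurable fun x : X => ⟪y, g x⟫ := by
        intro g hg
        induction hg using Submodule.span_induction with
        | mem g hg =>
          obtain ⟨x', v, rfl⟩ := hg
          exact hK.measurable_kerFun y v x'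
        | zero =>
          simp only [RKHS.coe_zero, Pi.zero_apply, inner_zero_right]
          exact measurable_const
        | add a b _ _ ha hb =>
          simp only [RKHS.coe_add, Pi.add_apply, inner_add_right]
          exact ha.add hb
        | smul c a _ ha =>
          simp only [RKHS.coe_smul, Pi.smul_apply, real_inner_smul_right]
          exact ha.const_mul c
      exact key _ (hu n)
    · rw [tendsto_pi_nhds]
      intro x
      exact ((continuous_const.inner (RKHS.continuous_eval x)).tendsto h).comp hlim
  have he : MeasurableEmbedding
      (fun (v : Y) (k : ℕ) => ⟪TopologicalSpace.denseSeq Y k, v⟫) := by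
    refine Continuous.measurableEmbedding (by fun_prop) fun v w hvw => ?_
    refine (TopologicalSpace.denseRange_denseSeq Y).eq_of_inner_right ℝ ?_
    exact fun k => congrFun hvw k
  rw [← he.measurable_comp_iff]
  exact measurable_pi_lambda _ fun k => hw _

variable [MeasurableSpace Y] [BorelSpace Y] [SecondCountableTopology Y]

lemma KernelCondition.memLp {κ₀ : ℝ} (hK : KernelCondition H₂ (X := X) (Y := Y) κ₀)
    (m : Measure X) [IsFiniteMeasure m] (h : H₂) : MemLp (fun x : X => h x) 2 m :=
  MemLp.of_bound (hK.measurable_apply h).aestronglyMeasurable (|κ₀| * ‖h‖)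
    (Eventually.of_forall fun x => hK.norm_apply_le h x)

/-- The inclusion operator `S : H₂ → L²(X, m; Y)`. -/
def inclL2 {κ₀ : ℝ} (hK : KernelCondition H₂ (X := X) (Y := Y) κ₀)
    (m : Measure X) [IsFiniteMeasure m] : H₂ →L[ℝ] Lp Y 2 m :=
  LinearMap.mkContinuousOfExistsBound
    { toFun := fun h => (hK.memLp m h).toLp (fun x : X => h x)
      map_add' := fun a b => by
        rw [← MemLp.toLp_add]; exact MemLp.toLp_congr _ _ (by simp; rfl)
      map_smul' := fun c a => by
        rw [RingHom.id_apply, ← MemLp.toLp_const_smul]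
        exact MemLp.toLp_congr _ _ (by simp; rfl) }
    (by
      refine ⟨(measureUnivNNReal m : ℝ) ^ ((2 : ℝ≥0∞).toReal)⁻¹ * |κ₀|, fun h => ?_⟩
      rw [mul_assoc]
      refine Lp.norm_le_of_ae_bound (by positivity) ?_
      filter_upwards [(hK.memLp m h).coeFn_toLp] with x hx
      simp only [LinearMap.coe_mk, AddHom.coe_mk]
      rw [hx]
      exact hK.norm_apply_le h x)

end Kernel

/-! ### The inverse problem and gradient descent -/

section Problem

variable {X Y H₁ H₂ : Type*} [MeasurableSpace X]
  [NormedAddCommGroup Y] [InnerProductSpace ℝ Y] [CompleteSpace Y]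
  [SecondCountableTopology Y] [MeasurableSpace Y] [BorelSpace Y]
  [NormedAddCommGroup H₁] [InnerProductSpace ℝ H₁] [CompleteSpace H₁]
  [NormedAddCommGroup H₂] [InnerProductSpace ℝ H₂] [CompleteSpace H₂] [RKHS ℝ H₂ X Y]

/-- `f†` is an interior point of the domain of `A`, and `[A f†](x)` is the mean of the conditional
law of `Y` given `X = x`, for almost all `x`. -/
def IsTrueSolution (ρ : Measure (X × Y)) [IsProbabilityMeasure ρ] (dom : Set H₁) (A : H₁ → H₂)
    (fdag : H₁) : Prop :=
  fdag ∈ interior dom ∧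
    ∀ᵐ x ∂ρ.fst, Integrable (fun y => y) (ρ.condKernel x) ∧
      A fdag x = ∫ y, y ∂(ρ.condKernel x)

/-- The Bernstein-type moment condition on the noise `y - g x` around the function `g`. -/
def BernsteinNoise (ρ : Measure (X × Y)) [IsProbabilityMeasure ρ] (g : X → Y)
    (M Sig : ℝ) : Prop :=
  ∀ᵐ x ∂ρ.fst, ∀ l : ℕ, 2 ≤ l →
    ∫⁻ y, ENNReal.ofReal (‖y - g x‖ ^ l) ∂(ρ.condKernel x) ≤
      ENNReal.ofReal (1 / 2 * (l.factorial : ℝ) * Sig ^ 2 * M ^ (l - 2))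

/-- `A` is Fréchet differentiable on its domain with derivative `A'`, and `‖A' f‖ ≤ Lip` on the
part of the domain that lies in the ball of radius `d` around `f†`. -/
def FrechetCondition (dom : Set H₁) (A : H₁ → H₂) (A' : H₁ → H₁ →L[ℝ] H₂) (fdag : H₁)
    (d Lip : ℝ) : Prop :=
  (∀ f ∈ dom, HasFDerivWithinAt A (A' f) dom f) ∧
    ∀ f ∈ Metric.ball fdag d ∩ dom, ‖A' f‖ ≤ Lip

/-- The nonlinearity conditions on `A` in the ball of radius `d` around `f†`, with
`S : H₂ → L²` the inclusion: the tangential cone condition with constant `α`, and the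
range invariance `S A'(f) = R_f S A'(f†)`. -/
def NonlinearityCondition {E : Type*} [NormedAddCommGroup E] [NormedSpace ℝ E] (S : H₂ →L[ℝ] E)
    (dom : Set H₁) (A : H₁ → H₂) (A' : H₁ → H₁ →L[ℝ] H₂) (fdag : H₁)
    (d α CR CR' : ℝ) : Prop :=
  (∀ f ∈ Metric.ball fdag d ∩ dom, ∀ f' ∈ Metric.ball fdag d ∩ dom,
      ‖S (A f - A f' - A' f' (f - f'))‖ ≤ α * ‖S (A f - A f')‖) ∧
    ∃ R : H₁ → E →L[ℝ] E, ∀ f ∈ Metric.ball fdag d ∩ dom,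
      S ∘L A' f = R f ∘L (S ∘L A' fdag) ∧ ‖R f‖ ≤ CR' ∧
        ‖R f - ContinuousLinearMap.id ℝ E‖ ≤ CR * ‖f - fdag‖

/-- The operator `T = B^* B` on `H₁`, with `B = S A'(f†) : H₁ → L²(X, m; Y)`. -/
def opT {κ₀ : ℝ} (hK : KernelCondition H₂ (X := X) (Y := Y) κ₀) (m : Measure X)
    [IsFiniteMeasure m] (A' : H₁ → H₁ →L[ℝ] H₂) (fdag : H₁) : H₁ →L[ℝ] H₁ :=
  (inclL2 hK m ∘L A' fdag)† ∘L (inclL2 hK m ∘L A' fdag)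

/-- The operator `L = S^* S` on `H₂`. -/
def opL {κ₀ : ℝ} (hK : KernelCondition H₂ (X := X) (Y := Y) κ₀) (m : Measure X)
    [IsFiniteMeasure m] : H₂ →L[ℝ] H₂ :=
  (inclL2 hK m)† ∘L inclL2 hK m

/-- One step of gradient descent with step size `η` for the sample `z`:
`f ↦ f - η (Ŝ A'(f))^* (Ŝ A(f) - y)`, the adjoint being with respect to the inner product
`(1 / n) ∑ ⟨·, ·⟩` of the empirical norm on `Yⁿ`. -/
def gdStep {n : ℕ} (z : Fin n → X × Y) (A : H₁ → H₂) (A' : H₁ → H₁ →L[ℝ] H₂) (η : ℝ)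
    (f : H₁) : H₁ :=
  f - η • ((n : ℝ)⁻¹ • ∑ j : Fin n,
    ((evalOp H₂ (z j).1 ∘L A' f)†) (A f (z j).1 - (z j).2))

/-- The gradient descent iterates `g_t`, `t ≥ 1`, started at `g_1`. (The value at `t = 0` is
irrelevant.) -/
def gdIter {n : ℕ} (z : Fin n → X × Y) (A : H₁ → H₂) (A' : H₁ → H₁ →L[ℝ] H₂) (η : ℝ)
    (g₁ : H₁) (t : ℕ) : H₁ :=
  (gdStep z A A' η)^[t - 1] g₁

end Problem

/-- The stopping time `T_n = ⌊η⁻¹ n ^ (1 / (min (2 r) 1 + ν + 1))⌋`. -/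
def stopTime (η r nu : ℝ) (n : ℕ) : ℕ :=
  ⌊η⁻¹ * (n : ℝ) ^ (1 / (min (2 * r) 1 + nu + 1))⌋₊

end

noncomputable section

universe u

/-! ### Eigenbases and spectral calculus of compact self-adjoint operators. -/

section EigenBasis

variable {H : Type*} [NormedAddCommGroup H] [InnerProductSpace ℝ H]
variable {ι : Type*}

/-! Put p = min(r, 1/2), λ = n^(-1/(2p+ν+1)), B = S A'(f†) and T = B†B. By range invariance, the
errors e_j = g_{j+1} − f† satisfy a perturbed linear Landweber iteration e_{j+1} = (1 − ηT) e_j − η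
(B† z_j + ν_j) with a quadratic nonlinearity ‖z_j‖ ≤ c ‖e_j‖ ‖B e_j‖ and sampling noise ν_j
(`exists_isPerturbedLandweber`). It runs for J steps with J of order 1/(ηλ). Neither c nor the
initial error is small, so the usual perturbation argument for source conditions does not close from
the start. The deterministic analysis (`exists_perturbedLandweber_rates`) has two phases.

Phase 1 (`exists_small_with_source`). The tangential cone condition gives an energy estimate: up to
noise, ‖e_j‖² drops by a multiple of ‖B e_j‖² in each step. Write e_j = T^p w_j + q_j, where q_j
collects the noise. One step multiplies ‖w_j‖² by at most 1 + C ‖B e_j‖²/‖e_j‖, and the energy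
estimate bounds ‖B e_j‖²/‖e_j‖ by a multiple of ‖e_j‖ − ‖e_{j+1}‖. This telescopes, so ‖w_j‖² exp(g
‖e_j‖) does not increase and the representer stays below a constant that does not depend on the
target size ε. By interpolation, a bounded representer and ‖e_j‖ > ε force a lower bound on ‖B e_j‖.
Hence the energy drops by a fixed amount per step, and the error falls below ε after a number of
steps that depends on the constants only.

Phase 2 (`rates_of_small`). From then on, the variation of constants formula and induction give
‖e_i‖ ≲ (i+1)^(-p) + s/√λ and ‖B e_i‖ ≲ (i+1)^(-(p+1/2)) + s, where s is the noise level. The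
nonlinear sum reproduces these rates times a weighted sum of the kernel 1/(k+1) + 1/(i−k).
Interpolating the bounds ε and K(k+1)^(-p) to √(εK) (k+1)^(-p/2) makes this factor small: the decay
sums the kernel and √ε supplies the smallness. Only the noise part of the weight produces a
logarithm, which is harmless since s/√λ decays like a power of 1/n.

The noise is measured relative to (L+λ)^(1/2). A Hilbert space Bernstein inequality, proved with
cosh ‖·‖ as potential, and the effective dimension bound give s of order log(6/δ) λ^(p+1/2)
(`exists_event_empirical`). At the stopping time both rates balance; the cases u = 0 and u = 1/2 are
the two bounds, because ‖T^(1/2) e‖ = ‖B e‖. The lower limit on δ bounds log(6/δ) in terms of d, and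
also forces d to exceed the a priori bound for the errors, so the iterates never leave the ball. -/

lemma HilbertBasis.hasSum_inner_sq (b : HilbertBasis ι ℝ H) (x : H) :
    HasSum (fun i => ⟪b i, x⟫ ^ 2) (‖x‖ ^ 2) := by
  have h := b.hasSum_inner_mul_inner x x
  rw [real_inner_self_eq_norm_sq] at h
  have h2 : (fun i => ⟪b i, x⟫ ^ 2) = fun i => ⟪x, b i⟫ * ⟪b i, x⟫ :=
    funext fun i => by rw [real_inner_comm x, pow_two]
  rw [h2]
  exact h

lemma HilbertBasis.ext_inner (b : HilbertBasis ι ℝ H) {x y : H}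
    (h : ∀ i, ⟪b i, x⟫ = ⟪b i, y⟫) : x = y := by
  apply b.repr.injective
  ext i
  simpa [b.repr_apply_apply] using h i

/-- Parseval. Most spectral estimates below are a scalar inequality for the eigenvalues passed
through this lemma. -/
lemma HilbertBasis.norm_le_of_abs_inner_le (b : HilbertBasis ι ℝ H) {x y : H} {c : ℝ} (hc : 0 ≤ c)
    (h : ∀ i, |⟪b i, y⟫| ≤ c * |⟪b i, x⟫|) : ‖y‖ ≤ c * ‖x‖ := by
  have h2 : ‖y‖ ^ 2 ≤ (c * ‖x‖) ^ 2 := by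
    rw [mul_pow]
    refine hasSum_le (fun i => ?_) (b.hasSum_inner_sq y) ((b.hasSum_inner_sq x).mul_left (c ^ 2))
    rw [← sq_abs, ← sq_abs ⟪b i, x⟫, ← mul_pow]
    gcongr
    exact h i
  exact (sq_le_sq₀ (norm_nonneg _) (by positivity)).mp h2

lemma HilbertBasis.exists_of_summable (b : HilbertBasis ι ℝ H) {c : ι → ℝ}
    (hc : Summable fun i => c i ^ 2) : ∃ x : H, ∀ i, ⟪b i, x⟫ = c i := by
  have hm : Memℓp c 2 := by
    rw [memℓp_gen_iff (by norm_num)]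
    simpa using hc
  refine ⟨b.repr.symm ⟨c, hm⟩, fun i => ?_⟩
  rw [← b.repr_apply_apply, LinearIsometryEquiv.apply_symm_apply]

lemma HilbertBasis.exists_diag (b : HilbertBasis ι ℝ H) {φ : ι → ℝ} {C : ℝ}
    (hφ : ∀ i, |φ i| ≤ C) : ∃ D : H →L[ℝ] H, ∀ x i, ⟪b i, D x⟫ = φ i * ⟪b i, x⟫ := by
  have hex : ∀ x : H, ∃ y : H, ∀ i, ⟪b i, y⟫ = φ i * ⟪b i, x⟫ := fun x => by
    refine b.exists_of_summable ?_
    refine Summable.of_nonneg_of_le (fun i => sq_nonneg _) (fun i => ?_)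
      ((b.hasSum_inner_sq x).summable.mul_left (C ^ 2))
    rw [mul_pow, ← sq_abs (φ i)]
    have := hφ i
    gcongr
  choose f hf using hex
  refine ⟨LinearMap.mkContinuous
    { toFun := f
      map_add' := fun x y => b.ext_inner fun i => ?_
      map_smul' := fun c x => b.ext_inner fun i => ?_ } (max C 0) fun x => ?_, hf⟩
  · rw [hf, inner_add_right, inner_add_right, hf, hf]; ring
  · rw [hf, RingHom.id_apply, inner_smul_right, inner_smul_right, hf]; ring
  · refine b.norm_le_of_abs_inner_le (le_max_right _ _) fun i => ?_
    simp only [LinearMap.coe_mk, AddHom.coe_mk]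
    rw [hf, abs_mul]
    have := (hφ i).trans (le_max_left C 0)
    gcongr

/-- The bounded operator which is diagonal in the Hilbert basis `b` with entries `φ`
(and zero if `φ` is unbounded). -/
def diagOp (b : HilbertBasis ι ℝ H) (φ : ι → ℝ) : H →L[ℝ] H :=
  open Classical in
  if h : ∃ C, ∀ i, |φ i| ≤ C then (b.exists_diag h.choose_spec).choose else 0

lemma inner_diagOp (b : HilbertBasis ι ℝ H) {φ : ι → ℝ} {C : ℝ} (hφ : ∀ i, |φ i| ≤ C)
    (x : H) (i : ι) : ⟪b i, diagOp b φ x⟫ = φ i * ⟪b i, x⟫ := by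
  have h : ∃ C, ∀ i, |φ i| ≤ C := ⟨C, hφ⟩
  rw [diagOp, dif_pos h]
  exact (b.exists_diag h.choose_spec).choose_spec x i

variable {T : H →L[ℝ] H} {μ : ι → ℝ}

lemma inner_apply_of_eigen (b : HilbertBasis ι ℝ H) (hT : ∀ x y, ⟪T x, y⟫ = ⟪x, T y⟫)
    (hb : ∀ i, T (b i) = μ i • b i) (x : H) (i : ι) : ⟪b i, T x⟫ = μ i * ⟪b i, x⟫ := by
  rw [← hT, hb, real_inner_smul_left]

/-- Bases of the single subspaces are concatenated. A vector orthogonal to all of them is orthogonal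
to each subspace, by expanding the elements of that subspace, and so vanishes. -/
lemma exists_hilbertBasis_of_orthogonalFamily [CompleteSpace H] {α : Type*}
    {V : α → Submodule ℝ H} (hcl : ∀ m, CompleteSpace (V m))
    (hfam : OrthogonalFamily ℝ (fun m => V m) fun m => (V m).subtypeₗᵢ)
    (hbot : (⨆ m, V m)ᗮ = ⊥) :
    ∃ b : HilbertBasis (Σ m : α, stdBasisSet (V m)) ℝ H, ∀ a, b a ∈ V a.1 := by
  have hON := hfam.orthonormal_sigma_orthonormal
    (v_family := fun m => stdBasis (V m)) (fun m => (stdBasis (V m)).orthonormal)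
  have hsp : (Submodule.span ℝ (Set.range fun a : Σ m : α, stdBasisSet (V m) =>
        (V a.1).subtypeₗᵢ (stdBasis (V a.1) a.2)))ᗮ = ⊥ := by
    rw [eq_bot_iff, ← hbot, ← Submodule.iInf_orthogonal]
    intro x hx
    rw [Submodule.mem_iInf]
    intro m
    rw [Submodule.mem_orthogonal]
    intro u hu
    have hsum := ((stdBasis (V m)).hasSum_repr ⟨u, hu⟩).mapL ((innerSL ℝ x) ∘L (V m).subtypeL)
    have hz : ∀ j : stdBasisSet (V m), ⟪x, ((stdBasis (V m) j : V m) : H)⟫ = 0 := fun j => by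
      rw [real_inner_comm]
      exact (Submodule.mem_orthogonal _ x).mp hx _ (Submodule.subset_span ⟨⟨m, j⟩, rfl⟩)
    have h0 : HasSum (fun _ : stdBasisSet (V m) => (0 : ℝ)) ⟪x, u⟫ := by
      have he : (fun _ : stdBasisSet (V m) => (0 : ℝ)) = fun j =>
          ((innerSL ℝ x) ∘L (V m).subtypeL) ((stdBasis (V m)).repr ⟨u, hu⟩ j • stdBasis (V m) j) :=
        funext fun j => by simp [hz j]
      rw [he]
      exact hsum
    rw [real_inner_comm]
    exact h0.unique hasSum_zero
  refine ⟨HilbertBasis.mkOfOrthogonalEqBot hON hsp, fun a => ?_⟩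
  rw [HilbertBasis.coe_mkOfOrthogonalEqBot]
  exact Submodule.coe_mem _

lemma isClosed_eigenspace (T : H →L[ℝ] H) (m : ℝ) :
    IsClosed ((Module.End.eigenspace (T : H →ₗ[ℝ] H) m : Submodule ℝ H) : Set H) := by
  have : ((Module.End.eigenspace (T : H →ₗ[ℝ] H) m : Submodule ℝ H) : Set H)
      = {x | T x = m • x} := by
    ext x; simp
  rw [this]
  exact isClosed_eq T.continuous (continuous_const_smul m)

/-- The spectral theorem for compact self-adjoint operators. The kernel is included as the
eigenspace of 0, so the eigenvectors span without further additions. -/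
lemma exists_eigenbasis {H : Type u} [NormedAddCommGroup H] [InnerProductSpace ℝ H]
    [CompleteSpace H] {T : H →L[ℝ] H} (hc : IsCompactOperator T)
    (hT : ∀ x y, ⟪T x, y⟫ = ⟪x, T y⟫) :
    ∃ (κ : Type u) (b : HilbertBasis κ ℝ H) (μ : κ → ℝ), ∀ i, T (b i) = μ i • b i := by
  have hsym : (T : H →ₗ[ℝ] H).IsSymmetric := hT
  have hcl : ∀ m : ℝ, CompleteSpace (Module.End.eigenspace (T : H →ₗ[ℝ] H) m) :=
    fun m => (isClosed_eigenspace T m).completeSpace_coe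
  have hbot := ContinuousLinearMap.orthogonalComplement_iSup_eigenspaces_eq_bot hc hsym
  obtain ⟨b, hb⟩ := exists_hilbertBasis_of_orthogonalFamily hcl hsym.orthogonalFamily_eigenspaces
    hbot
  refine ⟨_, b, fun a => a.1, fun a => ?_⟩
  exact Module.End.mem_eigenspace_iff.mp (hb a)

lemma mem_ker_sub_smul_iff {τ : ℝ} {x : H} :
    x ∈ (T - τ • ContinuousLinearMap.id ℝ H).ker ↔ T x = τ • x := by
  simp [LinearMap.mem_ker, sub_eq_zero]

lemma inner_eq_zero_of_eigen (hT : ∀ x y, ⟪T x, y⟫ = ⟪x, T y⟫) {σ τ : ℝ} (h : σ ≠ τ) {x y : H}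
    (hx : T x = σ • x) (hy : T y = τ • y) : ⟪x, y⟫ = 0 := by
  have h1 := hT x y
  rw [hx, hy, real_inner_smul_left, real_inner_smul_right] at h1
  have h2 : (σ - τ) * ⟪x, y⟫ = 0 := by linarith
  exact (mul_eq_zero.mp h2).resolve_left (sub_ne_zero.mpr h)

instance completeSpace_ker_sub_smul [CompleteSpace H] (T : H →L[ℝ] H) (τ : ℝ) :
    CompleteSpace (T - τ • ContinuousLinearMap.id ℝ H).ker :=
  (T - τ • ContinuousLinearMap.id ℝ H).isClosed_ker.completeSpace_coe

/-- A basis eigenvector either lies in the eigenspace, where the projection fixes it, or is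
orthogonal to it. -/
lemma inner_starProjection_ker [CompleteSpace H]
    (b : HilbertBasis ι ℝ H) (hT : ∀ x y, ⟪T x, y⟫ = ⟪x, T y⟫)
    (hb : ∀ i, T (b i) = μ i • b i) (τ : ℝ) (x : H) (i : ι) :
    ⟪b i, (T - τ • ContinuousLinearMap.id ℝ H).ker.starProjection x⟫ =
      if μ i = τ then ⟪b i, x⟫ else 0 := by
  rw [← Submodule.inner_starProjection_left_eq_right]
  split_ifs with h
  · rw [Submodule.starProjection_eq_self_iff.mpr (mem_ker_sub_smul_iff.mpr (h ▸ hb i))]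
  · rw [(Submodule.starProjection_apply_eq_zero_iff _).mpr, inner_zero_left]
    rw [Submodule.mem_orthogonal]
    intro u hu
    exact inner_eq_zero_of_eigen hT (Ne.symm h) (mem_ker_sub_smul_iff.mp hu) (hb i)

/-- `opPow` is a `tsum`, which would be 0 without summability. The terms lie in mutually orthogonal
eigenspaces, so it suffices to bound the partial sums. -/
lemma hasSum_rpow_smul_starProjection [CompleteSpace H] {s C : ℝ}
    (b : HilbertBasis ι ℝ H) (hT : ∀ x y, ⟪T x, y⟫ = ⟪x, T y⟫)
    (hb : ∀ i, T (b i) = μ i • b i) (hC : ∀ i, |μ i ^ s| ≤ C) (x : H) :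
    HasSum (fun τ : ℝ => τ ^ s • (T - τ • ContinuousLinearMap.id ℝ H).ker.starProjection x)
      (diagOp b (fun i => μ i ^ s) x) := by
  classical
  set P : ℝ → H := fun τ => (T - τ • ContinuousLinearMap.id ℝ H).ker.starProjection x with hP
  have hPmem : ∀ τ, P τ ∈ (T - τ • ContinuousLinearMap.id ℝ H).ker := fun τ =>
    Submodule.starProjection_apply_mem _ _
  have hin : ∀ i τ, ⟪b i, τ ^ s • P τ⟫ = if μ i = τ then μ i ^ s * ⟪b i, x⟫ else 0 := fun i τ => by
    rw [real_inner_smul_right, hP, inner_starProjection_ker b hT hb]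
    split_ifs with h
    · rw [h]
    · simp
  have horth : OrthogonalFamily ℝ (fun τ : ℝ => (T - τ • ContinuousLinearMap.id ℝ H).ker)
      fun τ => (T - τ • ContinuousLinearMap.id ℝ H).ker.subtypeₗᵢ := fun σ τ h u v =>
    inner_eq_zero_of_eigen hT h (mem_ker_sub_smul_iff.mp u.2) (mem_ker_sub_smul_iff.mp v.2)
  let f : ∀ τ : ℝ, (T - τ • ContinuousLinearMap.id ℝ H).ker := fun τ => τ ^ s • ⟨P τ, hPmem τ⟩
  have hs : Summable fun τ => τ ^ s • P τ := by
    refine (horth.summable_iff_norm_sq_summable f).mpr ?_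
    refine summable_of_sum_le (c := ‖diagOp b (fun i => μ i ^ s) x‖ ^ 2)
      (fun τ => sq_nonneg _) fun F => ?_
    rw [← horth.norm_sum f F]
    -- A partial sum keeps exactly the coordinates whose eigenvalue lies in `F`.
    have hle : ‖∑ τ ∈ F, τ ^ s • P τ‖ ≤ 1 * ‖diagOp b (fun i => μ i ^ s) x‖ := by
      refine b.norm_le_of_abs_inner_le zero_le_one fun i => ?_
      rw [inner_sum, Finset.sum_congr rfl fun τ _ => hin i τ, Finset.sum_ite_eq,
        inner_diagOp b hC, one_mul]
      split_ifs
      · exact le_rfl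
      · rw [abs_zero]; positivity
    rw [one_mul] at hle
    exact pow_le_pow_left₀ (norm_nonneg _) hle 2
  have heq : ∑' τ, τ ^ s • P τ = diagOp b (fun i => μ i ^ s) x := by
    refine b.ext_inner fun i => ?_
    rw [inner_diagOp b hC]
    have h1 := hs.hasSum.mapL (innerSL ℝ (b i))
    simp only [innerSL_apply_apply] at h1
    simp only [hin] at h1
    refine h1.unique ?_
    have h2 : (fun τ : ℝ => if μ i = τ then μ i ^ s * ⟪b i, x⟫ else 0) =
        fun τ => if τ = μ i then μ i ^ s * ⟪b i, x⟫ else 0 :=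
      funext fun τ => by simp only [eq_comm]
    rw [h2]
    exact hasSum_ite_eq (μ i) (μ i ^ s * ⟪b i, x⟫)
  rw [← heq]
  exact hs.hasSum

/-- In an eigenbasis, the power `T ^ s` acts by multiplication by the powers of the eigenvalues. -/
lemma opPow_eq_diagOp [CompleteSpace H] {s C : ℝ}
    (b : HilbertBasis ι ℝ H) (hT : ∀ x y, ⟪T x, y⟫ = ⟪x, T y⟫)
    (hb : ∀ i, T (b i) = μ i • b i) (hC : ∀ i, |μ i ^ s| ≤ C) (x : H) :
    opPow T s x = diagOp b (fun i => μ i ^ s) x :=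
  (hasSum_rpow_smul_starProjection b hT hb hC x).tsum_eq

end EigenBasis

end

noncomputable section

/-! ### Spectral estimates for the linear iteration 1 − η B†B. -/

section EigenSystem

variable {H E : Type*} [NormedAddCommGroup H] [InnerProductSpace ℝ H] [CompleteSpace H]
  [NormedAddCommGroup E] [InnerProductSpace ℝ E] [CompleteSpace E]
variable {ι : Type*}

/-- `b` is an orthonormal basis of eigenvectors of `B† B`, with eigenvalues `μ`, and `η` is a step
size with `η ‖B‖² ≤ 1`. -/
structure IsEigenSystem (B : H →L[ℝ] E) (b : HilbertBasis ι ℝ H) (μ : ι → ℝ) (η : ℝ) : Prop where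
  apply_basis : ∀ i, (B† ∘L B) (b i) = μ i • b i
  step_pos : 0 < η
  norm_le : η * ‖B‖ ^ 2 ≤ 1

namespace IsEigenSystem

variable {B : H →L[ℝ] E} {b : HilbertBasis ι ℝ H} {μ : ι → ℝ} {η : ℝ}

lemma symm_adjoint_comp (B : H →L[ℝ] E) (x y : H) :
    ⟪(B† ∘L B) x, y⟫ = ⟪x, (B† ∘L B) y⟫ := by
  simp [ContinuousLinearMap.adjoint_inner_left, ContinuousLinearMap.adjoint_inner_right]

variable (h : IsEigenSystem B b μ η)
include h

lemma inner_adjoint_comp (x : H) (i : ι) : ⟪b i, (B† ∘L B) x⟫ = μ i * ⟪b i, x⟫ :=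
  inner_apply_of_eigen b (symm_adjoint_comp B) h.apply_basis x i

lemma norm_apply_basis_sq (i : ι) : ‖B (b i)‖ ^ 2 = μ i := by
  have h1 := h.inner_adjoint_comp (b i) i
  rw [ContinuousLinearMap.comp_apply, ContinuousLinearMap.adjoint_inner_right,
    real_inner_self_eq_norm_sq, real_inner_self_eq_norm_sq, b.orthonormal.1 i] at h1
  linarith

lemma nonneg (i : ι) : 0 ≤ μ i := h.norm_apply_basis_sq i ▸ sq_nonneg _

lemma step_mul_le (i : ι) : η * μ i ≤ 1 := by
  have h1 := B.le_opNorm (b i)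
  rw [b.orthonormal.1 i, mul_one] at h1
  have := h.step_pos
  calc η * μ i = η * ‖B (b i)‖ ^ 2 := by rw [h.norm_apply_basis_sq]
    _ ≤ η * ‖B‖ ^ 2 := by gcongr
    _ ≤ 1 := h.norm_le

lemma step_mul_nonneg (i : ι) : 0 ≤ η * μ i := mul_nonneg h.step_pos.le (h.nonneg i)

lemma le_inv_step (i : ι) : μ i ≤ η⁻¹ := by
  rw [← one_div, le_div_iff₀' h.step_pos]
  exact h.step_mul_le i

lemma abs_rpow_le {s : ℝ} (hs : 0 ≤ s) (i : ι) : |μ i ^ s| ≤ η⁻¹ ^ s := by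
  rw [abs_of_nonneg (Real.rpow_nonneg (h.nonneg i) s)]
  exact Real.rpow_le_rpow (h.nonneg i) (h.le_inv_step i) hs

lemma inner_pow {s : ℝ} (hs : 0 ≤ s) (x : H) (i : ι) :
    ⟪b i, diagOp b (fun i => μ i ^ s) x⟫ = μ i ^ s * ⟪b i, x⟫ :=
  inner_diagOp b (h.abs_rpow_le hs) x i

lemma norm_pow_le {s : ℝ} (hs : 0 ≤ s) (x : H) :
    ‖diagOp b (fun i => μ i ^ s) x‖ ≤ η⁻¹ ^ s * ‖x‖ := by
  have := h.step_pos
  refine b.norm_le_of_abs_inner_le (by positivity) fun i => ?_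
  rw [h.inner_pow hs, abs_mul]
  gcongr
  exact h.abs_rpow_le hs i

lemma pow_pow {s t : ℝ} (hs : 0 ≤ s) (ht : 0 ≤ t) (x : H) :
    diagOp b (fun i => μ i ^ s) (diagOp b (fun i => μ i ^ t) x) =
      diagOp b (fun i => μ i ^ (s + t)) x := by
  refine b.ext_inner fun i => ?_
  rw [h.inner_pow hs, h.inner_pow ht, h.inner_pow (add_nonneg hs ht),
    Real.rpow_add_of_nonneg (h.nonneg i) hs ht, mul_assoc]

/-- Both squares are the expansion of ⟨x, B†B x⟩ in the eigenbasis. This turns every bound on the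
residual `B x` into a bound on a power of B†B. -/
lemma norm_half (x : H) : ‖diagOp b (fun i => μ i ^ (1 / 2 : ℝ)) x‖ = ‖B x‖ := by
  have h1 : HasSum (fun i => ⟪x, b i⟫ * ⟪b i, (B† ∘L B) x⟫) ⟪x, (B† ∘L B) x⟫ :=
    b.hasSum_inner_mul_inner x _
  have h2 := b.hasSum_inner_sq (diagOp b (fun i => μ i ^ (1 / 2 : ℝ)) x)
  have h3 : (fun i => ⟪b i, diagOp b (fun i => μ i ^ (1 / 2 : ℝ)) x⟫ ^ 2) =
      fun i => ⟪x, b i⟫ * ⟪b i, (B† ∘L B) x⟫ := funext fun i => by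
    rw [h.inner_pow (by norm_num), h.inner_adjoint_comp, mul_pow, ← Real.sqrt_eq_rpow,
      Real.sq_sqrt (h.nonneg i), real_inner_comm x]
    ring
  rw [h3] at h2
  have h4 := h2.unique h1
  rw [ContinuousLinearMap.comp_apply, ContinuousLinearMap.adjoint_inner_right,
    real_inner_self_eq_norm_sq] at h4
  exact (pow_left_inj₀ (norm_nonneg _) (norm_nonneg _) two_ne_zero).mp h4

lemma norm_apply_le (x : H) : ‖B x‖ ≤ η⁻¹ ^ (1 / 2 : ℝ) * ‖x‖ := by
  rw [← h.norm_half]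
  exact h.norm_pow_le (by norm_num) x

lemma inner_step_pow (m : ℕ) (x : H) (i : ι) :
    ⟪b i, ((1 - η • (B† ∘L B)) ^ m) x⟫ = (1 - η * μ i) ^ m * ⟪b i, x⟫ := by
  induction m generalizing x with
  | zero => simp
  | succ m ih =>
    have h1 := h.inner_adjoint_comp x i
    have h2 : ⟪b i, (1 - η • (B† ∘L B)) x⟫ = (1 - η * μ i) * ⟪b i, x⟫ := by
      rw [sub_apply, smul_apply, inner_sub_right,
        real_inner_smul_right, h1, one_apply_eq_self]
      ring
    rw [pow_succ, mul_apply_eq_comp, ih, h2]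
    ring

omit h in
-- For s = 1: (m+1)(1−x)^m is at most the geometric sum of the (1−x)^j with j ≤ m, and x times that
-- sum is at most 1. For general s take the s-th power and use (1−x)^m ≤ ((1−x)^m)^s.
lemma rpow_mul_pow_le {x s : ℝ} (hx₀ : 0 ≤ x) (hx₁ : x ≤ 1) (hs₀ : 0 ≤ s) (hs₁ : s ≤ 1) (m : ℕ) :
    x ^ s * (1 - x) ^ m ≤ ((m : ℝ) + 1) ^ (-s) := by
  have h0 : 0 ≤ 1 - x := by linarith
  have h1 : ((m : ℝ) + 1) * x * (1 - x) ^ m ≤ 1 := by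
    have hg : x * ∑ j ∈ Finset.range (m + 1), (1 - x) ^ j = 1 - (1 - x) ^ (m + 1) := by
      have := mul_neg_geom_sum (1 - x) (m + 1)
      rwa [sub_sub_cancel] at this
    have hle : ((m : ℝ) + 1) * (1 - x) ^ m ≤ ∑ j ∈ Finset.range (m + 1), (1 - x) ^ j := by
      have := Finset.card_nsmul_le_sum (Finset.range (m + 1)) (fun j => (1 - x) ^ j)
        ((1 - x) ^ m) fun j hj => pow_le_pow_of_le_one h0 (by linarith)
          (Nat.lt_succ_iff.mp (Finset.mem_range.mp hj))
      simpa using this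
    have : 0 ≤ (1 - x) ^ (m + 1) := by positivity
    nlinarith [mul_le_mul_of_nonneg_left hle hx₀]
  have hpos : (0 : ℝ) < (m : ℝ) + 1 := by positivity
  have h2 : (1 - x) ^ m ≤ ((1 - x) ^ m) ^ s := by
    have := Real.rpow_le_rpow_of_exponent_ge_of_imp (x := (1 - x) ^ m) (y := 1) (z := s)
      (by positivity) (pow_le_one₀ h0 (by linarith)) hs₁ (fun _ h => absurd h one_ne_zero)
    rwa [Real.rpow_one] at this
  calc x ^ s * (1 - x) ^ m ≤ x ^ s * ((1 - x) ^ m) ^ s := by gcongr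
    _ = (x * (1 - x) ^ m) ^ s := (Real.mul_rpow hx₀ (by positivity)).symm
    _ ≤ (((m : ℝ) + 1)⁻¹) ^ s := by
        refine Real.rpow_le_rpow (by positivity) ?_ hs₀
        rw [← one_div, le_div_iff₀ hpos]
        linarith
    _ = ((m : ℝ) + 1) ^ (-s) := by rw [Real.rpow_neg hpos.le, Real.inv_rpow hpos.le]

lemma norm_pow_step_pow_le {s : ℝ} (hs₀ : 0 ≤ s) (hs₁ : s ≤ 1) (m : ℕ) (x : H) :
    ‖diagOp b (fun i => μ i ^ s) (((1 - η • (B† ∘L B)) ^ m) x)‖ ≤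
      (η * ((m : ℝ) + 1)) ^ (-s) * ‖x‖ := by
  have hη := h.step_pos
  refine b.norm_le_of_abs_inner_le (by positivity) fun i => ?_
  rw [h.inner_pow hs₀, h.inner_step_pow, ← mul_assoc, abs_mul]
  have h1 := h.step_mul_le i
  have h0 := h.nonneg i
  refine mul_le_mul_of_nonneg_right ?_ (abs_nonneg _)
  have h3 : (0 : ℝ) ≤ 1 - η * μ i := by linarith
  rw [abs_of_nonneg (by positivity)]
  have h2 := rpow_mul_pow_le (h.step_mul_nonneg i) h1 hs₀ hs₁ m
  rw [Real.mul_rpow hη.le h0] at h2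
  rw [Real.mul_rpow hη.le (by positivity), Real.rpow_neg hη.le, ← div_eq_inv_mul, le_div_iff₀
    (by positivity)]
  linarith

lemma norm_step_pow_le (m : ℕ) (x : H) : ‖((1 - η • (B† ∘L B)) ^ m) x‖ ≤ ‖x‖ := by
  rw [← one_mul ‖x‖]
  refine b.norm_le_of_abs_inner_le zero_le_one fun i => ?_
  rw [h.inner_step_pow, abs_mul]
  have h1 := h.step_mul_le i
  have h0 := h.step_mul_nonneg i
  refine mul_le_mul_of_nonneg_right ?_ (abs_nonneg _)
  rw [abs_of_nonneg (pow_nonneg (by linarith) m)]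
  exact pow_le_one₀ (by linarith) (by linarith)

lemma step_pow_pow {s : ℝ} (hs : 0 ≤ s) (m : ℕ) (x : H) :
    ((1 - η • (B† ∘L B)) ^ m) (diagOp b (fun i => μ i ^ s) x) =
      diagOp b (fun i => μ i ^ s) (((1 - η • (B† ∘L B)) ^ m) x) := by
  refine b.ext_inner fun i => ?_
  rw [h.inner_step_pow, h.inner_pow hs, h.inner_pow hs, h.inner_step_pow]
  ring

lemma norm_apply_step_pow_le (m : ℕ) (x : H) :
    ‖B (((1 - η • (B† ∘L B)) ^ m) x)‖ ≤ (η * ((m : ℝ) + 1)) ^ (-(1 / 2) : ℝ) * ‖x‖ := by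
  rw [← h.norm_half]
  exact h.norm_pow_step_pow_le (by norm_num) (by norm_num) m x

lemma norm_step_pow_pow_le {s : ℝ} (hs₀ : 0 ≤ s) (hs₁ : s ≤ 1) (m : ℕ) (x : H) :
    ‖((1 - η • (B† ∘L B)) ^ m) (diagOp b (fun i => μ i ^ s) x)‖ ≤
      (η * ((m : ℝ) + 1)) ^ (-s) * ‖x‖ := by
  rw [h.step_pow_pow hs₀]
  exact h.norm_pow_step_pow_le hs₀ hs₁ m x

lemma norm_apply_step_pow_pow_le {s : ℝ} (hs₀ : 0 ≤ s) (hs₁ : s ≤ 1 / 2) (m : ℕ) (x : H) :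
    ‖B (((1 - η • (B† ∘L B)) ^ m) (diagOp b (fun i => μ i ^ s) x))‖ ≤
      (η * ((m : ℝ) + 1)) ^ (-(s + 1 / 2)) * ‖x‖ := by
  rw [← h.norm_half, h.step_pow_pow hs₀, h.pow_pow (by norm_num) hs₀, add_comm]
  exact h.norm_pow_step_pow_le (by positivity) (by linarith) m x

/-- `B†` factors through the square root of `B† B`. -/
lemma exists_half_eq_adjoint (z : E) :
    ∃ v : H, diagOp b (fun i => μ i ^ (1 / 2 : ℝ)) v = (B†) z ∧ ‖v‖ ≤ ‖z‖ := by
  classical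
  have hsq : ∀ i, (μ i ^ (1 / 2 : ℝ)) ^ 2 = μ i := fun i => by
    rw [← Real.sqrt_eq_rpow, Real.sq_sqrt (h.nonneg i)]
  -- The normalised images of the eigenvectors are orthonormal, so Bessel's inequality for z bounds
  -- the coordinates of the vector v.
  have hON : Orthonormal ℝ fun i : {i // μ i ≠ 0} =>
      (μ i ^ (1 / 2 : ℝ))⁻¹ • B (b i) := by
    rw [orthonormal_iff_ite]
    intro i j
    have h1 : ⟪B (b i), B (b j)⟫ = μ j * (if i = j then 1 else 0) := by
      have := h.inner_adjoint_comp (b j) i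
      rw [ContinuousLinearMap.comp_apply, ContinuousLinearMap.adjoint_inner_right] at this
      rw [this, orthonormal_iff_ite.mp b.orthonormal i j]
      by_cases hij : i = j
      · simp [hij]
      · simp [hij, Subtype.ext_iff.not.mp hij]
    rw [real_inner_smul_left, real_inner_smul_right, h1]
    split_ifs with hij
    · subst hij
      have hne : μ (i : ι) ^ (1 / 2 : ℝ) ≠ 0 := fun h0 => i.2 (by rw [← hsq, h0]; simp)
      field_simp
      rw [hsq]
    · simp
  have hsum := hON.inner_products_summable (x := z)
  have hbes := hON.tsum_inner_products_le (x := z)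
  let c : ι → ℝ := fun i => (μ i ^ (1 / 2 : ℝ))⁻¹ * ⟪B (b i), z⟫
  have hc : ∀ i : {i // μ i ≠ 0},
      c i ^ 2 = ‖⟪(μ i ^ (1 / 2 : ℝ))⁻¹ • B (b i), z⟫‖ ^ 2 := fun i => by
    rw [real_inner_smul_left, Real.norm_eq_abs, sq_abs]
  -- At a zero eigenvalue the inverse in `c` is 0⁻¹ = 0, so the coordinate of v vanishes there.
  have hsupp : Function.support (fun i => c i ^ 2) ⊆ {i | μ i ≠ 0} := fun i hi => by
    intro h0
    refine hi ?_
    have h0 : μ i = 0 := h0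
    simp [c, h0]
  have hcs : HasSum (fun i => c i ^ 2)
      (∑' i : {i // μ i ≠ 0}, ‖⟪(μ i ^ (1 / 2 : ℝ))⁻¹ • B (b i), z⟫‖ ^ 2) := by
    refine (hasSum_subtype_iff_of_support_subset hsupp).mp ?_
    have he : ((fun i => c i ^ 2) ∘ ((↑) : {i | μ i ≠ 0} → ι)) =
        fun i : {i // μ i ≠ 0} => ‖⟪(μ i ^ (1 / 2 : ℝ))⁻¹ • B (b i), z⟫‖ ^ 2 :=
      funext fun i => hc i
    rw [he]
    exact hsum.hasSum
  obtain ⟨v, hv⟩ := b.exists_of_summable hcs.summable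
  refine ⟨v, b.ext_inner fun i => ?_, ?_⟩
  · rw [h.inner_pow (by norm_num), hv, ContinuousLinearMap.adjoint_inner_right]
    by_cases hi : μ i = 0
    · have : B (b i) = 0 := by
        have := h.norm_apply_basis_sq i
        rw [hi] at this
        simpa using this
      rw [this, hi, inner_zero_left, Real.zero_rpow (by norm_num), zero_mul]
    · have hne : μ (i : ι) ^ (1 / 2 : ℝ) ≠ 0 := fun h0 => hi (by rw [← hsq, h0]; simp)
      simp only [c]
      field_simp
  · refine (sq_le_sq₀ (norm_nonneg _) (norm_nonneg _)).mp ?_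
    have h1 := b.hasSum_inner_sq v
    simp only [hv] at h1
    rw [h1.unique hcs]
    exact hbes

lemma norm_step_pow_adjoint_le (m : ℕ) (z : E) :
    ‖((1 - η • (B† ∘L B)) ^ m) ((B†) z)‖ ≤ (η * ((m : ℝ) + 1)) ^ (-(1 / 2) : ℝ) * ‖z‖ := by
  have hη := h.step_pos
  obtain ⟨v, hv, hvz⟩ := h.exists_half_eq_adjoint z
  rw [← hv]
  refine (h.norm_step_pow_pow_le (by norm_num) (by norm_num) m v).trans ?_
  gcongr

lemma norm_apply_step_pow_adjoint_le (m : ℕ) (z : E) :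
    ‖B (((1 - η • (B† ∘L B)) ^ m) ((B†) z))‖ ≤ (η * ((m : ℝ) + 1))⁻¹ * ‖z‖ := by
  have hη := h.step_pos
  obtain ⟨v, hv, hvz⟩ := h.exists_half_eq_adjoint z
  rw [← hv]
  refine (h.norm_apply_step_pow_pow_le (by norm_num) (by norm_num) m v).trans ?_
  rw [show -(1 / 2 + 1 / 2 : ℝ) = -1 by norm_num, Real.rpow_neg_one]
  gcongr

/-- The geometric sum collapses to 1 − (1−ημ)^m, which lies in [0, 1]. Adding the norms of the
single terms would cost a logarithm of m, so constant noise must be summed before taking norms. -/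
lemma norm_apply_sum_step_pow_adjoint_le (m : ℕ) (z : E) :
    ‖B (η • ∑ k ∈ Finset.range m, ((1 - η • (B† ∘L B)) ^ k) ((B†) z))‖ ≤ ‖z‖ := by
  obtain ⟨v, hv, hvz⟩ := h.exists_half_eq_adjoint z
  rw [← h.norm_half]
  refine le_trans ?_ hvz
  rw [← one_mul ‖v‖]
  refine b.norm_le_of_abs_inner_le zero_le_one fun i => ?_
  have h1 := h.step_mul_le i
  have h0 := h.step_mul_nonneg i
  rw [h.inner_pow (by norm_num), real_inner_smul_right, inner_sum]
  simp only [h.inner_step_pow, ← hv, h.inner_pow (show (0 : ℝ) ≤ 1 / 2 by norm_num)]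
  have h2 : μ i ^ (1 / 2 : ℝ) * (η * ∑ k ∈ Finset.range m,
      (1 - η * μ i) ^ k * (μ i ^ (1 / 2 : ℝ) * ⟪b i, v⟫)) = (1 - (1 - η * μ i) ^ m) * ⟪b i, v⟫ := by
    have hg := mul_neg_geom_sum (1 - η * μ i) m
    rw [sub_sub_cancel] at hg
    rw [← Finset.sum_mul, ← hg]
    have hsq : μ i ^ (1 / 2 : ℝ) * μ i ^ (1 / 2 : ℝ) = μ i := by
      rw [← Real.sqrt_eq_rpow, Real.mul_self_sqrt (h.nonneg i)]
    linear_combination (η * (∑ k ∈ Finset.range m, (1 - η * μ i) ^ k) * ⟪b i, v⟫) * hsq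
  rw [h2, abs_mul]
  have h3 : 0 ≤ (1 - η * μ i) ^ m := pow_nonneg (by linarith) m
  have h4 : (1 - η * μ i) ^ m ≤ 1 := pow_le_one₀ (by linarith) (by linarith)
  rw [abs_of_nonneg (by linarith : 0 ≤ 1 - (1 - η * μ i) ^ m)]
  gcongr
  linarith

/-- The interpolation inequality for the powers of `B† B`. -/
lemma norm_pow_mul_le {s θ : ℝ} (hs : 0 ≤ s) (hθ₀ : 0 ≤ θ) (hθ₁ : θ ≤ 1) (x : H) :
    ‖diagOp b (fun i => μ i ^ (s * θ)) x‖ ≤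
      ‖x‖ ^ (1 - θ) * ‖diagOp b (fun i => μ i ^ s) x‖ ^ θ := by
  have hsθ : 0 ≤ s * θ := mul_nonneg hs hθ₀
  rcases hθ₀.eq_or_lt with rfl | hθ
  · have : diagOp b (fun i => μ i ^ (s * 0)) x = x := b.ext_inner fun i => by
      rw [h.inner_pow (by simp)]; simp
    rw [this]; simp
  rcases (norm_nonneg x).eq_or_lt with hx | hx
  · have : x = 0 := norm_eq_zero.mp hx.symm
    subst this
    simp only [map_zero, norm_zero]
    positivity
  set y := diagOp b (fun i => μ i ^ s) x with hy
  rcases (norm_nonneg y).eq_or_lt with hy0 | hy0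
  · have hy' : y = 0 := norm_eq_zero.mp hy0.symm
    have : diagOp b (fun i => μ i ^ (s * θ)) x = 0 := b.ext_inner fun i => by
      have h1 := h.inner_pow hs x i
      rw [← hy, hy', inner_zero_right] at h1
      rw [h.inner_pow hsθ, inner_zero_right, Real.rpow_mul (h.nonneg i)]
      rcases mul_eq_zero.mp h1.symm with h2 | h2
      · rw [h2, Real.zero_rpow hθ.ne', zero_mul]
      · rw [h2, mul_zero]
    rw [this, norm_zero]
    positivity
  have hA : HasSum (fun i => ⟪b i, x⟫ ^ 2) (‖x‖ ^ 2) := b.hasSum_inner_sq x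
  have hB : HasSum (fun i => ⟪b i, y⟫ ^ 2) (‖y‖ ^ 2) := b.hasSum_inner_sq y
  have hC := b.hasSum_inner_sq (diagOp b (fun i => μ i ^ (s * θ)) x)
  -- Weighted AM-GM with a parameter c linearises the product coordinate by coordinate. For this
  -- value of c the sum of the linear bounds is exactly the square of the right side.
  set c := ‖y‖ ^ 2 / ‖x‖ ^ 2 with hc
  have hc0 : 0 < c := by positivity
  have hle : ∀ i, ⟪b i, diagOp b (fun i => μ i ^ (s * θ)) x⟫ ^ 2 ≤
      (1 - θ) * c ^ θ * ⟪b i, x⟫ ^ 2 + θ * c ^ (θ - 1) * ⟪b i, y⟫ ^ 2 := fun i => by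
    have hμ := h.nonneg i
    have hm : (0 : ℝ) ≤ (μ i ^ s) ^ 2 := by positivity
    have hag := Real.geom_mean_le_arith_mean2_weighted (w₁ := 1 - θ) (w₂ := θ) (p₁ := c)
      (p₂ := (μ i ^ s) ^ 2) (by linarith) hθ.le hc0.le hm (by ring)
    have hcθ : c ^ θ * c ^ (1 - θ) = c := by
      rw [← Real.rpow_add hc0]; simp
    have h1 : (μ i ^ (s * θ)) ^ 2 = ((μ i ^ s) ^ 2) ^ θ := by
      rw [Real.rpow_mul hμ, ← Real.rpow_natCast, ← Real.rpow_natCast,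
        ← Real.rpow_mul (by positivity) θ, ← Real.rpow_mul (by positivity) _ θ, mul_comm θ]
    have h2 : (μ i ^ (s * θ)) ^ 2 ≤ (1 - θ) * c ^ θ + θ * c ^ (θ - 1) * (μ i ^ s) ^ 2 := by
      have h3 : c ^ (θ - 1) * c ^ (1 - θ) = 1 := by
        rw [← Real.rpow_add hc0]; simp
      have h4 : c ^ (θ - 1) * c = c ^ θ := by
        rw [← Real.rpow_add_one hc0.ne']; simp
      have h5 := mul_le_mul_of_nonneg_left hag (Real.rpow_nonneg hc0.le (θ - 1))
      rw [h1]
      calc ((μ i ^ s) ^ 2) ^ θ = c ^ (θ - 1) * (c ^ (1 - θ) * ((μ i ^ s) ^ 2) ^ θ) := by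
            rw [← mul_assoc, h3, one_mul]
        _ ≤ _ := h5
        _ = _ := by rw [← h4]; ring
    rw [h.inner_pow hsθ, h.inner_pow hs, mul_pow, mul_pow]
    nlinarith [sq_nonneg ⟪b i, x⟫]
  have hsum := hasSum_le hle hC ((hA.mul_left _).add (hB.mul_left _))
  have hfin : (1 - θ) * c ^ θ * ‖x‖ ^ 2 + θ * c ^ (θ - 1) * ‖y‖ ^ 2 =
      (‖x‖ ^ (1 - θ) * ‖y‖ ^ θ) ^ 2 := by
    have h4 : c ^ (θ - 1) * c = c ^ θ := by
      rw [← Real.rpow_add_one hc0.ne']; simp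
    have h5 : ‖y‖ ^ 2 = c * ‖x‖ ^ 2 := by rw [hc]; field_simp
    have h6 : ‖x‖ ^ (1 - θ) * ‖y‖ ^ θ = ‖x‖ * (‖y‖ / ‖x‖) ^ θ := by
      rw [Real.div_rpow hy0.le hx.le, Real.rpow_sub hx, Real.rpow_one]; ring
    have h7 : c ^ θ = ((‖y‖ / ‖x‖) ^ θ) ^ 2 := by
      rw [hc, ← div_pow, ← Real.rpow_natCast, ← Real.rpow_natCast, ← Real.rpow_mul (by positivity),
        ← Real.rpow_mul (by positivity), mul_comm]
    rw [h6, mul_pow, ← h7, h5]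
    linear_combination θ * ‖x‖ ^ 2 * h4
  rw [hfin] at hsum
  exact (sq_le_sq₀ (norm_nonneg _) (by positivity)).mp hsum

end IsEigenSystem

end EigenSystem

end

noncomputable section

/-! ### Discrete kernel sums and a Gronwall estimate. -/

section ScalarEstimates

/-- Since γ ≤ 1, ((x+y)/x)^γ ≤ (x+y)/x. With x = k+1 and y = i−k this extracts the target rate
(i+1)^(-γ) from the k-th summand of the variation of constants formula and leaves the kernel 1/(k+1)
+ 1/(i−k). -/
lemma inv_mul_rpow_neg_le {x y γ : ℝ} (hx : 0 < x) (hy : 0 < y) (hγ₁ : γ ≤ 1) :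
    y⁻¹ * x ^ (-γ) ≤ (x + y) ^ (-γ) * (x⁻¹ + y⁻¹) := by
  have hτ : 0 < x + y := by positivity
  have h1 : 1 ≤ (x + y) / x := by rw [le_div_iff₀ hx]; linarith
  have h2 : ((x + y) / x) ^ γ ≤ (x + y) / x := by
    simpa using Real.rpow_le_rpow_of_exponent_le h1 hγ₁
  have h3 : x ^ (-γ) = (x + y) ^ (-γ) * ((x + y) / x) ^ γ := by
    rw [Real.div_rpow hτ.le hx.le, Real.rpow_neg hx.le, Real.rpow_neg hτ.le]
    field_simp
  rw [h3]
  calc y⁻¹ * ((x + y) ^ (-γ) * ((x + y) / x) ^ γ)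
      ≤ y⁻¹ * ((x + y) ^ (-γ) * ((x + y) / x)) := by gcongr
    _ = (x + y) ^ (-γ) * (x⁻¹ + y⁻¹) := by field_simp; ring

/-- The same extraction for the error norm. Here r ≤ 1/2 bounds ((x+y)/x)^r by a square root, and
√(x+y) ≤ √x + √y does the rest. -/
lemma rpow_neg_half_mul_rpow_neg_le {x y r : ℝ} (hx : 0 < x) (hy : 0 < y) (hr₁ : r ≤ 1 / 2) :
    y ^ (-(1 / 2) : ℝ) * x ^ (-(r + 1 / 2)) ≤ 2 * ((x + y) ^ (-r) * (x⁻¹ + y⁻¹)) := by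
  have hτ : 0 < x + y := by positivity
  have h1 : 1 ≤ (x + y) / x := by rw [le_div_iff₀ hx]; linarith
  have h2 : ((x + y) / x) ^ r ≤ √((x + y) / x) := by
    rw [Real.sqrt_eq_rpow]
    exact Real.rpow_le_rpow_of_exponent_le h1 hr₁
  have h3 : x ^ (-(r + 1 / 2)) = (x + y) ^ (-r) * ((x + y) / x) ^ r * (√x)⁻¹ := by
    rw [Real.div_rpow hτ.le hx.le, Real.rpow_neg hx.le, Real.rpow_neg hτ.le, Real.rpow_add hx,
      Real.sqrt_eq_rpow]
    field_simp
  have h4 : y ^ (-(1 / 2) : ℝ) = (√y)⁻¹ := by rw [Real.rpow_neg hy.le, Real.sqrt_eq_rpow]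
  have hsx := Real.sqrt_pos.mpr hx
  have hsy := Real.sqrt_pos.mpr hy
  have h5 : √(x + y) ≤ √x + √y := by
    rw [Real.sqrt_le_left (by positivity)]
    nlinarith [Real.sq_sqrt hx.le, Real.sq_sqrt hy.le, mul_pos hsx hsy]
  have h6 : (√x)⁻¹ * (√y)⁻¹ ≤ x⁻¹ + y⁻¹ := by
    have e1 : x⁻¹ = (√x)⁻¹ ^ 2 := by rw [inv_pow, Real.sq_sqrt hx.le]
    have e2 : y⁻¹ = (√y)⁻¹ ^ 2 := by rw [inv_pow, Real.sq_sqrt hy.le]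
    rw [e1, e2]
    nlinarith [sq_nonneg ((√x)⁻¹ - (√y)⁻¹), sq_nonneg ((√x)⁻¹), sq_nonneg ((√y)⁻¹)]
  have h7 : (√y)⁻¹ * (√((x + y) / x) * (√x)⁻¹) ≤ 2 * (x⁻¹ + y⁻¹) := by
    rw [Real.sqrt_div hτ.le]
    calc (√y)⁻¹ * (√(x + y) / √x * (√x)⁻¹) ≤ (√y)⁻¹ * ((√x + √y) / √x * (√x)⁻¹) := by gcongr
      _ = (√x)⁻¹ * (√y)⁻¹ + (√x ^ 2)⁻¹ := by field_simp
      _ = (√x)⁻¹ * (√y)⁻¹ + x⁻¹ := by rw [Real.sq_sqrt hx.le]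
      _ ≤ _ := by have := inv_pos.mpr hy; have := inv_pos.mpr hx; linarith
  rw [h3, h4]
  have hp : (0 : ℝ) ≤ (x + y) ^ (-r) := by positivity
  calc (√y)⁻¹ * ((x + y) ^ (-r) * ((x + y) / x) ^ r * (√x)⁻¹)
      ≤ (√y)⁻¹ * ((x + y) ^ (-r) * √((x + y) / x) * (√x)⁻¹) := by gcongr
    _ = (x + y) ^ (-r) * ((√y)⁻¹ * (√((x + y) / x) * (√x)⁻¹)) := by ring
    _ ≤ (x + y) ^ (-r) * (2 * (x⁻¹ + y⁻¹)) := by gcongr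
    _ = _ := by ring

lemma rpow_neg_half_le {x y : ℝ} (hx : 0 < x) (hy : 0 < y) :
    y ^ (-(1 / 2) : ℝ) ≤ √(x + y) * (x⁻¹ + y⁻¹) := by
  have h4 : y ^ (-(1 / 2) : ℝ) = √y * y⁻¹ := by
    rw [Real.rpow_neg hy.le, ← Real.sqrt_eq_rpow, ← div_eq_mul_inv, Real.sqrt_div_self]
  rw [h4]
  have : √y ≤ √(x + y) := Real.sqrt_le_sqrt (by linarith)
  have := inv_pos.mpr hx
  gcongr
  linarith

lemma inv_mul_rpow_neg_le_add {x y ρ : ℝ} (hx : 0 < x) (hy : 0 < y) (hρ : 0 ≤ ρ) :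
    (x⁻¹ + y⁻¹) * x ^ (-ρ) ≤ 2 * x ^ (-(1 + ρ)) + y ^ (-(1 + ρ)) := by
  have h : ∀ {t : ℝ}, 0 < t → t ^ (-(1 + ρ)) = t⁻¹ * t ^ (-ρ) := fun {t} ht => by
    rw [neg_add, Real.rpow_add ht, Real.rpow_neg_one]
  rw [h hx, h hy]
  have hix := inv_pos.mpr hx
  have hiy := inv_pos.mpr hy
  have px : 0 < x ^ (-ρ) := Real.rpow_pos_of_pos hx _
  have py : 0 < y ^ (-ρ) := Real.rpow_pos_of_pos hy _
  rcases le_total x y with hxy | hxy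
  · have : y⁻¹ ≤ x⁻¹ := inv_anti₀ hx hxy
    nlinarith [mul_le_mul_of_nonneg_right this px.le, mul_pos hiy py]
  · have : x ^ (-ρ) ≤ y ^ (-ρ) := by
      rw [Real.rpow_neg hx.le, Real.rpow_neg hy.le]
      exact inv_anti₀ (Real.rpow_pos_of_pos hy _) (Real.rpow_le_rpow hy.le hxy hρ)
    nlinarith [mul_le_mul_of_nonneg_left this hiy.le, mul_pos hix px]

lemma sum_range_reflect_cast (i : ℕ) (f : ℝ → ℝ) :
    ∑ k ∈ Finset.range i, f ((i : ℝ) - k) = ∑ k ∈ Finset.range i, f ((k : ℝ) + 1) := by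
  rw [← Finset.sum_range_reflect]
  refine Finset.sum_congr rfl fun k hk => ?_
  have hk := Finset.mem_range.mp hk
  congr 1
  have : (((i - 1 - k : ℕ) : ℝ)) = (i : ℝ) - 1 - k := by
    rw [Nat.cast_sub (by omega), Nat.cast_sub (by omega), Nat.cast_one]
  rw [this]
  ring

lemma sub_cast_pos {i k : ℕ} (hk : k ∈ Finset.range i) : (0 : ℝ) < (i : ℝ) - k := by
  have := Finset.mem_range.mp hk
  rw [sub_pos]
  exact_mod_cast this

/-- Up to constants, each product is at most (k+1)^(-(1+ρ)) + (i−k)^(-(1+ρ)), and both sums are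
partial sums of one convergent series. Any decay in k thus removes the logarithm of the bare kernel
sum. -/
lemma exists_sum_kernel_rpow_le {ρ : ℝ} (hρ : 0 < ρ) : ∃ Z : ℝ, 0 < Z ∧ ∀ i : ℕ,
    ∑ k ∈ Finset.range i, (((k : ℝ) + 1)⁻¹ + ((i : ℝ) - k)⁻¹) * ((k : ℝ) + 1) ^ (-ρ) ≤ Z := by
  have hs : Summable fun k : ℕ => ((k : ℝ) + 1) ^ (-(1 + ρ)) := by
    have := (summable_nat_add_iff 1).mpr (Real.summable_nat_rpow.mpr (by linarith : -(1 + ρ) < -1))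
    simpa using this
  have hpos : 0 ≤ ∑' k : ℕ, ((k : ℝ) + 1) ^ (-(1 + ρ)) := tsum_nonneg fun k => by positivity
  refine ⟨3 * ∑' k : ℕ, ((k : ℝ) + 1) ^ (-(1 + ρ)) + 1, by positivity, fun i => ?_⟩
  have h1 : ∑ k ∈ Finset.range i, ((k : ℝ) + 1) ^ (-(1 + ρ)) ≤
      ∑' k : ℕ, ((k : ℝ) + 1) ^ (-(1 + ρ)) :=
    hs.sum_le_tsum _ fun k _ => by positivity
  calc _ ≤ ∑ k ∈ Finset.range i,
        (2 * ((k : ℝ) + 1) ^ (-(1 + ρ)) + ((i : ℝ) - k) ^ (-(1 + ρ))) :=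
        Finset.sum_le_sum fun k hk =>
          inv_mul_rpow_neg_le_add (by positivity) (sub_cast_pos hk) hρ.le
    _ = 3 * ∑ k ∈ Finset.range i, ((k : ℝ) + 1) ^ (-(1 + ρ)) := by
        rw [Finset.sum_add_distrib, ← Finset.mul_sum,
          sum_range_reflect_cast i fun t => t ^ (-(1 + ρ))]
        ring
    _ ≤ _ := by linarith

/-- Twice a harmonic sum. This is the price of the part of the weight that does not decay in k. -/
lemma sum_kernel_le (i : ℕ) :
    ∑ k ∈ Finset.range i, (((k : ℝ) + 1)⁻¹ + ((i : ℝ) - k)⁻¹) ≤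
      2 * (1 + Real.log ((i : ℝ) + 1)) := by
  rw [Finset.sum_add_distrib, sum_range_reflect_cast i fun t => t⁻¹]
  have h := harmonic_le_one_add_log i
  have h2 : ((harmonic i : ℚ) : ℝ) = ∑ k ∈ Finset.range i, ((k : ℝ) + 1)⁻¹ := by
    simp [harmonic]
  rw [h2] at h
  have h3 : Real.log i ≤ Real.log ((i : ℝ) + 1) := by
    rcases Nat.eq_zero_or_pos i with rfl | hi
    · simp
    · exact Real.log_le_log (by exact_mod_cast hi) (by linarith)
  linarith

lemma sum_rpow_neg_half_le (i : ℕ) :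
    ∑ k ∈ Finset.range i, ((k : ℝ) + 1) ^ (-(1 / 2) : ℝ) ≤ 2 * √i := by
  induction i with
  | zero => simp
  | succ i ih =>
    rw [Finset.sum_range_succ]
    have hp : (0 : ℝ) < (i : ℝ) + 1 := by positivity
    have h1 : ((i : ℝ) + 1) ^ (-(1 / 2) : ℝ) = (√((i : ℝ) + 1))⁻¹ := by
      rw [Real.rpow_neg hp.le, Real.sqrt_eq_rpow]
    have hs := Real.sqrt_pos.mpr hp
    have h2 : 2 * √(i : ℝ) + (√((i : ℝ) + 1))⁻¹ ≤ 2 * √((i : ℝ) + 1) := by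
      rw [← sub_nonneg]
      have h3 : 2 * √((i : ℝ) + 1) - (2 * √(i : ℝ) + (√((i : ℝ) + 1))⁻¹) =
          (2 * √((i : ℝ) + 1) ^ 2 - 2 * √(i : ℝ) * √((i : ℝ) + 1) - 1) / √((i : ℝ) + 1) := by
        field_simp
        ring
      rw [h3]
      refine div_nonneg ?_ hs.le
      nlinarith [sq_nonneg (√((i : ℝ) + 1) - √(i : ℝ)), Real.sq_sqrt hp.le,
        Real.sq_sqrt (Nat.cast_nonneg (α := ℝ) i)]
    push_cast
    rw [h1]
    linarith

/-- A discrete Gronwall estimate which holds as long as the sequence stays below `X`. -/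
lemma gronwall_of_le {x : ℕ → ℝ} {q c X : ℝ} {J j₀ : ℕ} (hq : 0 ≤ q) (hc : 0 ≤ c)
    (hqJ : q * J ≤ 1) (hx : 0 ≤ x j₀) (hX : 3 * (x j₀ + J * c) ≤ X)
    (hstep : ∀ j < J, j₀ ≤ j → x j ≤ X → x (j + 1) ≤ (1 + q) * x j + c) :
    ∀ j, j₀ ≤ j → j ≤ J → x j ≤ 3 * (x j₀ + J * c) := by
  -- The constant 3 comes from (1+q)^i ≤ exp(qJ) ≤ e.
  have hexp : ∀ i : ℕ, i ≤ J → (1 + q) ^ i ≤ 3 := fun i hi => by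
    have h1 : (1 + q) ^ i ≤ Real.exp q ^ i :=
      pow_le_pow_left₀ (by linarith) (by linarith [Real.add_one_le_exp q]) i
    rw [← Real.exp_nat_mul] at h1
    have h2 : (i : ℝ) * q ≤ 1 := by
      have : (i : ℝ) ≤ J := by exact_mod_cast hi
      nlinarith
    have h3 := Real.exp_le_exp.mpr h2
    linarith [Real.exp_one_lt_d9]
  -- The growth bound and the uniform bound are proved together, since the recursion is available
  -- only while the sequence is below X.
  have key : ∀ i : ℕ, j₀ + i ≤ J → x (j₀ + i) ≤ (1 + q) ^ i * (x j₀ + i * c) ∧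
      x (j₀ + i) ≤ 3 * (x j₀ + J * c) := by
    intro i
    have hfin : j₀ + i ≤ J → x (j₀ + i) ≤ (1 + q) ^ i * (x j₀ + i * c) →
        x (j₀ + i) ≤ 3 * (x j₀ + J * c) := fun hi h => by
      have hiJ : i ≤ J := by omega
      have : (i : ℝ) ≤ J := by exact_mod_cast hiJ
      refine h.trans ?_
      have := hexp i hiJ
      gcongr
    induction i with
    | zero => exact fun h => ⟨by simp, hfin h (by simp)⟩
    | succ i ih =>
      intro h
      obtain ⟨h1, h2⟩ := ih (fun hi hle => by
        have hiJ : i ≤ J := by omega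
        have : (i : ℝ) ≤ J := by exact_mod_cast hiJ
        refine hle.trans ?_
        have := hexp i hiJ
        gcongr) (by omega)
      have h3 := hstep (j₀ + i) (by omega) (by omega) (h2.trans hX)
      have h4 : x (j₀ + (i + 1)) ≤ (1 + q) ^ (i + 1) * (x j₀ + (i + 1 : ℕ) * c) := by
        have h5 : (1 : ℝ) ≤ (1 + q) ^ (i + 1) := one_le_pow₀ (by linarith)
        calc x (j₀ + (i + 1)) ≤ (1 + q) * ((1 + q) ^ i * (x j₀ + i * c)) + 1 * c := by
              rw [one_mul]
              refine h3.trans ?_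
              gcongr
          _ ≤ (1 + q) * ((1 + q) ^ i * (x j₀ + i * c)) + (1 + q) ^ (i + 1) * c := by gcongr
          _ = _ := by push_cast; ring
      exact ⟨h4, hfin h h4⟩
  intro j hj hjJ
  obtain ⟨i, rfl⟩ := Nat.exists_eq_add_of_le hj
  exact (key i hjJ).2

end ScalarEstimates

end

noncomputable section

/-! ### The perturbed Landweber iteration and the growth of source representers in one step. -/

section Landweber

variable {H E : Type*} [NormedAddCommGroup H] [InnerProductSpace ℝ H] [CompleteSpace H]
  [NormedAddCommGroup E] [InnerProductSpace ℝ E] [CompleteSpace E]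
variable {ι : Type*} {B : H →L[ℝ] E} {b : HilbertBasis ι ℝ H} {μ : ι → ℝ} {η : ℝ}

/-- The errors `e j` of a Landweber iteration for the linear operator `B` with a nonlinearity
error `z j` and noise `ν j`. The noise is close to the constant noise `ν₀`, and `s` is the noise
level in the norm of `(B† B + lam) ^ (-1 / 2)`. The laws hold as long as `‖e j‖ ≤ X`. -/
structure IsPerturbedLandweber (B : H →L[ℝ] E) (η lam s X ce cz cs cn : ℝ) (J : ℕ)
    (e : ℕ → H) (z : ℕ → E) (ν : ℕ → H) (ν₀ : H) : Prop where
  step : ∀ j < J, ‖e j‖ ≤ X →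
    e (j + 1) = (1 - η • (B† ∘L B)) (e j) - η • ((B†) (z j) + ν j)
  nonlin : ∀ j < J, ‖e j‖ ≤ X → ‖z j‖ ≤ cz * (‖e j‖ * ‖B (e j)‖)
  energy : ∀ j < J, ‖e j‖ ≤ X →
    ‖e (j + 1)‖ ^ 2 ≤ (1 + η * lam) * ‖e j‖ ^ 2 - ce * ‖B (e j)‖ ^ 2 + cs * s ^ 2
  noise : ∀ j < J, ‖e j‖ ≤ X → ∀ x : H,
    |⟪x, ν j - ν₀⟫| ≤ s * (cn * (‖e j‖ * ‖B x‖ + √lam * ‖x‖))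
  noise_const : ∀ x : H, |⟪x, ν₀⟫| ≤ s * (cn * (‖B x‖ + √lam * ‖x‖))
  horizon : η * lam * J ≤ 1

namespace IsEigenSystem

lemma inner_pow_comm (h : IsEigenSystem B b μ η) {t : ℝ} (ht : 0 ≤ t) (x y : H) :
    ⟪diagOp b (fun i => μ i ^ t) x, y⟫ = ⟪x, diagOp b (fun i => μ i ^ t) y⟫ := by
  have h1 := b.hasSum_inner_mul_inner (diagOp b (fun i => μ i ^ t) x) y
  have h2 := b.hasSum_inner_mul_inner x (diagOp b (fun i => μ i ^ t) y)
  have h3 : (fun i => ⟪diagOp b (fun i => μ i ^ t) x, b i⟫ * ⟪b i, y⟫) =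
      fun i => ⟪x, b i⟫ * ⟪b i, diagOp b (fun i => μ i ^ t) y⟫ := funext fun i => by
    rw [real_inner_comm, h.inner_pow ht, h.inner_pow ht, real_inner_comm x]
    ring
  rw [h3] at h1
  exact h1.unique h2

/-- The cross term gives −2η‖B w‖², and η‖B‖² ≤ 1 lets the quadratic term cancel at most half of it.
The remaining gain pays for the nonlinearity in the growth of the representer. -/
lemma norm_sq_step_le (h : IsEigenSystem B b μ η) (w : H) :
    ‖(1 - η • (B† ∘L B)) w‖ ^ 2 ≤ ‖w‖ ^ 2 - η * ‖B w‖ ^ 2 := by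
  have hη := h.step_pos
  have h1 : ⟪w, (B† ∘L B) w⟫ = ‖B w‖ ^ 2 := by
    rw [ContinuousLinearMap.comp_apply, ContinuousLinearMap.adjoint_inner_right,
      real_inner_self_eq_norm_sq]
  have h2 : ‖(B† ∘L B) w‖ ^ 2 ≤ ‖B‖ ^ 2 * ‖B w‖ ^ 2 := by
    rw [← mul_pow]
    have := (B†).le_opNorm (B w)
    rw [LinearIsometryEquiv.norm_map] at this
    exact pow_le_pow_left₀ (norm_nonneg _) this 2
  have h3 : η ^ 2 * ‖(B† ∘L B) w‖ ^ 2 ≤ η * ‖B w‖ ^ 2 := by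
    calc η ^ 2 * ‖(B† ∘L B) w‖ ^ 2 ≤ η ^ 2 * (‖B‖ ^ 2 * ‖B w‖ ^ 2) := by gcongr
      _ = η * ‖B‖ ^ 2 * (η * ‖B w‖ ^ 2) := by ring
      _ ≤ 1 * (η * ‖B w‖ ^ 2) := by
          have := h.norm_le
          gcongr
      _ = _ := one_mul _
  rw [sub_apply, smul_apply, one_apply_eq_self, norm_sub_sq_real, norm_smul, mul_pow,
    real_inner_smul_right, h1, Real.norm_eq_abs, sq_abs]
  linarith

/-- The growth of a source representer in one step of the iteration. -/
lemma norm_sq_source_step_le (h : IsEigenSystem B b μ η) {r : ℝ} (hr₀ : 0 < r) (hr₁ : r ≤ 1 / 2)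
    (w v : H) :
    ‖(1 - η • (B† ∘L B)) w - η • diagOp b (fun i => μ i ^ (1 / 2 - r)) v‖ ^ 2 ≤
      ‖w‖ ^ 2 - η * ‖B w‖ ^ 2 + 2 * η * (‖w‖ ^ (2 * r) * ‖B w‖ ^ (1 - 2 * r) * ‖v‖) +
        η ^ 2 * (η⁻¹ ^ (1 / 2 - r) * ‖v‖) ^ 2 := by
  have hη := h.step_pos
  have ht : 0 ≤ 1 / 2 - r := by linarith
  -- The power moves to the other factor, commutes with the contraction 1 − η B†B, and is
  -- interpolated between ‖w‖ and ‖B w‖.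
  have h1 : |⟪(1 - η • (B† ∘L B)) w, diagOp b (fun i => μ i ^ (1 / 2 - r)) v⟫| ≤
      ‖w‖ ^ (2 * r) * ‖B w‖ ^ (1 - 2 * r) * ‖v‖ := by
    rw [← h.inner_pow_comm ht]
    refine (abs_real_inner_le_norm _ _).trans ?_
    gcongr
    have e1 := h.step_pow_pow ht 1 w
    rw [pow_one] at e1
    rw [← e1]
    have e2 := h.norm_step_pow_le 1 (diagOp b (fun i => μ i ^ (1 / 2 - r)) w)
    rw [pow_one] at e2
    refine e2.trans ?_
    have e3 := h.norm_pow_mul_le (s := 1 / 2) (θ := 1 - 2 * r) (by norm_num) (by linarith)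
      (by linarith) w
    rw [h.norm_half, sub_sub_cancel, show (1 / 2 : ℝ) * (1 - 2 * r) = 1 / 2 - r by ring] at e3
    exact e3
  rw [norm_sub_sq_real, real_inner_smul_right, norm_smul, mul_pow, Real.norm_eq_abs, sq_abs]
  have h2 := h.norm_sq_step_le w
  have h3 := h.norm_pow_le ht v
  have h4 : η ^ 2 * ‖diagOp b (fun i => μ i ^ (1 / 2 - r)) v‖ ^ 2 ≤
      η ^ 2 * (η⁻¹ ^ (1 / 2 - r) * ‖v‖) ^ 2 := by gcongr
  have h5 := neg_le_of_abs_le h1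
  nlinarith

end IsEigenSystem

/-- The constant in the estimate of the growth of the source representers. -/
def sourceGrowth (η r cz X : ℝ) : ℝ :=
  η * (16 * cz * X ^ (1 / 2 - r)) ^ (1 / (r + 1 / 2)) +
    η ^ 2 * (η⁻¹ ^ (1 / 2 - r) * (cz * (2 * η⁻¹ ^ r))) ^ 2 * X

lemma sourceGrowth_nonneg {η r cz X : ℝ} (hη : 0 < η) (hcz : 0 < cz) (hX : 0 < X) :
    0 ≤ sourceGrowth η r cz X := by
  unfold sourceGrowth; positivity

/-- The exponents add up to 2, so the product is at most the square of the larger number. -/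
lemma rpow_mul_rpow_le_sq_add_sq {n y r : ℝ} (hn : 0 ≤ n) (hy : 0 ≤ y) (hr₀ : 0 < r)
    (hr₁ : r ≤ 1 / 2) : n ^ (1 - 2 * r) * y ^ (1 + 2 * r) ≤ n ^ 2 + y ^ 2 := by
  have key : ∀ m : ℝ, 0 ≤ m → n ≤ m → y ≤ m → n ^ (1 - 2 * r) * y ^ (1 + 2 * r) ≤ m ^ 2 := by
    intro m hm hnm hym
    calc n ^ (1 - 2 * r) * y ^ (1 + 2 * r) ≤ m ^ (1 - 2 * r) * m ^ (1 + 2 * r) := by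
          gcongr
          linarith
      _ = m ^ (2 : ℝ) := by
          rw [← Real.rpow_add_of_nonneg hm (by linarith) (by linarith)]
          norm_num
      _ = m ^ 2 := Real.rpow_two m
  rcases le_total n y with hny | hny
  · exact (key y hy hny le_rfl).trans (by nlinarith [sq_nonneg n])
  · exact (key n hn le_rfl hny).trans (by nlinarith [sq_nonneg y])

/-- Here W = ‖w‖, n = ‖B w‖, a = ‖e‖, bb = ‖B e‖, P = ‖p‖ and β = ‖B p‖ with p = T^r w, ζ is the
size of the nonlinearity and W' the squared norm of the new representer. The cross term is split by
Young's inequality: one part is absorbed by the gain −η n², the other is at most a constant times W²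
bb²/a, because interpolation bounds a^(2r+1) by a multiple of W bb^(2r). -/
lemma source_growth_scalar {η r cz X W n a bb P β ζ W' : ℝ} (hη : 0 < η) (hr₀ : 0 < r)
    (hr₁ : r ≤ 1 / 2) (hcz : 0 < cz) (ha : 0 < a) (haX : a ≤ X) (hW : 0 < W)
    (hn : 0 ≤ n) (hb : 0 < bb) (hP : a ≤ 2 * P) (hβ₀ : 0 ≤ β) (hβ : β ≤ 2 * bb)
    (hint : P ^ (2 * r + 1) ≤ W * β ^ (2 * r)) (hPW : P ≤ η⁻¹ ^ r * W) (hζ₀ : 0 ≤ ζ)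
    (hζ : ζ ≤ cz * (a * bb))
    (hW' : W' ≤ W ^ 2 - η * n ^ 2 + 2 * η * (W ^ (2 * r) * n ^ (1 - 2 * r) * ζ) +
        η ^ 2 * (η⁻¹ ^ (1 / 2 - r) * ζ) ^ 2) :
    W' ≤ W ^ 2 * (1 + sourceGrowth η r cz X * (bb ^ 2 / a)) := by
  have hX : 0 < X := ha.trans_le haX
  have hP0 : 0 < P := by linarith
  set c := (16 * cz * X ^ (1 / 2 - r)) ^ (1 / (r + 1 / 2)) with hc
  have hc0 : 0 < c := by positivity
  have hcpow : c ^ (r + 1 / 2) = 16 * cz * X ^ (1 / 2 - r) := by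
    have hr' : r + 1 / 2 ≠ 0 := by positivity
    rw [hc, ← Real.rpow_mul (by positivity), one_div_mul_cancel hr', Real.rpow_one]
  -- Y has the size of the wanted growth: Y² = c W² bb²/a. The constant c is fixed so that 2 W^(2r)
  -- ζ ≤ Y^(1+2r); its factor 16 is 2 times the 8 in `e2`.
  set Y := W * bb * √(c / a) with hY
  have hY0 : 0 < Y := by positivity
  have hkey : 2 * W ^ (2 * r) * ζ ≤ Y ^ (1 + 2 * r) := by
    have e1 : Y ^ (1 + 2 * r) =
        W ^ (2 * r) * W * (bb ^ (2 * r) * bb) * (c ^ (r + 1 / 2) / a ^ (r + 1 / 2)) := by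
      rw [hY, Real.mul_rpow (by positivity) (by positivity), Real.mul_rpow hW.le hb.le,
        Real.sqrt_eq_rpow, ← Real.rpow_mul (by positivity), add_comm 1 (2 * r),
        Real.rpow_add_one hW.ne', Real.rpow_add_one hb.ne',
        show (1 / 2 : ℝ) * (2 * r + 1) = r + 1 / 2 by ring, Real.div_rpow hc0.le ha.le]
    have e2 : a ^ (2 * r + 1) ≤ 8 * (W * bb ^ (2 * r)) := by
      have f1 : (2 : ℝ) ^ (2 * r + 1) ≤ 2 ^ (2 : ℝ) :=
        Real.rpow_le_rpow_of_exponent_le (by norm_num) (by linarith)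
      have f2 : (2 : ℝ) ^ (2 * r) ≤ 2 ^ (1 : ℝ) :=
        Real.rpow_le_rpow_of_exponent_le (by norm_num) (by linarith)
      rw [Real.rpow_two] at f1
      rw [Real.rpow_one] at f2
      calc a ^ (2 * r + 1) ≤ (2 * P) ^ (2 * r + 1) := by gcongr
        _ = 2 ^ (2 * r + 1) * P ^ (2 * r + 1) := Real.mul_rpow (by norm_num) hP0.le
        _ ≤ 2 ^ 2 * (W * (2 * bb) ^ (2 * r)) := by
            gcongr
            refine hint.trans ?_
            gcongr
        _ = 2 ^ 2 * (W * (2 ^ (2 * r) * bb ^ (2 * r))) := by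
            rw [Real.mul_rpow (by norm_num) hb.le]
        _ ≤ 2 ^ 2 * (W * (2 * bb ^ (2 * r))) := by gcongr
        _ = _ := by ring
    have e3 : a * a ^ (r + 1 / 2) ≤ X ^ (1 / 2 - r) * a ^ (2 * r + 1) := by
      calc a * a ^ (r + 1 / 2) = a ^ (1 / 2 - r) * a ^ (2 * r + 1) := by
            rw [← Real.rpow_add ha, ← Real.rpow_one_add' ha.le (by positivity)]
            congr 1
            ring
        _ ≤ _ := by gcongr
    have e4 : 2 * cz * (a * a ^ (r + 1 / 2)) ≤ W * bb ^ (2 * r) * c ^ (r + 1 / 2) := by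
      rw [hcpow]
      calc 2 * cz * (a * a ^ (r + 1 / 2))
          ≤ 2 * cz * (X ^ (1 / 2 - r) * (8 * (W * bb ^ (2 * r)))) := by
            refine mul_le_mul_of_nonneg_left (e3.trans ?_) (by positivity)
            gcongr
        _ = _ := by ring
    rw [e1]
    have hap : 0 < a ^ (r + 1 / 2) := by positivity
    calc 2 * W ^ (2 * r) * ζ ≤ 2 * W ^ (2 * r) * (cz * (a * bb)) := by gcongr
      _ = W ^ (2 * r) * bb * (2 * cz * (a * a ^ (r + 1 / 2)) / a ^ (r + 1 / 2)) := by
          field_simp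
      _ ≤ W ^ (2 * r) * bb * ((W * bb ^ (2 * r) * c ^ (r + 1 / 2)) / a ^ (r + 1 / 2)) := by
          gcongr
      _ = _ := by ring
  have h1 : 2 * η * (W ^ (2 * r) * n ^ (1 - 2 * r) * ζ) ≤ η * (n ^ 2 + Y ^ 2) := by
    calc 2 * η * (W ^ (2 * r) * n ^ (1 - 2 * r) * ζ)
        = η * (n ^ (1 - 2 * r) * (2 * W ^ (2 * r) * ζ)) := by ring
      _ ≤ η * (n ^ (1 - 2 * r) * Y ^ (1 + 2 * r)) := by gcongr
      _ ≤ _ := by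
          gcongr
          exact rpow_mul_rpow_le_sq_add_sq hn hY0.le hr₀ hr₁
  have h2 : Y ^ 2 = c * (W ^ 2 * (bb ^ 2 / a)) := by
    rw [hY, mul_pow, Real.sq_sqrt (by positivity)]
    ring
  -- The quadratic term is brought to the form bb²/a by inserting X/a ≥ 1.
  have h3 : (η⁻¹ ^ (1 / 2 - r) * ζ) ^ 2 ≤
      (η⁻¹ ^ (1 / 2 - r) * (cz * (2 * η⁻¹ ^ r))) ^ 2 * X * (W ^ 2 * (bb ^ 2 / a)) := by
    have f1 : ζ ≤ cz * (2 * η⁻¹ ^ r) * (W * bb) := by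
      refine hζ.trans ?_
      calc cz * (a * bb) ≤ cz * (2 * (η⁻¹ ^ r * W) * bb) := by
            gcongr
            linarith
        _ = _ := by ring
    have f2 : 1 ≤ X / a := by rwa [one_le_div ha]
    calc (η⁻¹ ^ (1 / 2 - r) * ζ) ^ 2
        ≤ (η⁻¹ ^ (1 / 2 - r) * (cz * (2 * η⁻¹ ^ r) * (W * bb))) ^ 2 * 1 := by
          rw [mul_one]; gcongr
      _ ≤ (η⁻¹ ^ (1 / 2 - r) * (cz * (2 * η⁻¹ ^ r) * (W * bb))) ^ 2 * (X / a) := by gcongr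
      _ = _ := by ring
  have h4 : η ^ 2 * (η⁻¹ ^ (1 / 2 - r) * ζ) ^ 2 ≤
      η ^ 2 * ((η⁻¹ ^ (1 / 2 - r) * (cz * (2 * η⁻¹ ^ r))) ^ 2 * X * (W ^ 2 * (bb ^ 2 / a))) := by
    gcongr
  rw [h2] at h1
  unfold sourceGrowth
  rw [← hc]
  linarith

end Landweber

end

noncomputable section

/-! ### First phase: the error becomes small while the source representer stays bounded. -/

section Landweber

variable {H E : Type*} [NormedAddCommGroup H] [InnerProductSpace ℝ H] [CompleteSpace H]
  [NormedAddCommGroup E] [InnerProductSpace ℝ E] [CompleteSpace E]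
variable {ι : Type*} {B : H →L[ℝ] E} {b : HilbertBasis ι ℝ H} {μ : ι → ℝ} {η : ℝ}
variable {lam s X ce cz cs cn : ℝ} {J : ℕ} {e : ℕ → H} {z : ℕ → E} {ν : ℕ → H} {ν₀ : H}

namespace IsPerturbedLandweber

/-- The horizon J ≤ 1/(ηλ) turns the noise energy s² per step into the total (s/√λ)², up to
constants. -/
lemma mul_horizon_le (hL : IsPerturbedLandweber B η lam s X ce cz cs cn J e z ν ν₀)
    (hη : 0 < η) (hlam : 0 < lam) : (J : ℝ) * (cs * s ^ 2) ≤ cs * s ^ 2 / (η * lam) ∨ cs < 0 := by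
  rcases lt_or_ge cs 0 with h | h
  · exact Or.inr h
  · left
    rw [le_div_iff₀ (by positivity)]
    have := hL.horizon
    nlinarith [mul_nonneg h (sq_nonneg s)]

/-- The errors stay bounded. -/
lemma norm_sq_le (hL : IsPerturbedLandweber B η lam s X ce cz cs cn J e z ν ν₀)
    (hη : 0 < η) (hlam : 0 < lam) (hce : 0 ≤ ce) (hcs : 0 ≤ cs) {j₀ : ℕ}
    (hX : 3 * (‖e j₀‖ ^ 2 + cs / η * (s / √lam) ^ 2) ≤ X ^ 2) (hX₀ : 0 ≤ X) {j : ℕ}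
    (hj₀ : j₀ ≤ j) (hj : j ≤ J) :
    ‖e j‖ ^ 2 ≤ 3 * (‖e j₀‖ ^ 2 + cs / η * (s / √lam) ^ 2) := by
  have hJ : (J : ℝ) * (cs * s ^ 2) ≤ cs / η * (s / √lam) ^ 2 := by
    have h1 := (hL.mul_horizon_le hη hlam).resolve_right (not_lt.mpr hcs)
    rw [div_pow, Real.sq_sqrt hlam.le]
    convert h1 using 1
    field_simp
  have hle : 3 * (‖e j₀‖ ^ 2 + J * (cs * s ^ 2)) ≤
      3 * (‖e j₀‖ ^ 2 + cs / η * (s / √lam) ^ 2) := by linarith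
  refine (gronwall_of_le (x := fun j => ‖e j‖ ^ 2) (q := η * lam) (c := cs * s ^ 2) (by positivity)
    (by positivity) hL.horizon (by positivity) (hle.trans hX) (fun i hi _ hiX => ?_) j hj₀
    hj).trans hle
  have := hL.energy i hi ((sq_le_sq₀ (norm_nonneg _) hX₀).mp hiX)
  have := mul_nonneg hce (sq_nonneg ‖B (e i)‖)
  linarith

lemma norm_noise_le (hL : IsPerturbedLandweber B η lam s X ce cz cs cn J e z ν ν₀)
    (hs : 0 ≤ s) (hcn : 0 ≤ cn) {j : ℕ} (hj : j < J) (hX : ‖e j‖ ≤ X) (x : H) :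
    |⟪x, ν j⟫| ≤ s * (cn * ((X + 1) * ‖B x‖ + 2 * √lam * ‖x‖)) := by
  have h1 := hL.noise j hj hX x
  have h2 := hL.noise_const x
  have h3 : ⟪x, ν j⟫ = ⟪x, ν j - ν₀⟫ + ⟪x, ν₀⟫ := by rw [inner_sub_right]; ring
  rw [h3]
  refine (abs_add_le _ _).trans ((add_le_add h1 h2).trans ?_)
  rw [← mul_add, ← mul_add]
  have := mul_le_mul_of_nonneg_right hX (norm_nonneg (B x))
  refine mul_le_mul_of_nonneg_left (mul_le_mul_of_nonneg_left ?_ hcn) hs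
  linarith

/-- The weak bound is tested with the noise vector itself. -/
lemma norm_noise_le' (h : IsEigenSystem B b μ η)
    (hL : IsPerturbedLandweber B η lam s X ce cz cs cn J e z ν ν₀)
    (hlam₁ : lam ≤ 1) (hs : 0 ≤ s) (hcn : 0 ≤ cn) {j : ℕ} (hj : j < J) (hX : ‖e j‖ ≤ X) :
    ‖ν j‖ ≤ cn * ((X + 1) * η⁻¹ ^ (1 / 2 : ℝ) + 2) * s := by
  rcases (norm_nonneg (ν j)).eq_or_lt with h0 | h0
  · rw [← h0]
    have := h.step_pos
    have : 0 ≤ X := (norm_nonneg _).trans hX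
    positivity
  have h1 := hL.norm_noise_le hs hcn hj hX (ν j)
  rw [real_inner_self_eq_norm_sq, abs_of_nonneg (sq_nonneg _)] at h1
  have h2 := h.norm_apply_le (ν j)
  have h3 : √lam ≤ 1 := by rwa [Real.sqrt_le_one]
  have hX0 : 0 ≤ X := (norm_nonneg _).trans hX
  have h4 : s * (cn * ((X + 1) * ‖B (ν j)‖ + 2 * √lam * ‖ν j‖)) ≤
      s * (cn * ((X + 1) * (η⁻¹ ^ (1 / 2 : ℝ) * ‖ν j‖) + 2 * 1 * ‖ν j‖)) := by gcongr
  have h5 : ‖ν j‖ * ‖ν j‖ ≤ (cn * ((X + 1) * η⁻¹ ^ (1 / 2 : ℝ) + 2) * s) * ‖ν j‖ := by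
    linarith
  exact le_of_mul_le_mul_right h5 h0

/-- One step of the iteration while the error exceeds `ε`: the source representer grows at most
as much as the error decreases. -/
lemma exists_source_step (h : IsEigenSystem B b μ η)
    (hL : IsPerturbedLandweber B η lam s X ce cz cs cn J e z ν ν₀)
    {r ε Wb β₀ : ℝ} (hr₀ : 0 < r) (hr₁ : r ≤ 1 / 2) (hlam : 0 < lam)
    (hlam₁ : lam ≤ 1) (hs : 0 ≤ s) (hcn : 0 ≤ cn) (hcz : 0 < cz) (hce : 0 < ce)
    {j : ℕ} (hj : j < J) (hX : ‖e j‖ ≤ X) (hε : 0 < ε) (hεe : ε < ‖e j‖)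
    {w q : H} (hwq : e j = diagOp b (fun i => μ i ^ r) w + q) (hw : ‖w‖ ≤ Wb)
    (hWb : 0 < Wb) (hβ₀ : 0 < β₀) (hβε : (2 * β₀) ^ (2 * r) * Wb ≤ (ε / 2) ^ (2 * r + 1))
    (hq : ‖q‖ ≤ ε / 2) (hBq : η⁻¹ ^ (1 / 2 : ℝ) * ‖q‖ ≤ β₀)
    (hsmall : η * lam * X ^ 2 + cs * s ^ 2 ≤ ce / 2 * β₀ ^ 2) :
    ∃ w' q' : H, e (j + 1) = diagOp b (fun i => μ i ^ r) w' + q' ∧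
      ‖w'‖ ^ 2 * Real.exp (4 / ce * sourceGrowth η r cz X * ‖e (j + 1)‖) ≤
        ‖w‖ ^ 2 * Real.exp (4 / ce * sourceGrowth η r cz X * ‖e j‖) ∧
      ‖q'‖ ≤ ‖q‖ + η * (cn * ((X + 1) * η⁻¹ ^ (1 / 2 : ℝ) + 2) * s) ∧
      ‖e (j + 1)‖ ^ 2 ≤ ‖e j‖ ^ 2 - ce / 2 * β₀ ^ 2 := by
  have hη := h.step_pos
  have ha : 0 < ‖e j‖ := hε.trans hεe
  have hX0 : 0 < X := ha.trans_le hX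
  have ht : 0 ≤ 1 / 2 - r := by linarith
  -- Writing B† z_j = T^(1/2) v = T^r T^(1/2−r) v keeps the nonlinearity in the range of T^r. It is
  -- absorbed by the representer w, and only the noise enters q.
  obtain ⟨v, hv, hvz⟩ := h.exists_half_eq_adjoint (z j)
  set p := diagOp b (fun i => μ i ^ r) w with hp
  have hpa : ‖e j‖ ≤ 2 * ‖p‖ := by
    have := norm_add_le p q
    rw [← hwq] at this
    linarith
  have hpW : ‖p‖ ≤ η⁻¹ ^ r * ‖w‖ := h.norm_pow_le hr₀.le w
  have hW : 0 < ‖w‖ := by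
    by_contra h0
    have : ‖w‖ = 0 := le_antisymm (not_lt.mp h0) (norm_nonneg _)
    rw [this, mul_zero] at hpW
    linarith
  have hBp : diagOp b (fun i => μ i ^ (r + 1 / 2)) w = diagOp b (fun i => μ i ^ (1 / 2 : ℝ)) p := by
    rw [hp, h.pow_pow (by norm_num) hr₀.le, add_comm]
  -- Interpolation of T^r between the identity and T^(r+1/2), with θ = 2r/(2r+1).
  have hint : ‖p‖ ^ (2 * r + 1) ≤ ‖w‖ * ‖B p‖ ^ (2 * r) := by
    have h1 := h.norm_pow_mul_le (s := r + 1 / 2) (θ := 2 * r / (2 * r + 1)) (by positivity)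
      (by positivity) (by rw [div_le_one (by positivity)]; linarith) w
    have h2 : (r + 1 / 2) * (2 * r / (2 * r + 1)) = r := by field_simp
    rw [h2, hBp, h.norm_half, ← hp] at h1
    have h3 : 1 - 2 * r / (2 * r + 1) = 1 / (2 * r + 1) := by field_simp; ring
    rw [h3] at h1
    calc ‖p‖ ^ (2 * r + 1)
        ≤ (‖w‖ ^ (1 / (2 * r + 1)) * ‖B p‖ ^ (2 * r / (2 * r + 1))) ^ (2 * r + 1) := by gcongr
      _ = ‖w‖ * ‖B p‖ ^ (2 * r) := by
          have hne : 2 * r + 1 ≠ 0 := by positivity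
          rw [Real.mul_rpow (by positivity) (by positivity), ← Real.rpow_mul (norm_nonneg _),
            ← Real.rpow_mul (norm_nonneg _), one_div_mul_cancel hne, Real.rpow_one,
            div_mul_cancel₀ _ hne]
  -- As ‖p‖ ≥ ε/2 and the representer is at most Wb, interpolation keeps the residual away from
  -- zero.
  have hβp : 2 * β₀ ≤ ‖B p‖ := by
    have h1 : (2 * β₀) ^ (2 * r) ≤ ‖B p‖ ^ (2 * r) := by
      refine le_of_mul_le_mul_right ?_ hWb
      calc (2 * β₀) ^ (2 * r) * Wb ≤ (ε / 2) ^ (2 * r + 1) := hβε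
        _ ≤ ‖p‖ ^ (2 * r + 1) := by
            gcongr
            linarith
        _ ≤ ‖w‖ * ‖B p‖ ^ (2 * r) := hint
        _ ≤ Wb * ‖B p‖ ^ (2 * r) := by gcongr
        _ = _ := mul_comm _ _
    exact (Real.rpow_le_rpow_iff (by positivity) (norm_nonneg _) (by positivity)).mp h1
  have hBqβ : ‖B q‖ ≤ β₀ := (h.norm_apply_le q).trans hBq
  have hBe : B (e j) = B p + B q := by rw [hwq, map_add]
  have hBe1 : ‖B p‖ ≤ ‖B (e j)‖ + ‖B q‖ := by
    have : B p = B (e j) - B q := by rw [hBe]; abel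
    rw [this]; exact norm_sub_le _ _
  have hb₀ : β₀ ≤ ‖B (e j)‖ := by linarith
  have hb : 0 < ‖B (e j)‖ := hβ₀.trans_le hb₀
  have hW2 := source_growth_scalar hη hr₀ hr₁ hcz ha hX hW (norm_nonneg (B w)) hb hpa
    (norm_nonneg (B p)) (by linarith) hint hpW (norm_nonneg v)
    (hvz.trans (hL.nonlin j hj hX)) (h.norm_sq_source_step_le hr₀ hr₁ w v)
  have hen := hL.energy j hj hX
  -- Half of the energy gain absorbs the growth term and the noise, since ‖B e_j‖ ≥ β₀.
  have hen2 : ‖e (j + 1)‖ ^ 2 ≤ ‖e j‖ ^ 2 - ce / 2 * ‖B (e j)‖ ^ 2 := by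
    have h1 : ‖e j‖ ^ 2 ≤ X ^ 2 := by gcongr
    have h2 : η * lam * ‖e j‖ ^ 2 ≤ η * lam * X ^ 2 := by gcongr
    have h3 : ce / 2 * β₀ ^ 2 ≤ ce / 2 * ‖B (e j)‖ ^ 2 := by gcongr
    linarith
  -- A difference of squares is at most 2‖e_j‖ times the difference of the norms, so dividing by
  -- ‖e_j‖ leaves a telescoping bound.
  have hdec : ‖B (e j)‖ ^ 2 / ‖e j‖ ≤ 4 / ce * (‖e j‖ - ‖e (j + 1)‖) := by
    have hle : ‖e (j + 1)‖ ≤ ‖e j‖ := by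
      refine (sq_le_sq₀ (norm_nonneg _) (norm_nonneg _)).mp ?_
      have : 0 ≤ ce / 2 * ‖B (e j)‖ ^ 2 := by positivity
      linarith
    have h1 : ce / 2 * ‖B (e j)‖ ^ 2 ≤ (‖e j‖ - ‖e (j + 1)‖) * (2 * ‖e j‖) := by
      have h2 := mul_nonneg (sub_nonneg.mpr hle) (sub_nonneg.mpr hle)
      linarith
    rw [div_le_iff₀ ha]
    have h2 : ‖B (e j)‖ ^ 2 = 2 / ce * (ce / 2 * ‖B (e j)‖ ^ 2) := by field_simp
    rw [h2]
    calc 2 / ce * (ce / 2 * ‖B (e j)‖ ^ 2)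
        ≤ 2 / ce * ((‖e j‖ - ‖e (j + 1)‖) * (2 * ‖e j‖)) := by gcongr
      _ = _ := by ring
  refine ⟨(1 - η • (B† ∘L B)) w - η • diagOp b (fun i => μ i ^ (1 / 2 - r)) v,
    (1 - η • (B† ∘L B)) q - η • ν j, ?_, ?_, ?_, ?_⟩
  · rw [hL.step j hj hX, map_sub, map_smul, h.pow_pow hr₀.le ht, add_sub_cancel, hv, hwq, map_add]
    have := h.step_pow_pow hr₀.le 1 w
    rw [pow_one] at this
    rw [hp, this, smul_add]
    abel
  · set g := sourceGrowth η r cz X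
    have hg : 0 ≤ g := sourceGrowth_nonneg hη hcz hX0
    -- The growth factor becomes the exponential of a decrease of ‖e‖. This makes ‖w‖² exp(g‖e‖),
    -- with the factor 4/ce included in g, a Lyapunov function.
    have h1 : 1 + g * (‖B (e j)‖ ^ 2 / ‖e j‖) ≤
        Real.exp (4 / ce * g * (‖e j‖ - ‖e (j + 1)‖)) := by
      have h2 : g * (‖B (e j)‖ ^ 2 / ‖e j‖) ≤ g * (4 / ce * (‖e j‖ - ‖e (j + 1)‖)) := by gcongr
      have h3 := Real.add_one_le_exp (4 / ce * g * (‖e j‖ - ‖e (j + 1)‖))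
      linarith
    calc _ ≤ ‖w‖ ^ 2 * Real.exp (4 / ce * g * (‖e j‖ - ‖e (j + 1)‖)) *
          Real.exp (4 / ce * g * ‖e (j + 1)‖) := by
          gcongr
          refine hW2.trans ?_
          gcongr
      _ = _ := by
          rw [mul_assoc, ← Real.exp_add]
          congr 2
          ring
  · refine (norm_sub_le _ _).trans ?_
    have h1 := h.norm_step_pow_le 1 q
    rw [pow_one] at h1
    rw [norm_smul, Real.norm_of_nonneg hη.le]
    have := hL.norm_noise_le' h hlam₁ hs hcn hj hX
    gcongr
  · have : ce / 2 * β₀ ^ 2 ≤ ce / 2 * ‖B (e j)‖ ^ 2 := by gcongr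
    linarith

/-- The iteration becomes small while its source representer stays bounded. -/
lemma exists_small (h : IsEigenSystem B b μ η)
    (hL : IsPerturbedLandweber B η lam s X ce cz cs cn J e z ν ν₀)
    {r ε Wb β₀ : ℝ} {t₀ : ℕ} {w₀ : H} (hr₀ : 0 < r) (hr₁ : r ≤ 1 / 2) (hlam : 0 < lam)
    (hlam₁ : lam ≤ 1) (hs : 0 ≤ s) (hcn : 0 ≤ cn) (hcz : 0 < cz) (hce : 0 < ce) (hX : 0 < X)
    (hε : 0 < ε) (hWb0 : 0 < Wb) (hβ₀ : 0 < β₀)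
    (hβε : (2 * β₀) ^ (2 * r) * Wb ≤ (ε / 2) ^ (2 * r + 1))
    (hqs : t₀ * (η * (cn * ((X + 1) * η⁻¹ ^ (1 / 2 : ℝ) + 2))) * s ≤ ε / 2)
    (hBqs : η⁻¹ ^ (1 / 2 : ℝ) * (t₀ * (η * (cn * ((X + 1) * η⁻¹ ^ (1 / 2 : ℝ) + 2))) * s) ≤ β₀)
    (hsmall : η * lam * X ^ 2 + cs * s ^ 2 ≤ ce / 2 * β₀ ^ 2) (ht₀J : t₀ ≤ J)
    (ht₀ : X ^ 2 / (ce / 2 * β₀ ^ 2) < t₀) (hbd : ∀ j ≤ J, ‖e j‖ ≤ X)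
    (he0 : e 0 = diagOp b (fun i => μ i ^ r) w₀)
    (hw₀ : ‖w₀‖ ^ 2 * Real.exp (4 / ce * sourceGrowth η r cz X * X) ≤ Wb ^ 2) :
    ∃ j ≤ t₀, ‖e j‖ ≤ ε ∧ ∃ w q, e j = diagOp b (fun i => μ i ^ r) w + q ∧
      ‖w‖ ≤ Wb ∧ ‖q‖ ≤ t₀ * (η * (cn * ((X + 1) * η⁻¹ ^ (1 / 2 : ℝ) + 2))) * s := by
  have hη := h.step_pos
  set g := 4 / ce * sourceGrowth η r cz X with hg
  have hg0 : 0 ≤ g := mul_nonneg (by positivity) (sourceGrowth_nonneg hη hcz hX)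
  set δ := ce / 2 * β₀ ^ 2 with hδ
  have hδ0 : 0 < δ := by positivity
  set cν := cn * ((X + 1) * η⁻¹ ^ (1 / 2 : ℝ) + 2) with hcν
  have hcν0 : 0 ≤ cν := by positivity
  -- Either a small error has occurred already, or all invariants persist and the squared error has
  -- lost δ in each step.
  have key : ∀ j ≤ t₀, (∃ i ≤ j, ‖e i‖ ≤ ε ∧ ∃ w q, e i = diagOp b (fun i => μ i ^ r) w + q ∧
      ‖w‖ ≤ Wb ∧ ‖q‖ ≤ t₀ * (η * cν) * s) ∨ (∃ w q, e j = diagOp b (fun i => μ i ^ r) w + q ∧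
      ‖w‖ ^ 2 * Real.exp (g * ‖e j‖) ≤ Wb ^ 2 ∧ ‖q‖ ≤ j * (η * cν) * s ∧
      ‖e j‖ ^ 2 ≤ X ^ 2 - j * δ) := by
    intro j
    induction j with
    | zero =>
      intro _
      right
      refine ⟨w₀, 0, by rw [he0, add_zero], ?_, by simp, ?_⟩
      · refine le_trans ?_ hw₀
        have := hbd 0 (Nat.zero_le _)
        gcongr
      · have := hbd 0 (Nat.zero_le _)
        simp only [Nat.cast_zero, zero_mul, sub_zero]
        gcongr
    | succ j ih =>
      intro hj
      rcases ih (by omega) with ⟨i, hi, hgood⟩ | ⟨w, q, hwq, hw, hq, he⟩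
      · exact Or.inl ⟨i, by omega, hgood⟩
      have hwWb : ‖w‖ ≤ Wb := by
        refine (sq_le_sq₀ (norm_nonneg _) hWb0.le).mp (le_trans ?_ hw)
        have : 1 ≤ Real.exp (g * ‖e j‖) := Real.one_le_exp (by positivity)
        exact le_mul_of_one_le_right (sq_nonneg _) this
      have hqC : ‖q‖ ≤ t₀ * (η * cν) * s := by
        refine hq.trans ?_
        have : (j : ℝ) ≤ t₀ := by exact_mod_cast (by omega : j ≤ t₀)
        gcongr
      rcases le_or_gt ‖e j‖ ε with hle | hgt
      · exact Or.inl ⟨j, by omega, hle, w, q, hwq, hwWb, hqC⟩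
      right
      have hq1 : ‖q‖ ≤ ε / 2 := hqC.trans hqs
      have hq2 : η⁻¹ ^ (1 / 2 : ℝ) * ‖q‖ ≤ β₀ :=
        (mul_le_mul_of_nonneg_left hqC (by positivity)).trans hBqs
      obtain ⟨w', q', e1, e2, e3, e4⟩ := hL.exists_source_step h hr₀ hr₁ hlam
        hlam₁ hs hcn hcz hce (by omega : j < J) (hbd j (by omega)) hε hgt hwq hwWb hWb0
        hβ₀ hβε hq1 hq2 hsmall
      refine ⟨w', q', e1, e2.trans hw, e3.trans ?_, e4.trans ?_⟩
      · push_cast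
        linarith
      · push_cast
        linarith
  rcases key t₀ le_rfl with hgood | ⟨_, _, _, _, _, he⟩
  · exact hgood
  -- After t₀ > X²/δ such steps the squared error would be negative.
  · exfalso
    rw [div_lt_iff₀ hδ0] at ht₀
    have := sq_nonneg ‖e t₀‖
    linarith


end IsPerturbedLandweber

end Landweber

/-- The iteration becomes small after a number of steps that depends on the constants only, and
then satisfies a source condition with a constant that does not depend on how small it is. -/
lemma exists_small_with_source {r η ce cz cs cn X W₀ : ℝ} (hr₀ : 0 < r) (hr₁ : r ≤ 1 / 2)
    (hη : 0 < η) (hce : 0 < ce) (hcz : 0 < cz) (hcs : 0 ≤ cs) (hcn : 0 ≤ cn) (hX : 0 < X)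
    (hW₀ : 0 < W₀) :
    ∃ Wb : ℝ, 0 < Wb ∧ ∀ ε : ℝ, 0 < ε → ∃ (t₀ : ℕ) (κ Cq : ℝ), 0 < κ ∧ 0 ≤ Cq ∧
      ∀ {H E : Type*} [NormedAddCommGroup H] [InnerProductSpace ℝ H] [CompleteSpace H]
        [NormedAddCommGroup E] [InnerProductSpace ℝ E] [CompleteSpace E]
        {ι : Type*} {B : H →L[ℝ] E} {b : HilbertBasis ι ℝ H} {μ : ι → ℝ} {lam s : ℝ} {J : ℕ}
        {e : ℕ → H} {z : ℕ → E} {ν : ℕ → H} {ν₀ : H},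
        IsEigenSystem B b μ η → IsPerturbedLandweber B η lam s X ce cz cs cn J e z ν ν₀ →
        0 < lam → lam ≤ κ → 0 ≤ s → s ≤ κ → t₀ ≤ J → (∀ j ≤ J, ‖e j‖ ≤ X) →
        (∃ w₀, e 0 = diagOp b (fun i => μ i ^ r) w₀ ∧ ‖w₀‖ ≤ W₀) →
        ∃ j ≤ t₀, ‖e j‖ ≤ ε ∧ ∃ w q, e j = diagOp b (fun i => μ i ^ r) w + q ∧
          ‖w‖ ≤ Wb ∧ ‖q‖ ≤ Cq * s := by
  set g := 4 / ce * sourceGrowth η r cz X with hg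
  have hg0 : 0 ≤ g := mul_nonneg (by positivity) (sourceGrowth_nonneg hη hcz hX)
  -- The initial value of the Lyapunov function bounds all later representers; ε does not enter.
  set Wb := √(W₀ ^ 2 * Real.exp (g * X)) with hWb
  have hWb0 : 0 < Wb := Real.sqrt_pos.mpr (by positivity)
  have hWb2 : Wb ^ 2 = W₀ ^ 2 * Real.exp (g * X) := Real.sq_sqrt (by positivity)
  refine ⟨Wb, hWb0, fun ε hε => ?_⟩
  -- The solution of (2β₀)^(2r) Wb = (ε/2)^(2r+1), the residual bound forced by interpolation.
  set β₀ := ((ε / 2) ^ (2 * r + 1) / Wb) ^ (1 / (2 * r)) / 2 with hβ₀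
  have hβ₀0 : 0 < β₀ := by positivity
  have hβε : (2 * β₀) ^ (2 * r) * Wb ≤ (ε / 2) ^ (2 * r + 1) := by
    have hne : 2 * r ≠ 0 := by positivity
    rw [hβ₀, mul_div_cancel₀ _ (two_ne_zero), ← Real.rpow_mul (by positivity),
      one_div_mul_cancel hne, Real.rpow_one, div_mul_cancel₀ _ hWb0.ne']
  set δ := ce / 2 * β₀ ^ 2 with hδ
  have hδ0 : 0 < δ := by positivity
  obtain ⟨t₀, ht₀⟩ := exists_nat_gt (X ^ 2 / δ)
  set cν := cn * ((X + 1) * η⁻¹ ^ (1 / 2 : ℝ) + 2) with hcν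
  have hcν0 : 0 ≤ cν := by positivity
  set Cq := t₀ * (η * cν) with hCq
  have hCq0 : 0 ≤ Cq := by positivity
  set ζ := η⁻¹ ^ (1 / 2 : ℝ) with hζ
  have hζ0 : 0 < ζ := by positivity
  -- The second entry keeps the accumulated noise q below ε/2 and its residual below β₀. The third
  -- keeps the noise energy below half of the energy gain.
  set κ := min 1 (min (min (ε / 2) (β₀ / ζ) / (Cq + 1)) (δ / (η * X ^ 2 + cs))) with hκ
  have hden : 0 < η * X ^ 2 + cs := by positivity
  have hκ0 : 0 < κ := by positivity
  refine ⟨t₀, κ, Cq, hκ0, hCq0, ?_⟩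
  intro H E _ _ _ _ _ _ ι B b μ lam s J e z ν ν₀ h hL hlam hlamκ hs hsκ ht₀J hbd ⟨w₀, he0, hw₀⟩
  have hκ1 : κ ≤ 1 := min_le_left _ _
  have hκ2 : κ ≤ min (ε / 2) (β₀ / ζ) / (Cq + 1) := (min_le_right _ _).trans (min_le_left _ _)
  have hκ3 : κ ≤ δ / (η * X ^ 2 + cs) := (min_le_right _ _).trans (min_le_right _ _)
  have hsmall : η * lam * X ^ 2 + cs * s ^ 2 ≤ ce / 2 * β₀ ^ 2 := by
    have h1 : κ * (η * X ^ 2 + cs) ≤ δ := by rwa [le_div_iff₀ hden] at hκ3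
    have h2 : s ^ 2 ≤ κ := (pow_le_of_le_one hs (hsκ.trans hκ1) two_ne_zero).trans hsκ
    calc η * lam * X ^ 2 + cs * s ^ 2 ≤ η * κ * X ^ 2 + cs * κ := by gcongr
      _ = κ * (η * X ^ 2 + cs) := by ring
      _ ≤ δ := h1
  have hqs : Cq * s ≤ min (ε / 2) (β₀ / ζ) := by
    rw [le_div_iff₀ (by positivity)] at hκ2
    have := mul_le_mul_of_nonneg_left hsκ hCq0
    linarith
  exact hL.exists_small h hr₀ hr₁ hlam (hlamκ.trans hκ1) hs hcn hcz hce hX hε hWb0 hβ₀0 hβε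
    (hqs.trans (min_le_left _ _))
    (by
      have := hqs.trans (min_le_right _ _)
      rwa [le_div_iff₀ hζ0, mul_comm] at this)
    hsmall ht₀J ht₀ hbd he0 (by rw [hWb2]; gcongr)

end

noncomputable section

/-! ### Noise propagation by duality, and the variation of constants formula. -/

section Landweber

variable {H E : Type*} [NormedAddCommGroup H] [InnerProductSpace ℝ H] [CompleteSpace H]
  [NormedAddCommGroup E] [InnerProductSpace ℝ E] [CompleteSpace E]
variable {ι : Type*} {B : H →L[ℝ] E} {b : HilbertBasis ι ℝ H} {μ : ι → ℝ} {η : ℝ}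
variable {lam s X ce cz cs cn : ℝ} {J : ℕ} {e : ℕ → H} {z : ℕ → E} {ν : ℕ → H} {ν₀ : H}

lemma norm_le_of_abs_inner_le {F : Type*} [NormedAddCommGroup F] [InnerProductSpace ℝ F]
    {u : F} {c : ℝ} (hc : 0 ≤ c) (h : ∀ x : F, |⟪x, u⟫| ≤ c * ‖x‖) : ‖u‖ ≤ c := by
  rcases (norm_nonneg u).eq_or_lt with h0 | h0
  · rwa [← h0]
  · have h1 := h u
    rw [real_inner_self_eq_norm_sq, abs_of_nonneg (sq_nonneg _), pow_two] at h1
    exact le_of_mul_le_mul_right h1 h0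

lemma inner_step_pow_comm (B : H →L[ℝ] E) (η : ℝ) (m : ℕ) (x y : H) :
    ⟪((1 - η • (B† ∘L B)) ^ m) x, y⟫ = ⟪x, ((1 - η • (B† ∘L B)) ^ m) y⟫ := by
  induction m generalizing x y with
  | zero => simp
  | succ m ih =>
    have h1 : ∀ x y : H, ⟪(1 - η • (B† ∘L B)) x, y⟫ = ⟪x, (1 - η • (B† ∘L B)) y⟫ := fun x y => by
      simp only [sub_apply, smul_apply, one_apply_eq_self, inner_sub_left, inner_sub_right,
        real_inner_smul_left, real_inner_smul_right, IsEigenSystem.symm_adjoint_comp]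
    rw [pow_succ, mul_apply_eq_comp, ih, h1, ← mul_apply_eq_comp, ← pow_succ', pow_succ]

namespace IsEigenSystem

variable {A D : ℝ} {u : H}

/-- The noise is known only through test vectors. Moving the self-adjoint power onto the test vector
lets the smoothing estimates act there. -/
lemma norm_step_pow_noise_le (h : IsEigenSystem B b μ η) (hA : 0 ≤ A) (hD : 0 ≤ D)
    (hu : ∀ x, |⟪x, u⟫| ≤ A * ‖B x‖ + D * ‖x‖) (m : ℕ) :
    ‖((1 - η • (B† ∘L B)) ^ m) u‖ ≤ A * (η * ((m : ℝ) + 1)) ^ (-(1 / 2) : ℝ) + D := by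
  have hη := h.step_pos
  refine norm_le_of_abs_inner_le (by positivity) fun x => ?_
  rw [← inner_step_pow_comm]
  refine (hu _).trans ?_
  have h1 := h.norm_apply_step_pow_le m x
  have h2 := h.norm_step_pow_le m x
  calc _ ≤ A * ((η * ((m : ℝ) + 1)) ^ (-(1 / 2) : ℝ) * ‖x‖) + D * ‖x‖ := by gcongr
    _ = _ := by ring

lemma norm_apply_step_pow_noise_le (h : IsEigenSystem B b μ η) (hA : 0 ≤ A) (hD : 0 ≤ D)
    (hu : ∀ x, |⟪x, u⟫| ≤ A * ‖B x‖ + D * ‖x‖) (m : ℕ) :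
    ‖B (((1 - η • (B† ∘L B)) ^ m) u)‖ ≤
      A * (η * ((m : ℝ) + 1))⁻¹ + D * (η * ((m : ℝ) + 1)) ^ (-(1 / 2) : ℝ) := by
  have hη := h.step_pos
  refine norm_le_of_abs_inner_le (by positivity) fun x => ?_
  rw [← ContinuousLinearMap.adjoint_inner_left, ← inner_step_pow_comm]
  refine (hu _).trans ?_
  have h1 := h.norm_apply_step_pow_adjoint_le m x
  have h2 := h.norm_step_pow_adjoint_le m x
  calc _ ≤ A * ((η * ((m : ℝ) + 1))⁻¹ * ‖x‖) +
        D * ((η * ((m : ℝ) + 1)) ^ (-(1 / 2) : ℝ) * ‖x‖) := by gcongr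
    _ = _ := by ring

lemma step_mul_rpow_neg_half {y : ℝ} (hη : 0 < η) (hy : 0 ≤ y) :
    η * (η * y) ^ (-(1 / 2) : ℝ) = √η * y ^ (-(1 / 2) : ℝ) := by
  rw [Real.mul_rpow hη.le hy, ← mul_assoc, Real.sqrt_eq_rpow, ← Real.rpow_one_add' hη.le
    (by norm_num)]
  norm_num

/-- For noise that is the same in all steps: the whole geometric sum moves onto the test vector, so
the `A` part stays free of logarithms. The `D` part grows like √(ηm), which is compensated up to the
horizon because D is of order s√λ. -/
lemma norm_apply_sum_step_pow_noise_le (h : IsEigenSystem B b μ η) (hA : 0 ≤ A) (hD : 0 ≤ D)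
    (hu : ∀ x, |⟪x, u⟫| ≤ A * ‖B x‖ + D * ‖x‖) (m : ℕ) :
    ‖B (η • ∑ k ∈ Finset.range m, ((1 - η • (B† ∘L B)) ^ k) u)‖ ≤ A + D * (2 * (√η * √m)) := by
  have hη := h.step_pos
  refine norm_le_of_abs_inner_le (by positivity) fun x => ?_
  have e1 : ⟪x, B (η • ∑ k ∈ Finset.range m, ((1 - η • (B† ∘L B)) ^ k) u)⟫ =
      ⟪η • ∑ k ∈ Finset.range m, ((1 - η • (B† ∘L B)) ^ k) ((B†) x), u⟫ := by
    rw [← ContinuousLinearMap.adjoint_inner_left, real_inner_smul_left, real_inner_smul_right,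
      inner_sum, sum_inner]
    simp only [inner_step_pow_comm]
  rw [e1]
  refine (hu _).trans ?_
  have h1 := h.norm_apply_sum_step_pow_adjoint_le m x
  have h2 : ‖η • ∑ k ∈ Finset.range m, ((1 - η • (B† ∘L B)) ^ k) ((B†) x)‖ ≤
      2 * (√η * √m) * ‖x‖ := by
    rw [norm_smul, Real.norm_of_nonneg hη.le]
    calc η * ‖∑ k ∈ Finset.range m, ((1 - η • (B† ∘L B)) ^ k) ((B†) x)‖
        ≤ η * ∑ k ∈ Finset.range m, (η * ((k : ℝ) + 1)) ^ (-(1 / 2) : ℝ) * ‖x‖ := by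
          gcongr
          exact (norm_sum_le _ _).trans
            (Finset.sum_le_sum fun k _ => h.norm_step_pow_adjoint_le k x)
      _ = √η * (∑ k ∈ Finset.range m, ((k : ℝ) + 1) ^ (-(1 / 2) : ℝ)) * ‖x‖ := by
          rw [Finset.mul_sum, Finset.mul_sum, Finset.sum_mul]
          refine Finset.sum_congr rfl fun k _ => ?_
          rw [← mul_assoc, step_mul_rpow_neg_half hη (by positivity)]
      _ ≤ √η * (2 * √m) * ‖x‖ := by
          gcongr
          exact sum_rpow_neg_half_le m
      _ = _ := by ring
  calc _ ≤ A * ‖x‖ + D * (2 * (√η * √m) * ‖x‖) := by gcongr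
    _ = _ := by ring

end IsEigenSystem

namespace IsPerturbedLandweber

/-- The variation of constants formula. -/
lemma duhamel (hL : IsPerturbedLandweber B η lam s X ce cz cs cn J e z ν ν₀)
    (hbd : ∀ j ≤ J, ‖e j‖ ≤ X) (j₁ i : ℕ) (hi : j₁ + i ≤ J) :
    e (j₁ + i) = ((1 - η • (B† ∘L B)) ^ i) (e j₁) -
      η • ∑ k ∈ Finset.range i, ((1 - η • (B† ∘L B)) ^ (i - 1 - k))
        ((B†) (z (j₁ + k)) + ν (j₁ + k)) := by
  induction i with
  | zero => simp
  | succ i ih =>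
    have h1 := hL.step (j₁ + i) (by omega) (hbd _ (by omega))
    rw [← add_assoc, h1, ih (by omega), Finset.sum_range_succ]
    have h2 : ∀ k ∈ Finset.range i, ((1 - η • (B† ∘L B)) ^ (i + 1 - 1 - k))
        ((B†) (z (j₁ + k)) + ν (j₁ + k)) = (1 - η • (B† ∘L B))
          (((1 - η • (B† ∘L B)) ^ (i - 1 - k)) ((B†) (z (j₁ + k)) + ν (j₁ + k))) := by
      intro k hk
      have hk := Finset.mem_range.mp hk
      rw [show i + 1 - 1 - k = (i - 1 - k) + 1 by omega, pow_succ', mul_apply_eq_comp]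
    rw [Finset.sum_congr rfl h2, ← map_sum, map_sub, map_smul, ← mul_apply_eq_comp, ← pow_succ',
      show i + 1 - 1 - i = 0 by omega, pow_zero, one_apply_eq_self, smul_add η (_ : H) (_ + _)]
    abel

end IsPerturbedLandweber

end Landweber

end

noncomputable section

/-! ### The sums in the variation of constants formula. -/

section Landweber

variable {H E : Type*} [NormedAddCommGroup H] [InnerProductSpace ℝ H] [CompleteSpace H]
  [NormedAddCommGroup E] [InnerProductSpace ℝ E] [CompleteSpace E]
variable {ι : Type*} {B : H →L[ℝ] E} {b : HilbertBasis ι ℝ H} {μ : ι → ℝ} {η : ℝ}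
variable {lam s X ce cz cs cn : ℝ} {J : ℕ} {e : ℕ → H} {z : ℕ → E} {ν : ℕ → H} {ν₀ : H}

lemma cast_pred_sub_add_one {i k : ℕ} (hk : k ∈ Finset.range i) :
    ((i - 1 - k : ℕ) : ℝ) + 1 = (i : ℝ) - k := by
  have := Finset.mem_range.mp hk
  rw [Nat.cast_sub (by omega), Nat.cast_sub (by omega), Nat.cast_one]
  ring

namespace IsEigenSystem

variable {K Q ω r : ℝ} {i : ℕ} {y : ℕ → E} {α : ℕ → ℝ}

/-- Here α_k stands for ‖e_k‖, and K(k+1)^(-(r+1/2)) + Q for ‖B e_k‖. The kernel inequalities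
extract the target rate from each summand, so the sum reproduces the assumed rate times ω. -/
lemma norm_nonlin_sum_le (h : IsEigenSystem B b μ η) (hr₁ : r ≤ 1 / 2)
    (hcz : 0 ≤ cz) (hK : 0 ≤ K) (hQ : 0 ≤ Q) (hα : ∀ k, 0 ≤ α k)
    (hy : ∀ k < i, ‖y k‖ ≤ cz * (α k * (K * ((k : ℝ) + 1) ^ (-(r + 1 / 2)) + Q)))
    (hω : ∑ k ∈ Finset.range i, (((k : ℝ) + 1)⁻¹ + ((i : ℝ) - k)⁻¹) * α k ≤ ω) :
    ‖η • ∑ k ∈ Finset.range i, ((1 - η • (B† ∘L B)) ^ (i - 1 - k)) ((B†) (y k))‖ ≤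
      √η * cz * ω * (2 * K * ((i : ℝ) + 1) ^ (-r) + Q * √((i : ℝ) + 1)) := by
  have hη := h.step_pos
  rw [norm_smul, Real.norm_of_nonneg hη.le]
  calc η * ‖∑ k ∈ Finset.range i, ((1 - η • (B† ∘L B)) ^ (i - 1 - k)) ((B†) (y k))‖
      ≤ η * ∑ k ∈ Finset.range i, (η * ((i : ℝ) - k)) ^ (-(1 / 2) : ℝ) *
          (cz * (α k * (K * ((k : ℝ) + 1) ^ (-(r + 1 / 2)) + Q))) := by
        gcongr
        refine (norm_sum_le _ _).trans (Finset.sum_le_sum fun k hk => ?_)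
        have h1 := h.norm_step_pow_adjoint_le (i - 1 - k) (y k)
        rw [cast_pred_sub_add_one hk] at h1
        refine h1.trans ?_
        have := sub_cast_pos hk
        have := hy k (Finset.mem_range.mp hk)
        gcongr
    _ = √η * cz * ∑ k ∈ Finset.range i, α k *
          (K * (((i : ℝ) - k) ^ (-(1 / 2) : ℝ) * ((k : ℝ) + 1) ^ (-(r + 1 / 2))) +
            Q * ((i : ℝ) - k) ^ (-(1 / 2) : ℝ)) := by
        rw [Finset.mul_sum, Finset.mul_sum]
        refine Finset.sum_congr rfl fun k hk => ?_
        rw [← mul_assoc, step_mul_rpow_neg_half hη (sub_cast_pos hk).le]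
        ring
    _ ≤ √η * cz * ∑ k ∈ Finset.range i, α k *
          ((((k : ℝ) + 1)⁻¹ + ((i : ℝ) - k)⁻¹) *
            (2 * K * ((i : ℝ) + 1) ^ (-r) + Q * √((i : ℝ) + 1))) := by
        refine mul_le_mul_of_nonneg_left (Finset.sum_le_sum fun k hk => ?_) (by positivity)
        refine mul_le_mul_of_nonneg_left ?_ (hα k)
        have hx : (0 : ℝ) < (k : ℝ) + 1 := by positivity
        have hyk := sub_cast_pos hk
        have e0 : ((k : ℝ) + 1) + ((i : ℝ) - k) = (i : ℝ) + 1 := by ring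
        have h1 := rpow_neg_half_mul_rpow_neg_le hx hyk hr₁
        have h2 := rpow_neg_half_le hx hyk
        rw [e0] at h1 h2
        have h3 := mul_le_mul_of_nonneg_left h1 hK
        have h4 := mul_le_mul_of_nonneg_left h2 hQ
        linarith
    _ = √η * cz * ((∑ k ∈ Finset.range i, (((k : ℝ) + 1)⁻¹ + ((i : ℝ) - k)⁻¹) * α k) *
          (2 * K * ((i : ℝ) + 1) ^ (-r) + Q * √((i : ℝ) + 1))) := by
        rw [Finset.sum_mul]
        congr 1
        exact Finset.sum_congr rfl fun k _ => by ring
    _ ≤ √η * cz * (ω * (2 * K * ((i : ℝ) + 1) ^ (-r) + Q * √((i : ℝ) + 1))) := by gcongr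
    _ = _ := by ring

/-- The smoothing weight is now 1/(η(i−k)). The rate is extracted with exponent r + 1/2, and r ≤ 1/2
is what keeps this exponent at most 1. -/
lemma norm_apply_nonlin_sum_le (h : IsEigenSystem B b μ η)
    (hr₁ : r ≤ 1 / 2) (hcz : 0 ≤ cz) (hK : 0 ≤ K) (hQ : 0 ≤ Q) (hα : ∀ k, 0 ≤ α k)
    (hy : ∀ k < i, ‖y k‖ ≤ cz * (α k * (K * ((k : ℝ) + 1) ^ (-(r + 1 / 2)) + Q)))
    (hω : ∑ k ∈ Finset.range i, (((k : ℝ) + 1)⁻¹ + ((i : ℝ) - k)⁻¹) * α k ≤ ω) :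
    ‖B (η • ∑ k ∈ Finset.range i, ((1 - η • (B† ∘L B)) ^ (i - 1 - k)) ((B†) (y k)))‖ ≤
      cz * ω * (K * ((i : ℝ) + 1) ^ (-(r + 1 / 2)) + Q) := by
  have hη := h.step_pos
  rw [map_smul, map_sum, norm_smul, Real.norm_of_nonneg hη.le]
  calc η * ‖∑ k ∈ Finset.range i, B (((1 - η • (B† ∘L B)) ^ (i - 1 - k)) ((B†) (y k)))‖
      ≤ η * ∑ k ∈ Finset.range i, (η * ((i : ℝ) - k))⁻¹ *
          (cz * (α k * (K * ((k : ℝ) + 1) ^ (-(r + 1 / 2)) + Q))) := by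
        gcongr
        refine (norm_sum_le _ _).trans (Finset.sum_le_sum fun k hk => ?_)
        have h1 := h.norm_apply_step_pow_adjoint_le (i - 1 - k) (y k)
        rw [cast_pred_sub_add_one hk] at h1
        refine h1.trans ?_
        have := sub_cast_pos hk
        have := hy k (Finset.mem_range.mp hk)
        gcongr
    _ = cz * ∑ k ∈ Finset.range i, α k *
          (K * (((i : ℝ) - k)⁻¹ * ((k : ℝ) + 1) ^ (-(r + 1 / 2))) + Q * ((i : ℝ) - k)⁻¹) := by
        rw [Finset.mul_sum, Finset.mul_sum]
        refine Finset.sum_congr rfl fun k hk => ?_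
        have := sub_cast_pos hk
        field_simp
    _ ≤ cz * ∑ k ∈ Finset.range i, α k *
          ((((k : ℝ) + 1)⁻¹ + ((i : ℝ) - k)⁻¹) *
            (K * ((i : ℝ) + 1) ^ (-(r + 1 / 2)) + Q)) := by
        refine mul_le_mul_of_nonneg_left (Finset.sum_le_sum fun k hk => ?_) (by positivity)
        refine mul_le_mul_of_nonneg_left ?_ (hα k)
        have hx : (0 : ℝ) < (k : ℝ) + 1 := by positivity
        have hyk := sub_cast_pos hk
        have e0 : ((k : ℝ) + 1) + ((i : ℝ) - k) = (i : ℝ) + 1 := by ring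
        have h1 := inv_mul_rpow_neg_le (γ := r + 1 / 2) hx hyk (by linarith)
        rw [e0] at h1
        have h3 := mul_le_mul_of_nonneg_left h1 hK
        have h4 : 0 ≤ ((k : ℝ) + 1)⁻¹ * Q := by positivity
        linarith
    _ = cz * ((∑ k ∈ Finset.range i, (((k : ℝ) + 1)⁻¹ + ((i : ℝ) - k)⁻¹) * α k) *
          (K * ((i : ℝ) + 1) ^ (-(r + 1 / 2)) + Q)) := by
        rw [Finset.sum_mul]
        congr 1
        exact Finset.sum_congr rfl fun k _ => by ring
    _ ≤ cz * (ω * (K * ((i : ℝ) + 1) ^ (-(r + 1 / 2)) + Q)) := by gcongr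
    _ = _ := by ring

lemma sum_step_rpow_neg_half_le (hη : 0 < η) (i : ℕ) :
    η * ∑ k ∈ Finset.range i, (η * ((i : ℝ) - k)) ^ (-(1 / 2) : ℝ) ≤ 2 * (√η * √i) := by
  rw [sum_range_reflect_cast i fun t => (η * t) ^ (-(1 / 2) : ℝ), Finset.mul_sum]
  calc _ = √η * ∑ k ∈ Finset.range i, ((k : ℝ) + 1) ^ (-(1 / 2) : ℝ) := by
        rw [Finset.mul_sum]
        exact Finset.sum_congr rfl fun k _ => step_mul_rpow_neg_half hη (by positivity)
    _ ≤ √η * (2 * √i) := by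
        gcongr
        exact sum_rpow_neg_half_le i
    _ = _ := by ring

lemma norm_noise_sum_le (h : IsEigenSystem B b μ η) {A D : ℝ} {u : ℕ → H} (hA : 0 ≤ A)
    (hD : 0 ≤ D) (hu : ∀ k < i, ∀ x, |⟪x, u k⟫| ≤ A * ‖B x‖ + D * ‖x‖) :
    ‖η • ∑ k ∈ Finset.range i, ((1 - η • (B† ∘L B)) ^ (i - 1 - k)) (u k)‖ ≤
      A * (2 * (√η * √i)) + D * (η * i) := by
  have hη := h.step_pos
  rw [norm_smul, Real.norm_of_nonneg hη.le]
  calc η * ‖∑ k ∈ Finset.range i, ((1 - η • (B† ∘L B)) ^ (i - 1 - k)) (u k)‖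
      ≤ η * ∑ k ∈ Finset.range i, (A * (η * ((i : ℝ) - k)) ^ (-(1 / 2) : ℝ) + D) := by
        gcongr
        refine (norm_sum_le _ _).trans (Finset.sum_le_sum fun k hk => ?_)
        have h1 := h.norm_step_pow_noise_le hA hD (hu k (Finset.mem_range.mp hk)) (i - 1 - k)
        rwa [cast_pred_sub_add_one hk] at h1
    _ = A * (η * ∑ k ∈ Finset.range i, (η * ((i : ℝ) - k)) ^ (-(1 / 2) : ℝ)) + D * (η * i) := by
        rw [Finset.sum_add_distrib, ← Finset.mul_sum]
        simp only [Finset.sum_const, Finset.card_range, nsmul_eq_mul]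
        ring
    _ ≤ _ := add_le_add_left
        (mul_le_mul_of_nonneg_left (sum_step_rpow_neg_half_le hη i) hA) _

/-- Noise whose leading part carries the factor α_k: that factor makes the sum of 1/(i−k) bounded,
which it would not be for constant noise. -/
lemma norm_apply_noise_sum_le (h : IsEigenSystem B b μ η) {A D : ℝ} {u : ℕ → H} (hA : 0 ≤ A)
    (hD : 0 ≤ D) (hα : ∀ k, 0 ≤ α k)
    (hu : ∀ k < i, ∀ x, |⟪x, u k⟫| ≤ A * α k * ‖B x‖ + D * ‖x‖)
    (hω : ∑ k ∈ Finset.range i, (((k : ℝ) + 1)⁻¹ + ((i : ℝ) - k)⁻¹) * α k ≤ ω) :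
    ‖B (η • ∑ k ∈ Finset.range i, ((1 - η • (B† ∘L B)) ^ (i - 1 - k)) (u k))‖ ≤
      A * ω + D * (2 * (√η * √i)) := by
  have hη := h.step_pos
  rw [map_smul, map_sum, norm_smul, Real.norm_of_nonneg hη.le]
  calc η * ‖∑ k ∈ Finset.range i, B (((1 - η • (B† ∘L B)) ^ (i - 1 - k)) (u k))‖
      ≤ η * ∑ k ∈ Finset.range i, (A * α k * (η * ((i : ℝ) - k))⁻¹ +
          D * (η * ((i : ℝ) - k)) ^ (-(1 / 2) : ℝ)) := by
        gcongr
        refine (norm_sum_le _ _).trans (Finset.sum_le_sum fun k hk => ?_)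
        have h1 := h.norm_apply_step_pow_noise_le (mul_nonneg hA (hα k)) hD
          (hu k (Finset.mem_range.mp hk)) (i - 1 - k)
        rwa [cast_pred_sub_add_one hk] at h1
    _ = A * ∑ k ∈ Finset.range i, ((i : ℝ) - k)⁻¹ * α k +
          D * (η * ∑ k ∈ Finset.range i, (η * ((i : ℝ) - k)) ^ (-(1 / 2) : ℝ)) := by
        rw [Finset.sum_add_distrib, mul_add, Finset.mul_sum, Finset.mul_sum, Finset.mul_sum,
          Finset.mul_sum, Finset.mul_sum]
        congr 1
        · refine Finset.sum_congr rfl fun k hk => ?_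
          have := sub_cast_pos hk
          field_simp
        · exact Finset.sum_congr rfl fun k _ => by ring
    _ ≤ A * ω + D * (2 * (√η * √i)) := by
        have h2 : ∑ k ∈ Finset.range i, ((i : ℝ) - k)⁻¹ * α k ≤ ω := by
          refine le_trans (Finset.sum_le_sum fun k _ => ?_) hω
          have hx : (0 : ℝ) ≤ ((k : ℝ) + 1)⁻¹ := by positivity
          have := hα k
          gcongr
          linarith
        exact add_le_add (mul_le_mul_of_nonneg_left h2 hA)
          (mul_le_mul_of_nonneg_left (sum_step_rpow_neg_half_le hη i) hD)

end IsEigenSystem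

end Landweber

end

noncomputable section

/-! ### Second phase: convergence rates once the error is small. -/

section Landweber

variable {H E : Type*} [NormedAddCommGroup H] [InnerProductSpace ℝ H] [CompleteSpace H]
  [NormedAddCommGroup E] [InnerProductSpace ℝ E] [CompleteSpace E]
variable {ι : Type*} {B : H →L[ℝ] E} {b : HilbertBasis ι ℝ H} {μ : ι → ℝ} {η : ℝ}
variable {lam s X ce cz cs cn : ℝ} {J : ℕ} {e : ℕ → H} {z : ℕ → E} {ν : ℕ → H} {ν₀ : H}

/-- After removal of κ, both upper bounds hold, hence so does their geometric mean. It is small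
through ε and still decays in x, as the kernel sum requires. -/
lemma le_sqrt_mul_rpow_add {a ε K κ x r : ℝ} (hε : 0 ≤ ε) (hK : 0 ≤ K) (hκ : 0 ≤ κ) (hx : 0 < x)
    (h₁ : a ≤ ε) (h₂ : a ≤ K * x ^ (-r) + κ) : a ≤ √(ε * K) * x ^ (-(r / 2)) + κ := by
  have hxr : x ^ (-(r / 2)) * x ^ (-(r / 2)) = x ^ (-r) := by
    rw [← Real.rpow_add hx]
    congr 1
    ring
  have hp : 0 < x ^ (-(r / 2)) := by positivity
  by_contra hlt
  have hlt := not_le.mp hlt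
  have hs : 0 ≤ √(ε * K) * x ^ (-(r / 2)) := by positivity
  have h3 : (√(ε * K) * x ^ (-(r / 2))) * (√(ε * K) * x ^ (-(r / 2))) <
      (a - κ) * (a - κ) := mul_self_lt_mul_self hs (by linarith)
  have h4 : (√(ε * K) * x ^ (-(r / 2))) * (√(ε * K) * x ^ (-(r / 2))) = ε * (K * x ^ (-r)) := by
    rw [← hxr]
    have := Real.mul_self_sqrt (mul_nonneg hε hK)
    linear_combination (x ^ (-(r / 2)) * x ^ (-(r / 2))) * this
  have h5 : (a - κ) * (a - κ) ≤ ε * (K * x ^ (-r)) :=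
    mul_le_mul (by linarith) (by linarith) (by linarith) hε
  linarith

namespace IsPerturbedLandweber

set_option maxHeartbeats 1600000 in
/-- The rates of the iteration after a time from which on the errors are at most `ε`, with
constants that depend on `ε` only through smallness conditions. -/
lemma rates_of_small (h : IsEigenSystem B b μ η)
    (hL : IsPerturbedLandweber B η lam s X ce cz cs cn J e z ν ν₀)
    {r ε Wb Cq K K₂ ω : ℝ} {j₁ : ℕ} {w q : H} (hr₀ : 0 < r) (hr₁ : r ≤ 1 / 2) (hlam : 0 < lam)
    (hlam₁ : lam ≤ 1) (hs : 0 ≤ s) (hcn : 0 ≤ cn) (hcz : 0 ≤ cz) (hX : 0 ≤ X) (hε : 0 ≤ ε)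
    (hbd : ∀ j ≤ J, ‖e j‖ ≤ X) (hsm : ∀ j, j₁ ≤ j → j ≤ J → ‖e j‖ ≤ ε)
    (hwq : e j₁ = diagOp b (fun i => μ i ^ r) w + q) (hw : ‖w‖ ≤ Wb) (hCq : 0 ≤ Cq)
    (hq : ‖q‖ ≤ Cq * s) (hK0 : 0 ≤ K) (hK₂0 : 0 ≤ K₂)
    (hK : η ^ (-r) * Wb ≤ K / 2) (hK' : η ^ (-(r + 1 / 2)) * Wb ≤ K / 2)
    (hK₂ : Cq + cn * (2 * X + 4) ≤ K₂ / 2) (hK₂' : η⁻¹ ^ (1 / 2 : ℝ) * Cq + 6 * cn ≤ K₂ / 2)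
    (hω₀ : 0 ≤ ω) (hω₁ : ω ≤ 1) (hωc : 4 * (√η + 1) * cz * ω ≤ 1)
    (hω : ∀ i, j₁ + i ≤ J → ∑ k ∈ Finset.range i, (((k : ℝ) + 1)⁻¹ + ((i : ℝ) - k)⁻¹) *
      (√(ε * K) * ((k : ℝ) + 1) ^ (-(r / 2)) + K₂ * (s / √lam)) ≤ ω) :
    ∀ i, j₁ + i ≤ J → ‖e (j₁ + i)‖ ≤ K * ((i : ℝ) + 1) ^ (-r) + K₂ * (s / √lam) ∧
      ‖B (e (j₁ + i))‖ ≤ K * ((i : ℝ) + 1) ^ (-(r + 1 / 2)) + K₂ * s := by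
  have hη := h.step_pos
  have hsl : 0 < √lam := Real.sqrt_pos.mpr hlam
  have hsl1 : √lam ≤ 1 := by rwa [Real.sqrt_le_one]
  have hsN : s ≤ s / √lam := by rw [le_div_iff₀ hsl]; exact mul_le_of_le_one_right hs hsl1
  set Na := s / √lam with hNa
  have hNa0 : 0 ≤ Na := by positivity
  set α : ℕ → ℝ := fun k => √(ε * K) * ((k : ℝ) + 1) ^ (-(r / 2)) + K₂ * Na with hα
  have hα0 : ∀ k, 0 ≤ α k := fun k => by positivity
  intro i
  -- All earlier errors enter through the variation of constants formula.
  induction i using Nat.strong_induction_on with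
  | _ i ih =>
  intro hi
  have hak : ∀ k < i, ‖e (j₁ + k)‖ ≤ α k := fun k hk =>
    le_sqrt_mul_rpow_add hε hK0 (by positivity) (by positivity)
      (hsm _ (by omega) (by omega)) (ih k hk (by omega)).1
  have hz : ∀ k < i, ‖z (j₁ + k)‖ ≤
      cz * (α k * (K * ((k : ℝ) + 1) ^ (-(r + 1 / 2)) + K₂ * s)) := fun k hk => by
    refine (hL.nonlin _ (by omega) (hbd _ (by omega))).trans ?_
    have h1 := hak k hk
    have h2 := (ih k hk (by omega)).2
    have h3 := hα0 k
    gcongr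
  have hiJ : η * lam * i ≤ 1 := by
    have : (i : ℝ) ≤ J := by exact_mod_cast (by omega : i ≤ J)
    exact (mul_le_mul_of_nonneg_left this (by positivity)).trans hL.horizon
  have hsq : √lam * (√η * √i) ≤ 1 := by
    rw [← Real.sqrt_mul hη.le, ← Real.sqrt_mul hlam.le, Real.sqrt_le_one]
    linarith
  have hsq' : √η * √i ≤ 1 / √lam := by rw [le_div_iff₀' hsl]; exact hsq
  -- the bounds of the single terms
  have t1 : ‖((1 - η • (B† ∘L B)) ^ i) (e j₁)‖ ≤ K / 2 * ((i : ℝ) + 1) ^ (-r) + Cq * s := by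
    rw [hwq, map_add]
    have h1 := h.norm_step_pow_pow_le hr₀.le (by linarith) i w
    have h2 := h.norm_step_pow_le i q
    rw [Real.mul_rpow hη.le (by positivity)] at h1
    calc _ ≤ η ^ (-r) * ((i : ℝ) + 1) ^ (-r) * ‖w‖ + ‖q‖ := (norm_add_le _ _).trans
          (add_le_add h1 h2)
      _ ≤ η ^ (-r) * ((i : ℝ) + 1) ^ (-r) * Wb + Cq * s := by gcongr
      _ = η ^ (-r) * Wb * ((i : ℝ) + 1) ^ (-r) + Cq * s := by ring
      _ ≤ _ := by gcongr
  have t1' : ‖B (((1 - η • (B† ∘L B)) ^ i) (e j₁))‖ ≤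
      K / 2 * ((i : ℝ) + 1) ^ (-(r + 1 / 2)) + η⁻¹ ^ (1 / 2 : ℝ) * Cq * s := by
    rw [hwq, map_add, map_add]
    have h1 := h.norm_apply_step_pow_pow_le hr₀.le hr₁ i w
    have h2 := (h.norm_apply_le _).trans (mul_le_mul_of_nonneg_left (h.norm_step_pow_le i q)
      (by positivity : 0 ≤ η⁻¹ ^ (1 / 2 : ℝ)))
    rw [Real.mul_rpow hη.le (by positivity)] at h1
    calc _ ≤ η ^ (-(r + 1 / 2)) * ((i : ℝ) + 1) ^ (-(r + 1 / 2)) * ‖w‖ +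
          η⁻¹ ^ (1 / 2 : ℝ) * ‖q‖ := (norm_add_le _ _).trans (add_le_add h1 h2)
      _ ≤ η ^ (-(r + 1 / 2)) * ((i : ℝ) + 1) ^ (-(r + 1 / 2)) * Wb +
          η⁻¹ ^ (1 / 2 : ℝ) * (Cq * s) := by gcongr
      _ = η ^ (-(r + 1 / 2)) * Wb * ((i : ℝ) + 1) ^ (-(r + 1 / 2)) +
          η⁻¹ ^ (1 / 2 : ℝ) * Cq * s := by ring
      _ ≤ _ := by gcongr
  have t2 := h.norm_nonlin_sum_le (i := i) hr₁ hcz hK0 (mul_nonneg hK₂0 hs) hα0 hz (hω i hi)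
  have t2' := h.norm_apply_nonlin_sum_le (i := i) hr₁ hcz hK0 (mul_nonneg hK₂0 hs) hα0 hz
    (hω i hi)
  have hnoise : ∀ k < i, ∀ x, |⟪x, ν (j₁ + k)⟫| ≤
      s * cn * (X + 1) * ‖B x‖ + s * cn * 2 * √lam * ‖x‖ := fun k hk x =>
    (hL.norm_noise_le hs hcn (by omega) (hbd _ (by omega)) x).trans (by linarith)
  have t3 := h.norm_noise_sum_le (i := i) (u := fun k => ν (j₁ + k)) (by positivity)
    (by positivity) hnoise
  have hdiff : ∀ k < i, ∀ x, |⟪x, ν (j₁ + k) - ν₀⟫| ≤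
      s * cn * α k * ‖B x‖ + s * cn * √lam * ‖x‖ := fun k hk x => by
    refine (hL.noise _ (by omega) (hbd _ (by omega)) x).trans ?_
    have h1 := mul_le_mul_of_nonneg_right (hak k hk) (norm_nonneg (B x))
    have h2 := mul_le_mul_of_nonneg_left h1 (mul_nonneg hs hcn)
    linarith
  have t4 := h.norm_apply_noise_sum_le (i := i) (u := fun k => ν (j₁ + k) - ν₀)
    (mul_nonneg hs hcn) (by positivity) hα0 hdiff (hω i hi)
  have t5 := h.norm_apply_sum_step_pow_noise_le (u := ν₀) (mul_nonneg hs hcn)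
    (by positivity : 0 ≤ s * cn * √lam) (fun x => (hL.noise_const x).trans (by linarith)) i
  -- The noise is split into its deviation from ν₀, where the factor α_k bounds the kernel sum, and
  -- ν₀, where the geometric sum collapses. Each part contributes at most 3 cn s.
  have t3' : ‖B (η • ∑ k ∈ Finset.range i, ((1 - η • (B† ∘L B)) ^ (i - 1 - k)) (ν (j₁ + k)))‖ ≤
      6 * cn * s := by
    have e1 : η • ∑ k ∈ Finset.range i, ((1 - η • (B† ∘L B)) ^ (i - 1 - k)) (ν (j₁ + k)) =
        η • ∑ k ∈ Finset.range i, ((1 - η • (B† ∘L B)) ^ (i - 1 - k)) (ν (j₁ + k) - ν₀) +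
        η • ∑ k ∈ Finset.range i, ((1 - η • (B† ∘L B)) ^ k) ν₀ := by
      rw [← Finset.sum_range_reflect (fun k => ((1 - η • (B† ∘L B)) ^ k) ν₀), ← smul_add,
        ← Finset.sum_add_distrib]
      congr 1
      refine Finset.sum_congr rfl fun k _ => ?_
      rw [← map_add, sub_add_cancel]
    rw [e1, map_add]
    refine (norm_add_le _ _).trans ((add_le_add t4 t5).trans ?_)
    have hc : 0 ≤ s * cn := mul_nonneg hs hcn
    have h1 := mul_le_mul_of_nonneg_left hω₁ hc
    have h2 := mul_le_mul_of_nonneg_left hsq hc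
    linarith
  have hdu := hL.duhamel hbd j₁ i hi
  have hsplit : η • ∑ k ∈ Finset.range i, ((1 - η • (B† ∘L B)) ^ (i - 1 - k))
      ((B†) (z (j₁ + k)) + ν (j₁ + k)) =
      η • ∑ k ∈ Finset.range i, ((1 - η • (B† ∘L B)) ^ (i - 1 - k)) ((B†) (z (j₁ + k))) +
      η • ∑ k ∈ Finset.range i, ((1 - η • (B† ∘L B)) ^ (i - 1 - k)) (ν (j₁ + k)) := by
    rw [← smul_add, ← Finset.sum_add_distrib]
    simp only [map_add]
  rw [hsplit] at hdu
  have hczω : 0 ≤ cz * ω := mul_nonneg hcz hω₀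
  have hczω' : 0 ≤ √η * (cz * ω) := by positivity
  have hωa : √η * cz * ω ≤ 1 / 4 := by linarith
  have hωb : cz * ω ≤ 1 / 4 := by linarith
  constructor
  · have hKp : 0 ≤ K * ((i : ℝ) + 1) ^ (-r) := by positivity
    have f2 : √η * cz * ω * (2 * K * ((i : ℝ) + 1) ^ (-r) + K₂ * s * √((i : ℝ) + 1)) ≤
        1 / 2 * (K * ((i : ℝ) + 1) ^ (-r)) + K₂ / 2 * Na := by
      -- The comparison √(i+1) ≤ 2√i fails at i = 0, where s ≤ s/√λ is used instead.
      rcases Nat.eq_zero_or_pos i with rfl | hi0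
      · have g1 := mul_le_mul_of_nonneg_right hωa hKp
        have g2 := mul_le_mul_of_nonneg_right hωa (mul_nonneg hK₂0 hs)
        have g3 := mul_le_mul_of_nonneg_left hsN hK₂0
        have g4 : 0 ≤ K₂ * s := mul_nonneg hK₂0 hs
        simp only [Nat.cast_zero, zero_add, Real.sqrt_one, mul_one] at g1 ⊢
        linarith
      · have hi1 : (1 : ℝ) ≤ i := by exact_mod_cast hi0
        have g0 : √((i : ℝ) + 1) ≤ 2 * √i := by
          rw [Real.sqrt_le_left (by positivity), mul_pow, Real.sq_sqrt (by positivity)]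
          linarith
        have g1 := mul_le_mul_of_nonneg_right hωa hKp
        have g2 : √η * cz * ω * (K₂ * s * √((i : ℝ) + 1)) ≤ K₂ / 2 * Na := by
          calc √η * cz * ω * (K₂ * s * √((i : ℝ) + 1))
              ≤ √η * cz * ω * (K₂ * s * (2 * √i)) := by gcongr
            _ = 2 * (cz * ω) * K₂ * s * (√η * √i) := by ring
            _ ≤ 2 * (1 / 4) * K₂ * s * (1 / √lam) := by gcongr
            _ = _ := by rw [hNa]; ring
        linarith
    have f3 : s * cn * (X + 1) * (2 * (√η * √i)) + s * cn * 2 * √lam * (η * i) ≤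
        cn * (2 * X + 4) * Na := by
      have g1 : √lam * (η * i) ≤ 1 / √lam := by
        rw [le_div_iff₀ hsl]
        have h1 : √lam * (η * i) * √lam = √lam * √lam * (η * i) := by ring
        rw [h1, Real.mul_self_sqrt hlam.le]
        linarith
      calc _ = s * cn * (X + 1) * (2 * (√η * √i)) + s * cn * 2 * (√lam * (η * i)) := by ring
        _ ≤ s * cn * (X + 1) * (2 * (1 / √lam)) + s * cn * 2 * (1 / √lam) := by gcongr
        _ = _ := by rw [hNa]; ring
    have f4 : Cq * s ≤ Cq * Na := by gcongr
    have f5 := mul_le_mul_of_nonneg_right hK₂ hNa0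
    rw [hdu]
    refine (norm_sub_le _ _).trans ((add_le_add t1 ((norm_add_le _ _).trans
      (add_le_add t2 t3))).trans ?_)
    linarith
  · have hKp : 0 ≤ K * ((i : ℝ) + 1) ^ (-(r + 1 / 2)) := by positivity
    have g1 := mul_le_mul_of_nonneg_right hωb hKp
    have g2 := mul_le_mul_of_nonneg_right hωb (mul_nonneg hK₂0 hs)
    have g3 := mul_le_mul_of_nonneg_right hK₂' hs
    have g4 : 0 ≤ K₂ * s := mul_nonneg hK₂0 hs
    rw [hdu, map_sub, map_add]
    refine (norm_sub_le _ _).trans ((add_le_add t1' ((norm_add_le _ _).trans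
      (add_le_add t2' t3'))).trans ?_)
    linarith

end IsPerturbedLandweber

end Landweber

end

/-! ### Both phases combined: rates for arbitrary initial error and nonlinearity. -/

noncomputable section

/-- Converts rates in the time since the end of the first phase to rates in the total time, at the
cost of a factor 2. -/
lemma rpow_neg_le_two_mul {x y γ : ℝ} (hx : 0 < x) (hxy : x ≤ 2 * y) (hγ₀ : 0 ≤ γ)
    (hγ₁ : γ ≤ 1) : y ^ (-γ) ≤ 2 * x ^ (-γ) := by
  have hy : 0 < y := by linarith
  have h1 : (2 : ℝ) ^ γ ≤ 2 ^ (1 : ℝ) :=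
    Real.rpow_le_rpow_of_exponent_le (by norm_num) hγ₁
  rw [Real.rpow_one] at h1
  have h2 : x ^ γ ≤ 2 * y ^ γ := by
    calc x ^ γ ≤ (2 * y) ^ γ := Real.rpow_le_rpow hx.le hxy hγ₀
      _ = 2 ^ γ * y ^ γ := Real.mul_rpow (by norm_num) hy.le
      _ ≤ _ := by gcongr
  rw [Real.rpow_neg hx.le, Real.rpow_neg hy.le]
  have hpx : 0 < x ^ γ := by positivity
  have hpy : 0 < y ^ γ := by positivity
  rw [← div_eq_mul_inv, le_div_iff₀ hpx, inv_mul_le_iff₀ hpy]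
  linarith

set_option maxHeartbeats 1600000 in
/-- The convergence rates of a perturbed Landweber iteration. The size of the initial error and of
the nonlinearity is arbitrary. -/
theorem exists_perturbedLandweber_rates {r η ce cz cs cn X W₀ : ℝ} (hr₀ : 0 < r) (hr₁ : r ≤ 1 / 2)
    (hη : 0 < η) (hce : 0 < ce) (hcz : 0 < cz) (hcs : 0 ≤ cs) (hcn : 0 ≤ cn) (hX : 0 < X)
    (hW₀ : 0 < W₀) (hXW : 3 * ((η⁻¹ ^ r * W₀) ^ 2 + 1) ≤ X ^ 2) :
    ∃ (K κ : ℝ) (J₀ : ℕ), 0 < K ∧ 0 < κ ∧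
      ∀ {H E : Type*} [NormedAddCommGroup H] [InnerProductSpace ℝ H] [CompleteSpace H]
        [NormedAddCommGroup E] [InnerProductSpace ℝ E] [CompleteSpace E]
        {ι : Type*} {B : H →L[ℝ] E} {b : HilbertBasis ι ℝ H} {μ : ι → ℝ} {lam s : ℝ} {J : ℕ}
        {e : ℕ → H} {z : ℕ → E} {ν : ℕ → H} {ν₀ : H},
        IsEigenSystem B b μ η → IsPerturbedLandweber B η lam s X ce cz cs cn J e z ν ν₀ →
        0 < lam → lam ≤ κ → 0 ≤ s → s / √lam * (1 + Real.log ((J : ℝ) + 1)) ≤ κ → J₀ ≤ J →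
        (∃ w₀, e 0 = diagOp b (fun i => μ i ^ r) w₀ ∧ ‖w₀‖ ≤ W₀) →
        (∀ j ≤ J, ‖e j‖ ≤ X) ∧ ‖e J‖ ≤ K * ((J : ℝ) ^ (-r) + s / √lam) ∧
          ‖B (e J)‖ ≤ K * ((J : ℝ) ^ (-(r + 1 / 2)) + s) := by
  obtain ⟨Wb, hWb, hsmall⟩ := exists_small_with_source hr₀ hr₁ hη hce hcz hcs hcn hX hW₀
  obtain ⟨Z, hZ, hZle⟩ := exists_sum_kernel_rpow_le (ρ := r / 2) (by positivity)
  -- The order of choices avoids circularity: K depends on Wb but not on ε. Then ε is chosen small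
  -- relative to K, which fixes t₀ and Cq, then K₂ and finally κ.
  obtain ⟨K, hK⟩ : ∃ K, K = 2 * (η ^ (-r) * Wb + η ^ (-(r + 1 / 2)) * Wb) := ⟨_, rfl⟩
  have hK0 : 0 < K := by rw [hK]; positivity
  have hKa : η ^ (-r) * Wb ≤ K / 2 := by
    have : 0 < η ^ (-(r + 1 / 2)) * Wb := by positivity
    linarith
  have hKb : η ^ (-(r + 1 / 2)) * Wb ≤ K / 2 := by
    have : 0 < η ^ (-r) * Wb := by positivity
    linarith
  obtain ⟨ω, hω⟩ : ∃ ω, ω = min 1 (1 / (4 * (√η + 1) * cz)) := ⟨_, rfl⟩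
  have hω0 : 0 < ω := by rw [hω]; positivity
  have hω1 : ω ≤ 1 := by rw [hω]; exact min_le_left _ _
  have hωc : 4 * (√η + 1) * cz * ω ≤ 1 := by
    have h1 : ω ≤ 1 / (4 * (√η + 1) * cz) := by rw [hω]; exact min_le_right _ _
    rw [le_div_iff₀ (by positivity)] at h1
    linarith
  -- With this ε the decaying part of the kernel sum is at most ω/2; the noise part gets the other
  -- half.
  obtain ⟨ε, hε⟩ : ∃ ε, ε = (ω / (2 * Z)) ^ 2 / K := ⟨_, rfl⟩
  have hε0 : 0 < ε := by rw [hε]; positivity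
  have hεZ : √(ε * K) * Z = ω / 2 := by
    rw [hε, div_mul_cancel₀ _ hK0.ne', Real.sqrt_sq (by positivity)]
    field_simp
  -- The first phase aims at ε/3, so that the factor 3 in the Gronwall bound keeps all later errors
  -- below ε.
  obtain ⟨t₀, κ₁, Cq, hκ₁, hCq, hsm⟩ := hsmall (ε / 3) (by positivity)
  obtain ⟨K₂, hK₂⟩ : ∃ K₂, K₂ =
    2 * (Cq + cn * (2 * X + 4) + (η⁻¹ ^ (1 / 2 : ℝ) * Cq + 6 * cn)) := ⟨_, rfl⟩
  have hp1 : 0 ≤ Cq + cn * (2 * X + 4) := by positivity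
  have hp2 : 0 ≤ η⁻¹ ^ (1 / 2 : ℝ) * Cq + 6 * cn := by positivity
  have hK₂0 : 0 ≤ K₂ := by linarith
  obtain ⟨κ, hκ⟩ : ∃ κ, κ = min (min κ₁ 1) (min (min ((ε / 3) ^ 2) 1 / (cs / η + 1))
    (ω / (4 * (K₂ + 1)))) := ⟨_, rfl⟩
  have hκ0 : 0 < κ := by rw [hκ]; positivity
  have hκa : κ ≤ κ₁ := by rw [hκ]; exact (min_le_left _ _).trans (min_le_left _ _)
  have hκb : κ ≤ 1 := by rw [hκ]; exact (min_le_left _ _).trans (min_le_right _ _)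
  have hκc : cs / η * κ ^ 2 ≤ min ((ε / 3) ^ 2) 1 := by
    have h1 : κ ≤ min ((ε / 3) ^ 2) 1 / (cs / η + 1) := by
      rw [hκ]; exact (min_le_right _ _).trans (min_le_left _ _)
    have h2 : 0 ≤ cs / η := by positivity
    rw [le_div_iff₀ (by positivity)] at h1
    have h3 : κ ^ 2 ≤ κ := pow_le_of_le_one hκ0.le hκb two_ne_zero
    have h4 := mul_le_mul_of_nonneg_left h3 h2
    linarith
  have hκd : K₂ * (2 * κ) ≤ ω / 2 := by
    have h1 : κ ≤ ω / (4 * (K₂ + 1)) := by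
      rw [hκ]; exact (min_le_right _ _).trans (min_le_right _ _)
    rw [le_div_iff₀ (by positivity)] at h1
    linarith
  refine ⟨2 * K + K₂, κ, 2 * t₀ + 1, by positivity, hκ0, ?_⟩
  intro H E _ _ _ _ _ _ ι B b μ lam s J e z ν ν₀ h hL hlam hlamκ hs hsκ hJ hsrc
  have hsl : 0 < √lam := Real.sqrt_pos.mpr hlam
  have hlam1 : lam ≤ 1 := hlamκ.trans hκb
  have hsl1 : √lam ≤ 1 := by rwa [Real.sqrt_le_one]
  have hsN : s ≤ s / √lam := by rw [le_div_iff₀ hsl]; exact mul_le_of_le_one_right hs hsl1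
  have hNa0 : 0 ≤ s / √lam := by positivity
  have hlog : 0 ≤ Real.log ((J : ℝ) + 1) := Real.log_nonneg (by simp)
  have hNaκ : s / √lam ≤ κ := (le_mul_of_one_le_right hNa0 (by linarith)).trans hsκ
  have hNa2 : cs / η * (s / √lam) ^ 2 ≤ min ((ε / 3) ^ 2) 1 := by
    refine le_trans ?_ hκc
    gcongr
  obtain ⟨w₀, he0, hw₀⟩ := hsrc
  have hbd : ∀ j ≤ J, ‖e j‖ ≤ X := fun j hj => by
    have h1 : ‖e 0‖ ^ 2 ≤ (η⁻¹ ^ r * W₀) ^ 2 := by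
      rw [he0]
      have := h.norm_pow_le hr₀.le w₀
      gcongr
      refine this.trans ?_
      gcongr
    have h2 : 3 * (‖e 0‖ ^ 2 + cs / η * (s / √lam) ^ 2) ≤ X ^ 2 := by
      have := hNa2.trans (min_le_right _ _)
      linarith
    exact (sq_le_sq₀ (norm_nonneg _) hX.le).mp
      ((hL.norm_sq_le hη hlam hce.le hcs h2 hX.le (Nat.zero_le j) hj).trans h2)
  refine ⟨hbd, ?_⟩
  obtain ⟨j₁, hj₁, hej, w, q, hwq, hw, hq⟩ := hsm h hL hlam (hlamκ.trans hκa) hs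
    (hsN.trans (hNaκ.trans hκa)) (by omega) hbd ⟨w₀, he0, hw₀⟩
  -- from the time `j₁` on the iteration is small
  have hL' : IsPerturbedLandweber B η lam s (max X (3 * X + ε)) ce cz cs cn J e z ν ν₀ :=
    { step := fun j hj _ => hL.step j hj (hbd j hj.le)
      nonlin := fun j hj _ => hL.nonlin j hj (hbd j hj.le)
      energy := fun j hj _ => hL.energy j hj (hbd j hj.le)
      noise := fun j hj _ => hL.noise j hj (hbd j hj.le)
      noise_const := hL.noise_const
      horizon := hL.horizon }
  have hsm' : ∀ j, j₁ ≤ j → j ≤ J → ‖e j‖ ≤ ε := fun j hj hjJ => by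
    have h1 : ‖e j₁‖ ^ 2 ≤ (ε / 3) ^ 2 := by gcongr
    have h2 := hNa2.trans (min_le_left _ _)
    have h3 : 3 * (‖e j₁‖ ^ 2 + cs / η * (s / √lam) ^ 2) ≤ ε ^ 2 := by
      have : (ε / 3) ^ 2 = ε ^ 2 / 9 := by ring
      linarith [sq_nonneg ε]
    -- ε need not be below X, so the Gronwall bound is applied with an enlarged threshold; the laws
    -- hold there because all errors are at most X.
    have h4 : ε ^ 2 ≤ max X (3 * X + ε) ^ 2 := by
      have : ε ≤ max X (3 * X + ε) := le_max_of_le_right (by linarith)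
      gcongr
    exact (sq_le_sq₀ (norm_nonneg _) hε0.le).mp ((hL'.norm_sq_le hη hlam hce.le hcs (h3.trans h4)
      (le_max_of_le_left hX.le) hj hjJ).trans h3)
  have hωsum : ∀ i, j₁ + i ≤ J → ∑ k ∈ Finset.range i, (((k : ℝ) + 1)⁻¹ + ((i : ℝ) - k)⁻¹) *
      (√(ε * K) * ((k : ℝ) + 1) ^ (-(r / 2)) + K₂ * (s / √lam)) ≤ ω := fun i hi => by
    have h1 := mul_le_mul_of_nonneg_left (hZle i) (Real.sqrt_nonneg (ε * K))
    have h2 := mul_le_mul_of_nonneg_left (sum_kernel_le i) (mul_nonneg hK₂0 hNa0)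
    have h3 : Real.log ((i : ℝ) + 1) ≤ Real.log ((J : ℝ) + 1) := by
      have : (i : ℝ) ≤ J := by exact_mod_cast (by omega : i ≤ J)
      exact Real.log_le_log (by positivity) (by linarith)
    have h4 : K₂ * (s / √lam) * (2 * (1 + Real.log ((i : ℝ) + 1))) ≤ ω / 2 := by
      calc K₂ * (s / √lam) * (2 * (1 + Real.log ((i : ℝ) + 1)))
          ≤ K₂ * (s / √lam) * (2 * (1 + Real.log ((J : ℝ) + 1))) := by gcongr
        _ = K₂ * (2 * (s / √lam * (1 + Real.log ((J : ℝ) + 1)))) := by ring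
        _ ≤ K₂ * (2 * κ) := by gcongr
        _ ≤ ω / 2 := hκd
    rw [hεZ] at h1
    calc _ = √(ε * K) * ∑ k ∈ Finset.range i, (((k : ℝ) + 1)⁻¹ + ((i : ℝ) - k)⁻¹) *
          ((k : ℝ) + 1) ^ (-(r / 2)) + K₂ * (s / √lam) *
          ∑ k ∈ Finset.range i, (((k : ℝ) + 1)⁻¹ + ((i : ℝ) - k)⁻¹) := by
          rw [Finset.mul_sum, Finset.mul_sum, ← Finset.sum_add_distrib]
          exact Finset.sum_congr rfl fun k _ => by ring
      _ ≤ ω := by linarith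
  obtain ⟨i, rfl⟩ := Nat.exists_eq_add_of_le (show j₁ ≤ J by omega)
  obtain ⟨ra, rb⟩ := hL.rates_of_small h hr₀ hr₁ hlam hlam1 hs hcn hcz.le hX.le hε0.le hbd hsm' hwq
    hw hCq hq hK0.le hK₂0 hKa hKb (by linarith) (by linarith) hω0.le hω1 hωc hωsum i le_rfl
  have hi1 : ((j₁ + i : ℕ) : ℝ) ≤ 2 * ((i : ℝ) + 1) := by
    have : j₁ + i ≤ 2 * (i + 1) := by omega
    exact_mod_cast this
  have hJpos : (0 : ℝ) < ((j₁ + i : ℕ) : ℝ) := by exact_mod_cast (by omega : 0 < j₁ + i)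
  constructor
  · have h1 := rpow_neg_le_two_mul hJpos hi1 hr₀.le (by linarith)
    have h2 : 0 < ((j₁ + i : ℕ) : ℝ) ^ (-r) := by positivity
    linarith [mul_le_mul_of_nonneg_left h1 hK0.le, mul_nonneg hK0.le hNa0,
      mul_nonneg hK₂0 h2.le]
  · have h1 := rpow_neg_le_two_mul (γ := r + 1 / 2) hJpos hi1 (by linarith) (by linarith)
    have h2 : 0 < ((j₁ + i : ℕ) : ℝ) ^ (-(r + 1 / 2)) := by positivity
    linarith [mul_le_mul_of_nonneg_left h1 hK0.le, mul_nonneg hK0.le hs,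
      mul_nonneg hK₂0 h2.le]

end

noncomputable section

universe u

/-! ### Hilbert-Schmidt operators and traces. -/

section HilbertSchmidt

variable {H F : Type*} [NormedAddCommGroup H] [InnerProductSpace ℝ H]
  [NormedAddCommGroup F] [InnerProductSpace ℝ F]
variable {ι κ : Type*}

/-- Orthonormal vectors have distance √2, so the balls of radius 1/2 around them are disjoint. -/
lemma HilbertBasis.countable [SecondCountableTopology H] (b : HilbertBasis ι ℝ H) :
    Countable ι := by
  have hd : Pairwise (Function.onFun Disjoint fun i => Metric.ball (b i) (1 / 2)) := by
    intro i j hij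
    refine Metric.ball_disjoint_ball ?_
    have h1 : ‖b i - b j‖ ^ 2 = 2 := by
      rw [norm_sub_sq_real, b.orthonormal.1 i, b.orthonormal.1 j, b.orthonormal.2 hij]
      norm_num
    rw [dist_eq_norm]
    nlinarith [norm_nonneg (b i - b j)]
  exact hd.countable_of_isOpen_disjoint (fun i => Metric.isOpen_ball)
    fun i => Metric.nonempty_ball.mpr (by norm_num)

lemma HilbertBasis.tsum_ofReal_inner_sq (b : HilbertBasis ι ℝ H) (x : H) :
    ∑' i, ENNReal.ofReal (⟪b i, x⟫ ^ 2) = ENNReal.ofReal (‖x‖ ^ 2) := by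
  rw [← (b.hasSum_inner_sq x).tsum_eq,
    ENNReal.ofReal_tsum_of_nonneg (fun _ => sq_nonneg _) (b.hasSum_inner_sq x).summable]

/-- Both sides are the double sum of the squared matrix entries. Applied twice, it shows that the
trace does not depend on the basis. -/
lemma tsum_norm_sq_eq_tsum_adjoint [CompleteSpace H] [CompleteSpace F] (Q : H →L[ℝ] F)
    (b : HilbertBasis ι ℝ H) (c : HilbertBasis κ ℝ F) :
    ∑' i, ENNReal.ofReal (‖Q (b i)‖ ^ 2) = ∑' k, ENNReal.ofReal (‖(Q†) (c k)‖ ^ 2) := by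
  simp_rw [← c.tsum_ofReal_inner_sq (Q _), ← b.tsum_ofReal_inner_sq ((Q†) _)]
  rw [ENNReal.tsum_comm]
  refine tsum_congr fun k => tsum_congr fun i => ?_
  rw [ContinuousLinearMap.adjoint_inner_right, real_inner_comm]

lemma opTrace_adjoint_comp [CompleteSpace H] [CompleteSpace F] (Q : H →L[ℝ] F) :
    opTrace (Q† ∘L Q) = ∑' i, ENNReal.ofReal (‖Q (stdBasis H i)‖ ^ 2) := by
  unfold opTrace
  refine tsum_congr fun i => ?_
  rw [ContinuousLinearMap.comp_apply, ContinuousLinearMap.adjoint_inner_right,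
    real_inner_self_eq_norm_sq]

lemma opTrace_adjoint_comp_eq [CompleteSpace H] [CompleteSpace F] (Q : H →L[ℝ] F)
    (b : HilbertBasis ι ℝ H) :
    opTrace (Q† ∘L Q) = ∑' i, ENNReal.ofReal (‖Q (b i)‖ ^ 2) := by
  rw [opTrace_adjoint_comp, tsum_norm_sq_eq_tsum_adjoint Q b (stdBasis F),
    tsum_norm_sq_eq_tsum_adjoint Q (stdBasis H) (stdBasis F)]

/-- The coordinates of Q†y are ⟨Q b_i, y⟩, so Cauchy-Schwarz bounds the norm of the adjoint. -/
lemma norm_sq_apply_le_of_hasSum [CompleteSpace H] [CompleteSpace F] (Q : H →L[ℝ] F)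
    (b : HilbertBasis ι ℝ H) {c : ℝ} (hQ : HasSum (fun i => ‖Q (b i)‖ ^ 2) c) : ‖Q‖ ^ 2 ≤ c := by
  have hc : 0 ≤ c := hQ.nonneg fun i => sq_nonneg _
  have h1 : ‖Q†‖ ≤ √c := by
    refine ContinuousLinearMap.opNorm_le_bound _ (Real.sqrt_nonneg c) fun y => ?_
    refine (sq_le_sq₀ (norm_nonneg _) (by positivity)).mp ?_
    rw [mul_pow, Real.sq_sqrt hc]
    refine hasSum_le (fun i => ?_) (b.hasSum_inner_sq ((Q†) y)) (hQ.mul_right _)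
    rw [ContinuousLinearMap.adjoint_inner_right, ← mul_pow, ← sq_abs]
    have := abs_real_inner_le_norm (Q (b i)) y
    gcongr
  rw [LinearIsometryEquiv.norm_map] at h1
  calc ‖Q‖ ^ 2 ≤ √c ^ 2 := by gcongr
    _ = c := Real.sq_sqrt hc

/-- Hilbert-Schmidt operators are compact. -/
lemma isCompactOperator_of_summable [CompleteSpace H] [CompleteSpace F] (Q : H →L[ℝ] F)
    (b : HilbertBasis ι ℝ H) (hQ : Summable fun i => ‖Q (b i)‖ ^ 2) : IsCompactOperator Q := by
  classical
  -- Finite rank truncations; their distance to Q is bounded by the tail of the Hilbert-Schmidt sum.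
  let G : Finset ι → H →L[ℝ] F := fun A => ∑ i ∈ A, (innerSL ℝ (b i)).smulRight (Q (b i))
  have hG : ∀ A, IsCompactOperator (G A) := fun A => by
    have h1 : ∀ i, IsCompactOperator ((innerSL ℝ (b i)).smulRight (Q (b i))) := fun i => by
      have h2 := (isCompactOperator_of_locallyCompactSpace_dom (innerSL ℝ (b i))).clm_comp
        (ContinuousLinearMap.toSpanSingleton ℝ (Q (b i)))
      exact h2
    have h3 : ∀ A : Finset ι, G A ∈ compactOperator (RingHom.id ℝ) H F := fun A =>
      Submodule.sum_mem _ fun i _ => h1 i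
    exact h3 A
  have hGb : ∀ A i, (Q - G A) (b i) = if i ∈ A then 0 else Q (b i) := fun A i => by
    simp only [G, sub_apply, sum_apply, ContinuousLinearMap.smulRight_apply,
      innerSL_apply_apply, orthonormal_iff_ite.mp b.orthonormal, ite_smul, one_smul, zero_smul,
      Finset.sum_ite_eq']
    split_ifs <;> simp
  refine isCompactOperator_of_tendsto (l := atTop) (F := G) ?_ (Eventually.of_forall hG)
  rw [tendsto_iff_norm_sub_tendsto_zero]
  have h0 : Tendsto (fun A : Finset ι => √(∑' i, ‖Q (b i)‖ ^ 2 - ∑ i ∈ A, ‖Q (b i)‖ ^ 2)) atTop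
      (𝓝 0) := by
    have h2 : Tendsto (fun A : Finset ι => ∑' i, ‖Q (b i)‖ ^ 2 - ∑ i ∈ A, ‖Q (b i)‖ ^ 2) atTop
        (𝓝 (∑' i, ‖Q (b i)‖ ^ 2 - ∑' i, ‖Q (b i)‖ ^ 2)) := hQ.hasSum.const_sub _
    rw [sub_self] at h2
    have h3 := (Real.continuous_sqrt.tendsto 0).comp h2
    rwa [Real.sqrt_zero] at h3
  refine squeeze_zero (fun _ => norm_nonneg _) (fun A => ?_) h0
  refine Real.le_sqrt_of_sq_le ?_
  rw [← norm_neg, neg_sub]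
  refine norm_sq_apply_le_of_hasSum _ b ?_
  have h4 : (fun i => ‖(Q - G A) (b i)‖ ^ 2) =
      fun i => ‖Q (b i)‖ ^ 2 - if i ∈ A then ‖Q (b i)‖ ^ 2 else 0 := funext fun i => by
    rw [hGb]
    split_ifs <;> simp
  rw [h4]
  have h5 : HasSum (fun i => if i ∈ A then ‖Q (b i)‖ ^ 2 else 0) (∑ i ∈ A, ‖Q (b i)‖ ^ 2) := by
    rw [← Finset.sum_congr rfl fun i hi => if_pos hi]
    exact hasSum_sum_of_ne_finset_zero fun i hi => if_neg hi
  exact hQ.hasSum.sub h5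

end HilbertSchmidt

/-! ### The effective dimension in an eigenbasis. -/

section EffectiveDimension

variable {H E : Type*} [NormedAddCommGroup H] [InnerProductSpace ℝ H] [CompleteSpace H]
  [NormedAddCommGroup E] [InnerProductSpace ℝ E] [CompleteSpace E]
variable {ι : Type*} {B : H →L[ℝ] E} {b : HilbertBasis ι ℝ H} {μ : ι → ℝ} {η lam : ℝ}

/-- The operator (L+λ)⁻¹L is written as Q†Q with Q diagonal, because then basis independence allows
the trace to be computed in b instead of the fixed basis of `opTrace`. The resolvent is exhibited as
a diagonal operator to show that `Ring.inverse` is a true inverse. -/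
lemma IsEigenSystem.effectiveDim_eq (h : IsEigenSystem B b μ η) (hlam : 0 < lam) :
    effectiveDim (B† ∘L B) lam = ∑' i, ENNReal.ofReal (μ i / (μ i + lam)) := by
  have hpos : ∀ i, 0 < μ i + lam := fun i => by linarith [h.nonneg i]
  have hinvb : ∀ i, |(μ i + lam)⁻¹| ≤ lam⁻¹ := fun i => by
    rw [abs_of_pos (inv_pos.mpr (hpos i))]
    exact inv_anti₀ hlam (by linarith [h.nonneg i])
  have hqb : ∀ i, |√(μ i / (μ i + lam))| ≤ 1 := fun i => by
    rw [abs_of_nonneg (Real.sqrt_nonneg _), Real.sqrt_le_one, div_le_one (hpos i)]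
    linarith
  set D := diagOp b fun i => (μ i + lam)⁻¹ with hD
  set Q := diagOp b fun i => √(μ i / (μ i + lam)) with hQ
  have hLlam : ∀ x i, ⟪b i, (B† ∘L B + lam • (1 : H →L[ℝ] H)) x⟫ = (μ i + lam) * ⟪b i, x⟫ :=
    fun x i => by
      rw [add_apply, inner_add_right, h.inner_adjoint_comp, smul_apply, one_apply_eq_self,
        real_inner_smul_right]
      ring
  have h1 : (B† ∘L B + lam • (1 : H →L[ℝ] H)) * D = 1 := by
    ext x
    refine b.ext_inner fun i => ?_
    rw [mul_apply_eq_comp, hLlam, inner_diagOp b hinvb, one_apply_eq_self]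
    field_simp [(hpos i).ne']
  have h2 : D * (B† ∘L B + lam • (1 : H →L[ℝ] H)) = 1 := by
    ext x
    refine b.ext_inner fun i => ?_
    rw [mul_apply_eq_comp, inner_diagOp b hinvb, hLlam, one_apply_eq_self]
    field_simp [(hpos i).ne']
  have hu : IsUnit (B† ∘L B + lam • (1 : H →L[ℝ] H)) := ⟨⟨_, D, h1, h2⟩, rfl⟩
  have hQb : ∀ i, Q (b i) = √(μ i / (μ i + lam)) • b i := fun i => by
    refine b.ext_inner fun j => ?_
    rw [inner_diagOp b hqb, real_inner_smul_right]
    by_cases hij : i = j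
    · rw [hij]
    · rw [b.orthonormal.2 (Ne.symm hij)]; simp
  have hQQ : ∀ x i, ⟪b i, (Q† ∘L Q) x⟫ = (μ i / (μ i + lam)) * ⟪b i, x⟫ := fun x i => by
    rw [ContinuousLinearMap.comp_apply, ContinuousLinearMap.adjoint_inner_right, hQb,
      real_inner_smul_left, inner_diagOp b hqb, ← mul_assoc,
      Real.mul_self_sqrt (div_nonneg (h.nonneg i) (hpos i).le)]
  have h3 : Ring.inverse (B† ∘L B + lam • (1 : H →L[ℝ] H)) * (B† ∘L B) = Q† ∘L Q := by
    rw [Ring.inverse_mul_eq_iff_eq_mul _ _ _ hu]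
    ext x
    refine b.ext_inner fun i => ?_
    rw [mul_apply_eq_comp, hLlam, hQQ, h.inner_adjoint_comp]
    field_simp [(hpos i).ne']
  rw [effectiveDim, h3, opTrace_adjoint_comp_eq Q b]
  refine tsum_congr fun i => ?_
  rw [hQb, norm_smul, b.orthonormal.1 i, mul_one, Real.norm_eq_abs, sq_abs,
    Real.sq_sqrt (div_nonneg (h.nonneg i) (hpos i).le)]

end EffectiveDimension

/-! ### The inclusion into L² is Hilbert-Schmidt. -/

section Kernel

variable {X Y : Type*} {H₂ : Type u} [MeasurableSpace X]
  [NormedAddCommGroup Y] [InnerProductSpace ℝ Y] [CompleteSpace Y]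
  [NormedAddCommGroup H₂] [InnerProductSpace ℝ H₂] [CompleteSpace H₂] [RKHS ℝ H₂ X Y]
variable {ι : Type*} {κ₀ : ℝ}

/-- The adjoint of K_x is evaluation at x, so the sum is the trace of K_x†K_x computed on the other
side. -/
lemma KernelCondition.tsum_norm_sq_le (hK : KernelCondition H₂ (X := X) (Y := Y) κ₀)
    (b : HilbertBasis ι ℝ H₂) (x : X) :
    ∑' i, ENNReal.ofReal (‖b i x‖ ^ 2) ≤ ENNReal.ofReal (κ₀ ^ 2) := by
  refine le_trans (le_of_eq ?_) (hK.trace_le x)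
  rw [opTrace_adjoint_comp, tsum_norm_sq_eq_tsum_adjoint _ (stdBasis Y) b]
  simp only [RKHS.adjoint_kerFun]

variable [MeasurableSpace Y] [BorelSpace Y] [SecondCountableTopology Y]
  (hK : KernelCondition H₂ (X := X) (Y := Y) κ₀) (m : Measure X) [IsProbabilityMeasure m]

lemma inclL2_ae_eq (h : H₂) : (inclL2 hK m h : X → Y) =ᵐ[m] fun x => h x :=
  (hK.memLp m h).coeFn_toLp

lemma inner_inclL2 (h k : H₂) : ⟪inclL2 hK m h, inclL2 hK m k⟫ = ∫ x, ⟪h x, k x⟫ ∂m := by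
  rw [L2.inner_def]
  refine integral_congr_ae ?_
  filter_upwards [inclL2_ae_eq hK m h, inclL2_ae_eq hK m k] with x h1 h2
  rw [h1, h2]

lemma integrable_inner_apply (hK : KernelCondition H₂ (X := X) (Y := Y) κ₀) (m : Measure X)
    [IsProbabilityMeasure m] (h k : H₂) : Integrable (fun x => ⟪h x, k x⟫) m := by
  refine (L2.integrable_inner (𝕜 := ℝ) (inclL2 hK m h) (inclL2 hK m k)).congr ?_
  filter_upwards [inclL2_ae_eq hK m h, inclL2_ae_eq hK m k] with x h1 h2
  rw [h1, h2]

lemma norm_inclL2_sq (h : H₂) : ‖inclL2 hK m h‖ ^ 2 = ∫ x, ‖h x‖ ^ 2 ∂m := by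
  rw [← real_inner_self_eq_norm_sq, inner_inclL2]
  simp only [real_inner_self_eq_norm_sq]

lemma ofReal_norm_inclL2_sq (h : H₂) :
    ENNReal.ofReal (‖inclL2 hK m h‖ ^ 2) = ∫⁻ x, ENNReal.ofReal (‖h x‖ ^ 2) ∂m := by
  rw [norm_inclL2_sq, ofReal_integral_eq_lintegral_ofReal]
  · have := integrable_inner_apply hK m h h
    simpa only [real_inner_self_eq_norm_sq] using this
  · exact Eventually.of_forall fun x => sq_nonneg _

lemma norm_inclL2_le (hκ₀ : 0 ≤ κ₀) : ‖inclL2 hK m‖ ≤ κ₀ := by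
  refine ContinuousLinearMap.opNorm_le_bound _ hκ₀ fun h => ?_
  refine (sq_le_sq₀ (norm_nonneg _) (by positivity)).mp ?_
  rw [norm_inclL2_sq]
  calc ∫ x, ‖h x‖ ^ 2 ∂m ≤ ∫ _, (κ₀ * ‖h‖) ^ 2 ∂m := by
        refine integral_mono_of_nonneg (Eventually.of_forall fun x => sq_nonneg _)
          (integrable_const _) (Eventually.of_forall fun x => ?_)
        have := hK.norm_apply_le h x
        rw [abs_of_nonneg hκ₀] at this
        dsimp only
        gcongr
    _ = _ := by simp

/-- By Tonelli, the Hilbert-Schmidt sum of S is the integral of the pointwise sums, each at most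
κ₀². Separability makes the basis countable. -/
lemma isCompactOperator_inclL2 [SecondCountableTopology H₂] :
    IsCompactOperator (inclL2 hK m) := by
  set b := stdBasis H₂
  have := b.countable
  refine isCompactOperator_of_summable _ b ?_
  have h1 : ∑' i, ENNReal.ofReal (‖inclL2 hK m (b i)‖ ^ 2) ≤ ENNReal.ofReal (κ₀ ^ 2) := by
    simp only [ofReal_norm_inclL2_sq]
    rw [← lintegral_tsum fun i =>
      ((hK.measurable_apply (b i)).norm.pow_const 2).ennreal_ofReal.aemeasurable]
    calc _ ≤ ∫⁻ _, ENNReal.ofReal (κ₀ ^ 2) ∂m := lintegral_mono fun x => hK.tsum_norm_sq_le b x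
      _ = _ := by simp
  have h2 := ENNReal.summable_toReal (ne_top_of_le_ne_top ENNReal.ofReal_ne_top h1)
  simpa only [ENNReal.toReal_ofReal (sq_nonneg _)] using h2

/-- The operator `L = S† S` has an orthonormal basis of eigenvectors. -/
lemma exists_isEigenSystem_inclL2 [SecondCountableTopology H₂] (hκ₀ : 0 < κ₀) :
    ∃ (ι : Type u) (b : HilbertBasis ι ℝ H₂) (μ : ι → ℝ),
      IsEigenSystem (inclL2 hK m) b μ (1 / κ₀ ^ 2) := by
  obtain ⟨ι, b, μ, hb⟩ := exists_eigenbasis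
    ((isCompactOperator_inclL2 hK m).clm_comp ((inclL2 hK m)†))
    (T := (inclL2 hK m)† ∘L inclL2 hK m) (IsEigenSystem.symm_adjoint_comp _)
  refine ⟨ι, b, μ, hb, by positivity, ?_⟩
  rw [one_div_mul_eq_div, div_le_one (by positivity)]
  have := norm_inclL2_le hK m hκ₀.le
  gcongr

end Kernel

end

noncomputable section

/-! ### Bernstein inequality in Hilbert space. -/

section Concentration

/-- As a function of x², cosh x is a power series with nonnegative coefficients, hence convex. -/
lemma Real.cosh_le_of_sq_le_convex_comb {x p q θ : ℝ} (hθ₀ : 0 ≤ θ) (hθ₁ : θ ≤ 1)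
    (h : x ^ 2 = θ * p ^ 2 + (1 - θ) * q ^ 2) :
    Real.cosh x ≤ θ * Real.cosh p + (1 - θ) * Real.cosh q := by
  refine hasSum_le (fun k => ?_) (Real.hasSum_cosh x)
    (((Real.hasSum_cosh p).mul_left θ).add ((Real.hasSum_cosh q).mul_left (1 - θ)))
  have h1 := (convexOn_pow (𝕜 := ℝ) k).2 (Set.mem_Ici.mpr (sq_nonneg p))
    (Set.mem_Ici.mpr (sq_nonneg q)) hθ₀ (sub_nonneg.mpr hθ₁) (by ring)
  simp only [smul_eq_mul] at h1
  rw [pow_mul, pow_mul, pow_mul, h, ← mul_div_assoc, ← mul_div_assoc, ← add_div]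
  gcongr

variable {F : Type*} [NormedAddCommGroup F] [InnerProductSpace ℝ F]

/-- The square ‖s+x‖² is a convex combination of (‖s‖+‖x‖)² and (‖s‖−‖x‖)², with weights given by
the cosine of the angle. Convexity of cosh in the square then isolates a part linear in x, which has
mean zero for centred x. -/
lemma cosh_norm_add_le (s x : F) :
    Real.cosh ‖s + x‖ ≤ Real.cosh ‖s‖ * (Real.exp ‖x‖ - ‖x‖) +
      Real.sinh ‖s‖ / ‖s‖ * ⟪s, x⟫ := by
  rcases eq_or_ne s 0 with rfl | hs
  · have := Real.exp_pos (-‖x‖)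
    have h2 : Real.sinh ‖x‖ ≥ ‖x‖ := Real.self_le_sinh_iff.mpr (norm_nonneg x)
    have h3 := Real.cosh_add_sinh ‖x‖
    simp
    linarith
  rcases eq_or_ne x 0 with rfl | hx
  · simp
  have ha := norm_pos_iff.mpr hs
  have hb := norm_pos_iff.mpr hx
  obtain ⟨hc1, hc2⟩ := abs_le.mp (abs_real_inner_le_norm s x)
  set a := ‖s‖
  set b := ‖x‖
  set c := ⟪s, x⟫
  have hab : 0 < a * b := mul_pos ha hb
  have hq1 : -1 ≤ c / (a * b) := by rw [le_div_iff₀ hab]; linarith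
  have hq2 : c / (a * b) ≤ 1 := by rw [div_le_one hab]; exact hc2
  have h1 : Real.cosh ‖s + x‖ ≤ (1 + c / (a * b)) / 2 * Real.cosh (a + b) +
      (1 - (1 + c / (a * b)) / 2) * Real.cosh (a - b) := by
    refine Real.cosh_le_of_sq_le_convex_comb (by linarith) (by linarith) ?_
    rw [norm_add_sq_real]
    change a ^ 2 + 2 * c + b ^ 2 = _
    field_simp
    ring
  have hs0 : 0 ≤ Real.sinh a := Real.sinh_nonneg_iff.mpr ha.le
  have hs1 : b ≤ Real.sinh b := Real.self_le_sinh_iff.mpr hb.le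
  have h2 : c / (a * b) * (Real.sinh a * Real.sinh b) ≤
      Real.sinh a / a * c + Real.sinh a * (Real.sinh b - b) := by
    have e1 : c / (a * b) * (Real.sinh a * Real.sinh b) =
        Real.sinh a / a * c + c / (a * b) * (Real.sinh a * (Real.sinh b - b)) := by
      field_simp
      ring
    rw [e1]
    have := mul_le_mul_of_nonneg_right hq2 (mul_nonneg hs0 (sub_nonneg.mpr hs1))
    linarith
  have h3 : Real.sinh a * (Real.sinh b - b) ≤ Real.cosh a * (Real.sinh b - b) :=
    mul_le_mul_of_nonneg_right (Real.sinh_lt_cosh a).le (sub_nonneg.mpr hs1)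
  rw [Real.cosh_add, Real.cosh_sub] at h1
  rw [← Real.cosh_add_sinh b]
  linarith

variable [MeasurableSpace F] [BorelSpace F] [SecondCountableTopology F]
  {Ω : Type*} [MeasurableSpace Ω] {P : Measure Ω}

lemma lintegral_cosh_norm_add_le {ξ : Ω → F} {N : Ω → ℝ} (hξ : Measurable ξ)
    (hξN : ∀ᵐ ω ∂P, ‖ξ ω‖ ≤ N ω) (hmean : ∀ s, ∫ ω, ⟪s, ξ ω⟫ ∂P = 0) {q : ℝ}
    (hq : ∫⁻ ω, ENNReal.ofReal (Real.exp (N ω) - N ω) ∂P ≤ ENNReal.ofReal q) (s : F) :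
    ∫⁻ ω, ENNReal.ofReal (Real.cosh ‖s + ξ ω‖) ∂P ≤
      ENNReal.ofReal (Real.cosh ‖s‖) * ENNReal.ofReal q := by
  have hpos : ∀ x : ℝ, 0 ≤ Real.exp x - x := fun x => by linarith [Real.add_one_le_exp x]
  -- The function e^t − t increases for t ≥ 0, so the norm may be replaced by its majorant N.
  have hmono : ∀ᵐ ω ∂P, Real.exp ‖ξ ω‖ - ‖ξ ω‖ ≤ Real.exp (N ω) - N ω := by
    filter_upwards [hξN] with ω h
    have h0 := norm_nonneg (ξ ω)
    have h1 := Real.add_one_le_exp (N ω - ‖ξ ω‖)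
    have h2 : Real.exp (N ω) = Real.exp ‖ξ ω‖ * Real.exp (N ω - ‖ξ ω‖) := by
      rw [← Real.exp_add]; ring_nf
    have h3 := Real.one_le_exp h0
    nlinarith [mul_le_mul h3 h1 (by linarith) (by linarith)]
  have hmeas : Measurable fun ω => Real.exp ‖ξ ω‖ - ‖ξ ω‖ := by fun_prop
  have hle : ∫⁻ ω, ENNReal.ofReal (Real.exp ‖ξ ω‖ - ‖ξ ω‖) ∂P ≤ ENNReal.ofReal q :=
    (lintegral_mono_ae (hmono.mono fun ω h => ENNReal.ofReal_le_ofReal h)).trans hq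
  have hint : Integrable (fun ω => Real.exp ‖ξ ω‖ - ‖ξ ω‖) P := by
    refine ⟨hmeas.aestronglyMeasurable, ?_⟩
    rw [hasFiniteIntegral_iff_ofReal (Eventually.of_forall fun ω => hpos _)]
    exact hle.trans_lt ENNReal.ofReal_lt_top
  have hnorm : Integrable (fun ω => ‖ξ ω‖) P := by
    refine hint.mono' (by fun_prop) (Eventually.of_forall fun ω => ?_)
    rw [norm_norm]
    have := Real.quadratic_le_exp_of_nonneg (norm_nonneg (ξ ω))
    nlinarith [sq_nonneg (‖ξ ω‖ - 1)]
  have hinner : Integrable (fun ω => ⟪s, ξ ω⟫) P := by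
    refine (hnorm.const_mul ‖s‖).mono' (by fun_prop) (Eventually.of_forall fun ω => ?_)
    exact norm_inner_le_norm s (ξ ω)
  calc ∫⁻ ω, ENNReal.ofReal (Real.cosh ‖s + ξ ω‖) ∂P
      ≤ ∫⁻ ω, ENNReal.ofReal (Real.cosh ‖s‖ * (Real.exp ‖ξ ω‖ - ‖ξ ω‖) +
          Real.sinh ‖s‖ / ‖s‖ * ⟪s, ξ ω⟫) ∂P :=
        lintegral_mono fun ω => ENNReal.ofReal_le_ofReal (cosh_norm_add_le s (ξ ω))
    _ = ENNReal.ofReal (∫ ω, (Real.cosh ‖s‖ * (Real.exp ‖ξ ω‖ - ‖ξ ω‖) +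
          Real.sinh ‖s‖ / ‖s‖ * ⟪s, ξ ω⟫) ∂P) := by
        refine (ofReal_integral_eq_lintegral_ofReal
          ((hint.const_mul _).add (hinner.const_mul _)) ?_).symm
        exact Eventually.of_forall fun ω =>
          (Real.cosh_pos _).le.trans (cosh_norm_add_le s (ξ ω))
    _ = ENNReal.ofReal (Real.cosh ‖s‖) *
          ∫⁻ ω, ENNReal.ofReal (Real.exp ‖ξ ω‖ - ‖ξ ω‖) ∂P := by
        rw [integral_add (hint.const_mul _) (hinner.const_mul _), integral_const_mul,
          integral_const_mul, hmean, mul_zero, add_zero, ENNReal.ofReal_mul (Real.cosh_pos _).le,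
          ofReal_integral_eq_lintegral_ofReal hint (Eventually.of_forall fun ω => hpos _)]
    _ ≤ _ := by gcongr

variable [IsProbabilityMeasure P]

/-- Induction over an arbitrary starting point s: the first sample is split off by Tonelli and
absorbed into s, and each sample costs a factor q. -/
lemma lintegral_cosh_norm_sum_le {ξ : Ω → F} {N : Ω → ℝ} (hξ : Measurable ξ)
    (hξN : ∀ᵐ ω ∂P, ‖ξ ω‖ ≤ N ω) (hmean : ∀ s, ∫ ω, ⟪s, ξ ω⟫ ∂P = 0) {q : ℝ}
    (hq : ∫⁻ ω, ENNReal.ofReal (Real.exp (N ω) - N ω) ∂P ≤ ENNReal.ofReal q) (n : ℕ) (s : F) :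
    ∫⁻ z : Fin n → Ω, ENNReal.ofReal (Real.cosh ‖s + ∑ j, ξ (z j)‖) ∂(Measure.pi fun _ => P) ≤
      ENNReal.ofReal (Real.cosh ‖s‖) * ENNReal.ofReal q ^ n := by
  induction n generalizing s with
  | zero => simp
  | succ n ih =>
    have hmp := (measurePreserving_piFinSuccAbove (fun _ : Fin (n + 1) => P) 0)
    have hsymm := hmp.symm
    rw [← hsymm.lintegral_comp_emb (MeasurableEquiv.measurableEmbedding _)]
    rw [lintegral_prod _ (by
      refine Measurable.aemeasurable ?_
      refine (Real.measurable_cosh.comp (measurable_const.add ?_).norm).ennreal_ofReal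
      refine Finset.measurable_sum _ fun j _ => hξ.comp ?_
      exact (measurable_pi_apply j).comp (MeasurableEquiv.measurable _))]
    have h1 : ∀ (x : Ω) (y : Fin n → Ω),
        s + ∑ j, ξ ((MeasurableEquiv.piFinSuccAbove (fun _ => Ω) 0).symm (x, y) j) =
          (s + ξ x) + ∑ j, ξ (y j) := fun x y => by
      rw [Fin.sum_univ_succ, add_assoc]
      simp [MeasurableEquiv.piFinSuccAbove]
    simp only [h1]
    calc _ ≤ ∫⁻ x, ENNReal.ofReal (Real.cosh ‖s + ξ x‖) * ENNReal.ofReal q ^ n ∂P :=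
          lintegral_mono fun x => ih (s + ξ x)
      _ = (∫⁻ x, ENNReal.ofReal (Real.cosh ‖s + ξ x‖) ∂P) * ENNReal.ofReal q ^ n :=
          lintegral_mul_const _ (by fun_prop)
      _ ≤ ENNReal.ofReal (Real.cosh ‖s‖) * ENNReal.ofReal q * ENNReal.ofReal q ^ n := by
          gcongr
          exact lintegral_cosh_norm_add_le hξ hξN hmean hq s
      _ = _ := by rw [pow_succ', mul_assoc]

/-- The moment bounds turn the exponential series, from the quadratic term on, into a geometric
series of ratio tc ≤ 1/2. -/
lemma lintegral_exp_sub_le {N : Ω → ℝ} (hN : Measurable N) (hN₀ : ∀ ω, 0 ≤ N ω) {v c t : ℝ}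
    (hv : 0 ≤ v) (hc : 0 ≤ c) (ht : 0 ≤ t) (htc : t * c ≤ 1 / 2)
    (hmom : ∀ l : ℕ, 2 ≤ l → ∫⁻ ω, ENNReal.ofReal (N ω ^ l) ∂P ≤
      ENNReal.ofReal (1 / 2 * l.factorial * v * c ^ (l - 2))) :
    ∫⁻ ω, ENNReal.ofReal (Real.exp (t * N ω) - t * N ω) ∂P ≤ ENNReal.ofReal (1 + v * t ^ 2) := by
  have h1 : ∀ ω, ENNReal.ofReal (Real.exp (t * N ω) - t * N ω) =
      1 + ∑' l : ℕ, ENNReal.ofReal (t ^ (l + 2) / (l + 2).factorial * N ω ^ (l + 2)) := fun ω => by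
    have h2 := (hasSum_nat_add_iff' 2).mpr (NormedSpace.expSeries_div_hasSum_exp (t * N ω))
    rw [← Real.exp_eq_exp_ℝ] at h2
    have h3 : ∀ l : ℕ, (t * N ω) ^ (l + 2) / (l + 2).factorial =
        t ^ (l + 2) / (l + 2).factorial * N ω ^ (l + 2) := fun l => by rw [mul_pow]; ring
    simp only [h3] at h2
    have h0 : ∀ l : ℕ, 0 ≤ t ^ (l + 2) / (l + 2).factorial * N ω ^ (l + 2) := fun l => by
      have := hN₀ ω
      positivity
    rw [← ENNReal.ofReal_tsum_of_nonneg h0 h2.summable, h2.tsum_eq, ← ENNReal.ofReal_one,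
      ← ENNReal.ofReal_add zero_le_one (h2.nonneg h0)]
    congr 1
    simp [Finset.sum_range_succ]
    ring
  have hgeo : HasSum (fun l : ℕ => 1 / 2 * v * t ^ 2 * (1 / 2 : ℝ) ^ l) (v * t ^ 2) := by
    have := (hasSum_geometric_two).mul_left (1 / 2 * v * t ^ 2)
    have e : 1 / 2 * v * t ^ 2 * 2 = v * t ^ 2 := by ring
    rwa [e] at this
  simp only [h1]
  rw [lintegral_add_left measurable_const, lintegral_const, measure_univ, mul_one,
    lintegral_tsum fun l => (by fun_prop), ENNReal.ofReal_add zero_le_one (by positivity),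
    ENNReal.ofReal_one]
  gcongr
  rw [← hgeo.tsum_eq, ENNReal.ofReal_tsum_of_nonneg (fun l => by positivity) hgeo.summable]
  refine ENNReal.tsum_le_tsum fun l => ?_
  have h4 : ∀ ω, ENNReal.ofReal (t ^ (l + 2) / (l + 2).factorial * N ω ^ (l + 2)) =
      ENNReal.ofReal (t ^ (l + 2) / (l + 2).factorial) * ENNReal.ofReal (N ω ^ (l + 2)) :=
    fun ω => ENNReal.ofReal_mul (by positivity)
  simp only [h4]
  rw [lintegral_const_mul _ (by fun_prop)]
  refine (mul_le_mul_right (hmom (l + 2) (by omega)) _).trans ?_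
  rw [← ENNReal.ofReal_mul (by positivity)]
  refine ENNReal.ofReal_le_ofReal ?_
  have hf : (0 : ℝ) < (l + 2).factorial := by positivity
  have h5 : t ^ (l + 2) / (l + 2).factorial * (1 / 2 * (l + 2).factorial * v * c ^ (l + 2 - 2)) =
      1 / 2 * v * t ^ 2 * (t * c) ^ l := by
    rw [Nat.add_sub_cancel, mul_pow]
    field_simp
    ring
  rw [h5]
  have := pow_le_pow_left₀ (mul_nonneg ht hc) htc l
  gcongr

/-- A Bernstein inequality in Hilbert space. -/
lemma measure_norm_sum_gt_le {ξ : Ω → F} {N : Ω → ℝ} (hξ : Measurable ξ) (hN : Measurable N)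
    (hN₀ : ∀ ω, 0 ≤ N ω) (hξN : ∀ᵐ ω ∂P, ‖ξ ω‖ ≤ N ω) (hmean : ∀ s, ∫ ω, ⟪s, ξ ω⟫ ∂P = 0)
    {v c : ℝ} (hv : 0 < v) (hc : 0 < c)
    (hmom : ∀ l : ℕ, 2 ≤ l → ∫⁻ ω, ENNReal.ofReal (N ω ^ l) ∂P ≤
      ENNReal.ofReal (1 / 2 * l.factorial * v * c ^ (l - 2)))
    {δ : ℝ} (hδ₀ : 0 < δ) (hδ₁ : δ ≤ 1) (n : ℕ) :
    (Measure.pi fun _ : Fin n => P)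
      {z | 2 * Real.log (6 / δ) * (2 * c + √(n * v)) < ‖∑ j, ξ (z j)‖} ≤
        ENNReal.ofReal (δ / 2) := by
  -- The exponential parameter is 1/w. The summand 2c makes the geometric ratio at most 1/2, and w²
  -- ≥ nv makes (1 + v/w²)^n at most e.
  obtain ⟨w, hw⟩ : ∃ w, w = 2 * c + √(n * v) := ⟨_, rfl⟩
  have hw0 : 0 < w := by rw [hw]; positivity
  have hwc : 2 * c ≤ w := by rw [hw]; linarith [Real.sqrt_nonneg (n * v)]
  have hwn : n * v ≤ w ^ 2 := by
    calc (n * v : ℝ) = √(n * v) ^ 2 := (Real.sq_sqrt (by positivity)).symm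
      _ ≤ w ^ 2 := by
        have : √(n * v) ≤ w := by rw [hw]; linarith
        gcongr
  have hq := lintegral_exp_sub_le hN hN₀ hv.le hc.le (inv_pos.mpr hw0).le
    (by rw [inv_mul_le_iff₀ hw0]; linarith) hmom
  have h1 := lintegral_cosh_norm_sum_le (ξ := fun ω => w⁻¹ • ξ ω) (N := fun ω => w⁻¹ * N ω)
    (hξ.const_smul _)
    (hξN.mono fun ω h => by
      rw [norm_smul, Real.norm_of_nonneg (inv_pos.mpr hw0).le]
      gcongr)
    (fun s => by simp only [real_inner_smul_right, integral_const_mul, hmean, mul_zero]) hq n 0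
  have h2 : ENNReal.ofReal (1 + v * w⁻¹ ^ 2) ^ n ≤ ENNReal.ofReal (Real.exp 1) := by
    rw [← ENNReal.ofReal_pow (by positivity)]
    refine ENNReal.ofReal_le_ofReal ?_
    calc (1 + v * w⁻¹ ^ 2) ^ n ≤ Real.exp (v * w⁻¹ ^ 2) ^ n := by
          refine pow_le_pow_left₀ (by positivity) ?_ n
          linarith [Real.add_one_le_exp (v * w⁻¹ ^ 2)]
      _ = Real.exp (n * (v * w⁻¹ ^ 2)) := (Real.exp_nat_mul _ _).symm
      _ ≤ Real.exp 1 := by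
          refine Real.exp_le_exp.mpr ?_
          rw [inv_pow, ← mul_assoc, ← div_eq_mul_inv, div_le_one (by positivity)]
          exact hwn
  simp only [norm_zero, Real.cosh_zero, ENNReal.ofReal_one, one_mul, zero_add,
    ← Finset.smul_sum] at h1
  -- On this event the normalised norm is at least 2 log(6/δ), so cosh is at least (6/δ)²/2 = 18/δ²,
  -- and Markov's inequality applies.
  have h3 : ∀ z ∈ {z : Fin n → Ω | 2 * Real.log (6 / δ) * (2 * c + √(n * v)) < ‖∑ j, ξ (z j)‖},
      ENNReal.ofReal (18 / δ ^ 2) ≤ ENNReal.ofReal (Real.cosh ‖w⁻¹ • ∑ j, ξ (z j)‖) := by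
    intro z hz
    rw [Set.mem_ofPred_eq, ← hw] at hz
    refine ENNReal.ofReal_le_ofReal ?_
    have h4 : 2 * Real.log (6 / δ) ≤ ‖w⁻¹ • ∑ j, ξ (z j)‖ := by
      rw [norm_smul, Real.norm_of_nonneg (inv_pos.mpr hw0).le, le_inv_mul_iff₀ hw0]
      linarith
    have h5 : Real.exp (2 * Real.log (6 / δ)) = (6 / δ) ^ 2 := by
      rw [two_mul, Real.exp_add, Real.exp_log (by positivity)]; ring
    have h6 := Real.exp_le_exp.mpr h4
    rw [h5] at h6
    rw [Real.cosh_eq]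
    have h7 := (Real.exp_pos (-‖w⁻¹ • ∑ j, ξ (z j)‖)).le
    have h8 : 18 / δ ^ 2 = (6 / δ) ^ 2 / 2 := by ring
    linarith
  have h4 := meas_ge_le_lintegral_div (μ := Measure.pi fun _ : Fin n => P)
    (f := fun z => ENNReal.ofReal (Real.cosh ‖w⁻¹ • ∑ j, ξ (z j)‖))
    ((Real.measurable_cosh.comp ((Finset.measurable_sum _ fun j _ =>
      hξ.comp (measurable_pi_apply j)).const_smul w⁻¹).norm).ennreal_ofReal.aemeasurable)
    (ε := ENNReal.ofReal (18 / δ ^ 2))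
    (by rw [Ne, ENNReal.ofReal_eq_zero, not_le]; positivity) ENNReal.ofReal_ne_top
  refine (measure_mono h3).trans (h4.trans ?_)
  refine (ENNReal.div_le_div_right (h1.trans h2) _).trans ?_
  rw [← ENNReal.ofReal_div_of_pos (by positivity)]
  refine ENNReal.ofReal_le_ofReal ?_
  -- It remains that e ≤ 9/δ, which holds as δ ≤ 1.
  have h5 := Real.exp_one_lt_d9
  rw [div_le_iff₀ (by positivity)]
  have h6 : δ / 2 * (18 / δ ^ 2) = 9 / δ := by field_simp; norm_num
  rw [h6, le_div_iff₀ hδ₀]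
  nlinarith [Real.exp_pos 1]

/-- A Bernstein inequality for a countable family of coordinates. -/
lemma measure_sum_sq_gt_le {κ : Type*} [Countable κ] {f : κ → Ω → ℝ} {N : Ω → ℝ}
    (hf : ∀ k, Measurable (f k)) (hN : Measurable N) (hN₀ : ∀ ω, 0 ≤ N ω)
    (hfN : ∀ᵐ ω ∂P, ∀ A : Finset κ, ∑ k ∈ A, f k ω ^ 2 ≤ N ω ^ 2)
    (hint : ∀ k, Integrable (f k) P) (hmean : ∀ k, ∫ ω, f k ω ∂P = 0)
    {v c : ℝ} (hv : 0 < v) (hc : 0 < c)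
    (hmom : ∀ l : ℕ, 2 ≤ l → ∫⁻ ω, ENNReal.ofReal (N ω ^ l) ∂P ≤
      ENNReal.ofReal (1 / 2 * l.factorial * v * c ^ (l - 2)))
    {δ : ℝ} (hδ₀ : 0 < δ) (hδ₁ : δ ≤ 1) (n : ℕ) :
    (Measure.pi fun _ : Fin n => P)
      {z | ∃ A : Finset κ, (2 * Real.log (6 / δ) * (2 * c + √(n * v))) ^ 2 <
        ∑ k ∈ A, (∑ j, f k (z j)) ^ 2} ≤ ENNReal.ofReal (δ / 2) := by
  have hΛ : 0 ≤ 2 * Real.log (6 / δ) * (2 * c + √(n * v)) := by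
    have : 0 ≤ Real.log (6 / δ) := Real.log_nonneg (by rw [le_div_iff₀ hδ₀]; linarith)
    positivity
  -- The event is a directed union over finite sets of coordinates. The finite-dimensional bound
  -- does not depend on the set, so it passes to the union.
  rw [Set.ofPred_exists, Directed.measure_iUnion]
  · refine iSup_le fun A => ?_
    have h1 := measure_norm_sum_gt_le (P := P)
      (ξ := fun ω => (WithLp.toLp 2 fun k : A => f k ω : EuclideanSpace ℝ A)) (N := N)
      (by fun_prop) hN hN₀ (by
        filter_upwards [hfN] with ω h
        refine (sq_le_sq₀ (norm_nonneg _) (hN₀ ω)).mp ?_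
        rw [EuclideanSpace.real_norm_sq_eq]
        exact (Finset.sum_coe_sort A fun k => f k ω ^ 2).trans_le (h A))
      (fun s => by
        simp only [PiLp.inner_apply]
        rw [integral_finsetSum]
        · refine Finset.sum_eq_zero fun k _ => ?_
          simp [integral_mul_const, hmean]
        · intro k _
          simp only [RCLike.inner_apply, conj_trivial]
          exact (hint k).mul_const _) hv hc hmom hδ₀ hδ₁ n
    refine (measure_mono fun z hz => ?_).trans h1
    rw [Set.mem_ofPred_eq] at hz ⊢
    refine (sq_lt_sq₀ hΛ (norm_nonneg _)).mp (hz.trans_eq ?_)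
    rw [EuclideanSpace.real_norm_sq_eq, ← Finset.sum_coe_sort A]
    simp
  · refine Monotone.directed_le fun A A' hA z hz => ?_
    rw [Set.mem_ofPred_eq] at hz ⊢
    exact hz.trans_le (Finset.sum_le_sum_of_subset_of_nonneg hA fun _ _ _ => sq_nonneg _)

end Concentration

end

noncomputable section

/-! ### Weighted norms in coordinates. -/

section Coordinates

variable {H : Type*} [NormedAddCommGroup H] [InnerProductSpace ℝ H] [CompleteSpace H]
  {ι : Type*}

/-- Cauchy-Schwarz with weights. For p_k = √(μ_k+λ) the hypothesis bounds the norm of (L+λ)^(-1/2)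
ξ, and Q is the squared norm of (L+λ)^(1/2) h. -/
lemma HilbertBasis.abs_inner_le_of_sum_sq_le (b : HilbertBasis ι ℝ H) {p : ι → ℝ}
    (hp : ∀ k, 0 < p k) {ξ h : H} {R Q : ℝ} (hR : 0 ≤ R)
    (hξ : ∀ A : Finset ι, ∑ k ∈ A, (⟪b k, ξ⟫ / p k) ^ 2 ≤ R ^ 2)
    (hQ : HasSum (fun k => p k ^ 2 * ⟪b k, h⟫ ^ 2) Q) : |⟪h, ξ⟫| ≤ R * √Q := by
  have h1 : HasSum (fun k => ⟪h, b k⟫ * ⟪b k, ξ⟫) ⟪h, ξ⟫ := b.hasSum_inner_mul_inner h ξ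
  refine le_of_tendsto h1.abs (Eventually.of_forall fun A => ?_)
  have hQ0 : 0 ≤ Q := hQ.nonneg fun k => by positivity
  refine abs_le_of_sq_le_sq ?_ (by positivity)
  have h2 : ∑ k ∈ A, ⟪h, b k⟫ * ⟪b k, ξ⟫ = ∑ k ∈ A, (⟪b k, ξ⟫ / p k) * (p k * ⟪b k, h⟫) :=
    Finset.sum_congr rfl fun k _ => by
      rw [real_inner_comm]
      field_simp [(hp k).ne']
  have h3 : ∑ k ∈ A, (p k * ⟪b k, h⟫) ^ 2 ≤ Q := by
    simp only [mul_pow]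
    exact sum_le_hasSum A (fun k _ => by positivity) hQ
  rw [h2, mul_pow, Real.sq_sqrt hQ0]
  refine (Finset.sum_mul_sq_le_sq_mul_sq _ _ _).trans ?_
  exact mul_le_mul (hξ A) h3 (Finset.sum_nonneg fun _ _ => sq_nonneg _) (sq_nonneg R)

/-- The weighted Hilbert-Schmidt norm dominates the weighted operator norm. Hence one bound on
matrix entries controls Δ on all vectors at once, including the sample-dependent ones in the
iteration. -/
lemma HilbertBasis.sum_sq_apply_le (b : HilbertBasis ι ℝ H) {p : ι → ℝ}
    {Δ : H →L[ℝ] H} {R : ℝ}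
    (hΔ : ∀ A : Finset (ι × ι), ∑ q ∈ A, (⟪b q.1, Δ (b q.2)⟫ / p q.1) ^ 2 ≤ R ^ 2) (h : H)
    (A : Finset ι) : ∑ k ∈ A, (⟪b k, Δ h⟫ / p k) ^ 2 ≤ (R * ‖h‖) ^ 2 := by
  have h1 : ∑ k ∈ A, ‖(Δ†) (b k)‖ ^ 2 / p k ^ 2 ≤ R ^ 2 := by
    have h2 : HasSum (fun i => ∑ k ∈ A, ⟪b i, (Δ†) (b k)⟫ ^ 2 / p k ^ 2)
        (∑ k ∈ A, ‖(Δ†) (b k)‖ ^ 2 / p k ^ 2) :=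
      hasSum_sum fun k _ => (b.hasSum_inner_sq _).div_const _
    refine le_of_tendsto h2 (Eventually.of_forall fun I => ?_)
    rw [Finset.sum_comm, ← Finset.sum_product']
    refine le_trans (le_of_eq ?_) (hΔ (A ×ˢ I))
    refine Finset.sum_congr rfl fun q _ => ?_
    rw [ContinuousLinearMap.adjoint_inner_right, real_inner_comm, div_pow]
  calc ∑ k ∈ A, (⟪b k, Δ h⟫ / p k) ^ 2 ≤ ∑ k ∈ A, ‖(Δ†) (b k)‖ ^ 2 / p k ^ 2 * ‖h‖ ^ 2 := by
        refine Finset.sum_le_sum fun k _ => ?_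
        rw [div_pow, div_mul_eq_mul_div, ← ContinuousLinearMap.adjoint_inner_left, ← mul_pow,
          ← sq_abs ⟪_, _⟫]
        have := abs_real_inner_le_norm ((Δ†) (b k)) h
        gcongr
    _ = (∑ k ∈ A, ‖(Δ†) (b k)‖ ^ 2 / p k ^ 2) * ‖h‖ ^ 2 := by rw [Finset.sum_mul]
    _ ≤ _ := by rw [mul_pow]; gcongr

lemma IsEigenSystem.hasSum_add_mul_inner_sq {E : Type*} [NormedAddCommGroup E]
    [InnerProductSpace ℝ E] [CompleteSpace E] {B : H →L[ℝ] E} {b : HilbertBasis ι ℝ H}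
    {μ : ι → ℝ} {η : ℝ} (hB : IsEigenSystem B b μ η) (lam : ℝ) (h : H) :
    HasSum (fun k => (μ k + lam) * ⟪b k, h⟫ ^ 2) (‖B h‖ ^ 2 + lam * ‖h‖ ^ 2) := by
  have h1 : HasSum (fun k => ⟪h, b k⟫ * ⟪b k, (B† ∘L B) h⟫) ⟪h, (B† ∘L B) h⟫ :=
    b.hasSum_inner_mul_inner h _
  have h2 : (fun k => ⟪h, b k⟫ * ⟪b k, (B† ∘L B) h⟫) = fun k => μ k * ⟪b k, h⟫ ^ 2 :=
    funext fun k => by rw [hB.inner_adjoint_comp, real_inner_comm]; ring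
  rw [h2, ContinuousLinearMap.comp_apply, ContinuousLinearMap.adjoint_inner_right,
    real_inner_self_eq_norm_sq] at h1
  have h3 := h1.add ((b.hasSum_inner_sq h).mul_left lam)
  have h4 : (fun k => μ k * ⟪b k, h⟫ ^ 2 + lam * ⟪b k, h⟫ ^ 2) =
      fun k => (μ k + lam) * ⟪b k, h⟫ ^ 2 := funext fun k => by ring
  rwa [h4] at h3

end Coordinates

/-! ### The leverage function, whose mean is the effective dimension. -/

section Leverage

variable {X Y : Type*} {H₂ : Type*} [MeasurableSpace X]
  [NormedAddCommGroup Y] [InnerProductSpace ℝ Y] [CompleteSpace Y]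
  [NormedAddCommGroup H₂] [InnerProductSpace ℝ H₂] [CompleteSpace H₂] [RKHS ℝ H₂ X Y]
variable {ι : Type*} {κ₀ : ℝ}

/-- The function `x ↦ Tr ((L + λ)⁻¹ K_x K_x†)`. -/
def leverage (b : HilbertBasis ι ℝ H₂) (μ : ι → ℝ) (lam : ℝ) (x : X) : ℝ :=
  (∑' k, ENNReal.ofReal (‖b k x‖ ^ 2 / (μ k + lam))).toReal

variable {b : HilbertBasis ι ℝ H₂} {μ : ι → ℝ} {lam : ℝ}

lemma leverage_nonneg (x : X) : 0 ≤ leverage b μ lam x := ENNReal.toReal_nonneg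

lemma KernelCondition.tsum_leverage_le (hK : KernelCondition H₂ (X := X) (Y := Y) κ₀)
    (hμ : ∀ k, 0 ≤ μ k) (hlam : 0 < lam) (x : X) :
    ∑' k, ENNReal.ofReal (‖b k x‖ ^ 2 / (μ k + lam)) ≤ ENNReal.ofReal (κ₀ ^ 2 / lam) := by
  calc ∑' k, ENNReal.ofReal (‖b k x‖ ^ 2 / (μ k + lam))
      ≤ ∑' k, ENNReal.ofReal (‖b k x‖ ^ 2) * ENNReal.ofReal lam⁻¹ := by
        refine ENNReal.tsum_le_tsum fun k => ?_
        rw [← ENNReal.ofReal_mul (sq_nonneg _), div_eq_mul_inv]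
        refine ENNReal.ofReal_le_ofReal ?_
        have := hμ k
        gcongr
        linarith
    _ ≤ ENNReal.ofReal (κ₀ ^ 2) * ENNReal.ofReal lam⁻¹ := by
        rw [ENNReal.tsum_mul_right]
        gcongr
        exact hK.tsum_norm_sq_le b x
    _ = _ := by rw [← ENNReal.ofReal_mul (sq_nonneg _), div_eq_mul_inv]

lemma KernelCondition.ofReal_leverage (hK : KernelCondition H₂ (X := X) (Y := Y) κ₀)
    (hμ : ∀ k, 0 ≤ μ k) (hlam : 0 < lam) (x : X) :
    ENNReal.ofReal (leverage b μ lam x) = ∑' k, ENNReal.ofReal (‖b k x‖ ^ 2 / (μ k + lam)) :=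
  ENNReal.ofReal_toReal (ne_top_of_le_ne_top ENNReal.ofReal_ne_top (hK.tsum_leverage_le hμ hlam x))

lemma KernelCondition.leverage_le (hK : KernelCondition H₂ (X := X) (Y := Y) κ₀)
    (hμ : ∀ k, 0 ≤ μ k) (hlam : 0 < lam) (x : X) : leverage b μ lam x ≤ κ₀ ^ 2 / lam :=
  ENNReal.toReal_le_of_le_ofReal (by positivity) (hK.tsum_leverage_le hμ hlam x)

lemma KernelCondition.sum_le_leverage (hK : KernelCondition H₂ (X := X) (Y := Y) κ₀)
    (hμ : ∀ k, 0 ≤ μ k) (hlam : 0 < lam) (x : X) (A : Finset ι) :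
    ∑ k ∈ A, ‖b k x‖ ^ 2 / (μ k + lam) ≤ leverage b μ lam x := by
  have h0 : ∀ k, 0 ≤ ‖b k x‖ ^ 2 / (μ k + lam) := fun k =>
    div_nonneg (sq_nonneg _) (add_nonneg (hμ k) hlam.le)
  refine (ENNReal.ofReal_le_ofReal_iff (leverage_nonneg x)).mp ?_
  rw [hK.ofReal_leverage hμ hlam, ENNReal.ofReal_sum_of_nonneg fun k _ => h0 k]
  exact ENNReal.sum_le_tsum A

lemma KernelCondition.sum_norm_sq_le (hK : KernelCondition H₂ (X := X) (Y := Y) κ₀)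
    (b : HilbertBasis ι ℝ H₂) (x : X) (A : Finset ι) : ∑ k ∈ A, ‖b k x‖ ^ 2 ≤ κ₀ ^ 2 := by
  refine (ENNReal.ofReal_le_ofReal_iff (sq_nonneg _)).mp ?_
  rw [ENNReal.ofReal_sum_of_nonneg fun k _ => sq_nonneg _]
  exact (ENNReal.sum_le_tsum A).trans (hK.tsum_norm_sq_le b x)

variable [MeasurableSpace Y] [BorelSpace Y] [SecondCountableTopology Y]

lemma KernelCondition.measurable_leverage [Countable ι]
    (hK : KernelCondition H₂ (X := X) (Y := Y) κ₀) :
    Measurable fun x : X => leverage b μ lam x :=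
  (Measurable.tsum fun k =>
    (((hK.measurable_apply (b k)).norm.pow_const 2).div_const _).ennreal_ofReal).ennreal_toReal

/-- By Tonelli, since the integral of ‖b_k(x)‖² is ‖S b_k‖² = μ_k. -/
lemma lintegral_leverage [Countable ι] (hK : KernelCondition H₂ (X := X) (Y := Y) κ₀)
    {m : Measure X} [IsProbabilityMeasure m] {η : ℝ}
    (hb : IsEigenSystem (inclL2 hK m) b μ η) (hlam : 0 < lam) :
    ∫⁻ x, ENNReal.ofReal (leverage b μ lam x) ∂m = effectiveDim (opL hK m) lam := by
  simp only [hK.ofReal_leverage hb.nonneg hlam]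
  rw [lintegral_tsum fun k =>
    (((hK.measurable_apply (b k)).norm.pow_const 2).div_const _).ennreal_ofReal.aemeasurable]
  refine Eq.trans ?_ (hb.effectiveDim_eq hlam).symm
  refine tsum_congr fun k => ?_
  have h0 : 0 ≤ (μ k + lam)⁻¹ := inv_nonneg.mpr (add_nonneg (hb.nonneg k) hlam.le)
  simp only [div_eq_mul_inv, ENNReal.ofReal_mul (sq_nonneg _)]
  rw [lintegral_mul_const _ ((hK.measurable_apply (b k)).norm.pow_const 2).ennreal_ofReal,
    ← ofReal_norm_inclL2_sq hK m, hb.norm_apply_basis_sq, ENNReal.ofReal_mul (hb.nonneg k)]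

end Leverage

end

noncomputable section

/-! ### Concentration of the empirical noise and of the empirical covariance. -/

section Sampling

variable {X Y : Type*} {H₂ : Type*} [MeasurableSpace X]
  [NormedAddCommGroup Y] [InnerProductSpace ℝ Y] [CompleteSpace Y]
  [NormedAddCommGroup H₂] [InnerProductSpace ℝ H₂] [CompleteSpace H₂] [RKHS ℝ H₂ X Y]
  [MeasurableSpace Y] [BorelSpace Y] [SecondCountableTopology Y]
variable {ι : Type*} {κ₀ : ℝ} {b : HilbertBasis ι ℝ H₂} {μ : ι → ℝ} {lam η 𝒩 : ℝ}
  {ρ : Measure (X × Y)} [IsProbabilityMeasure ρ]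

/-- Given x, the Bernstein condition controls the powers of the noise. Of the l factors √leverage,
l−2 are bounded by κ₀/√λ and the other two integrate to the effective dimension. Thus 𝒩 enters the
variance only. -/
lemma lintegral_noise_pow_le [Countable ι] (hK : KernelCondition H₂ (X := X) (Y := Y) κ₀)
    (hκ₀ : 0 ≤ κ₀)
    (hb : IsEigenSystem (inclL2 hK ρ.fst) b μ η) (hlam : 0 < lam)
    (heff : effectiveDim (opL hK ρ.fst) lam ≤ ENNReal.ofReal 𝒩)
    {g : H₂} {M Sig : ℝ} (hM : 0 ≤ M) (hnoise : BernsteinNoise ρ (fun x => g x) M Sig)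
    {l : ℕ} (hl : 2 ≤ l) :
    ∫⁻ p, ENNReal.ofReal ((√(leverage b μ lam p.1) * ‖p.2 - g p.1‖) ^ l) ∂ρ ≤
      ENNReal.ofReal (1 / 2 * l.factorial * (Sig ^ 2 * 𝒩) * (M * (κ₀ / √lam)) ^ (l - 2)) := by
  have hw : Measurable fun x : X => leverage b μ lam x := hK.measurable_leverage
  have hg : Measurable fun x => g x := hK.measurable_apply g
  rw [← Measure.lintegral_condKernel (ρ := ρ) (by
    exact (((hw.comp measurable_fst).sqrt.mul
      (measurable_snd.sub (hg.comp measurable_fst)).norm).pow_const l).ennreal_ofReal)]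
  have h1 : ∀ᵐ x ∂ρ.fst, ∫⁻ y, ENNReal.ofReal ((√(leverage b μ lam x) * ‖y - g x‖) ^ l)
      ∂(ρ.condKernel x) ≤ ENNReal.ofReal (leverage b μ lam x) *
        ENNReal.ofReal (1 / 2 * l.factorial * Sig ^ 2 * (M * (κ₀ / √lam)) ^ (l - 2)) := by
    filter_upwards [hnoise] with x hx
    have h2 : ∀ y, ENNReal.ofReal ((√(leverage b μ lam x) * ‖y - g x‖) ^ l) =
        ENNReal.ofReal (√(leverage b μ lam x) ^ l) * ENNReal.ofReal (‖y - g x‖ ^ l) := fun y => by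
      rw [mul_pow, ENNReal.ofReal_mul (by positivity)]
    simp only [h2]
    rw [lintegral_const_mul _ (by fun_prop)]
    refine (mul_le_mul_right (hx l hl) _).trans ?_
    rw [← ENNReal.ofReal_mul (by positivity), ← ENNReal.ofReal_mul (leverage_nonneg x)]
    refine ENNReal.ofReal_le_ofReal ?_
    obtain ⟨k, rfl⟩ := Nat.exists_eq_add_of_le' hl
    have h3 : √(leverage b μ lam x) ≤ κ₀ / √lam := by
      refine Real.sqrt_le_iff.mpr ⟨by positivity, ?_⟩
      rw [div_pow, Real.sq_sqrt hlam.le]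
      exact hK.leverage_le hb.nonneg hlam x
    have h4 := leverage_nonneg (b := b) (μ := μ) (lam := lam) x
    rw [Nat.add_sub_cancel, pow_add, Real.sq_sqrt h4, mul_pow]
    have h5 : √(leverage b μ lam x) ^ k ≤ (κ₀ / √lam) ^ k := by gcongr
    calc √(leverage b μ lam x) ^ k * leverage b μ lam x *
          (1 / 2 * ((k + 2).factorial : ℝ) * Sig ^ 2 * M ^ k)
        ≤ (κ₀ / √lam) ^ k * leverage b μ lam x *
          (1 / 2 * ((k + 2).factorial : ℝ) * Sig ^ 2 * M ^ k) := by gcongr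
      _ = _ := by ring
  refine (lintegral_mono_ae h1).trans ?_
  rw [lintegral_mul_const _ hw.ennreal_ofReal, lintegral_leverage hK hb hlam]
  refine (mul_le_mul_left heff _).trans ?_
  rw [mul_comm, ← ENNReal.ofReal_mul (by positivity)]
  refine ENNReal.ofReal_le_ofReal (le_of_eq ?_)
  ring

/-- Conditioned on x, the noise has mean zero because g(x) is the conditional mean of y. -/
lemma integral_inner_noise_eq_zero {g h : H₂}
    (htrue : ∀ᵐ x ∂ρ.fst, Integrable (fun y => y) (ρ.condKernel x) ∧
      g x = ∫ y, y ∂(ρ.condKernel x))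
    (hint : Integrable (fun p : X × Y => ⟪h p.1, g p.1 - p.2⟫) ρ) :
    ∫ p : X × Y, ⟪h p.1, g p.1 - p.2⟫ ∂ρ = 0 := by
  rw [← Measure.integral_condKernel hint]
  refine integral_eq_zero_of_ae ?_
  filter_upwards [htrue] with x ⟨hx1, hx2⟩
  have h1 : Integrable (fun y => g x - y) (ρ.condKernel x) := (integrable_const _).sub hx1
  rw [Pi.zero_apply, integral_inner h1, integral_sub (integrable_const _) hx1, ← hx2]
  simp

lemma measure_noise_gt_le [Countable ι] (hK : KernelCondition H₂ (X := X) (Y := Y) κ₀)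
    (hκ₀ : 0 < κ₀) (hb : IsEigenSystem (inclL2 hK ρ.fst) b μ η) (hlam : 0 < lam)
    (h𝒩 : 0 < 𝒩) (heff : effectiveDim (opL hK ρ.fst) lam ≤ ENNReal.ofReal 𝒩)
    {g : H₂} (htrue : ∀ᵐ x ∂ρ.fst, Integrable (fun y => y) (ρ.condKernel x) ∧
      g x = ∫ y, y ∂(ρ.condKernel x))
    {M Sig : ℝ} (hM : 0 < M) (hSig : 0 < Sig) (hnoise : BernsteinNoise ρ (fun x => g x) M Sig)
    {δ : ℝ} (hδ₀ : 0 < δ) (hδ₁ : δ ≤ 1) (n : ℕ) :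
    (Measure.pi fun _ : Fin n => ρ)
      {z | ∃ A : Finset ι, (2 * Real.log (6 / δ) *
          (2 * (M * (κ₀ / √lam)) + √(n * (Sig ^ 2 * 𝒩)))) ^ 2 <
        ∑ k ∈ A, (∑ j, ⟪b k (z j).1, g (z j).1 - (z j).2⟫ / √(μ k + lam)) ^ 2} ≤
      ENNReal.ofReal (δ / 2) := by
  have hw : Measurable fun x : X => leverage b μ lam x := hK.measurable_leverage
  have hg : Measurable fun x => g x := hK.measurable_apply g
  have hpos : ∀ k, 0 < μ k + lam := fun k => by linarith [hb.nonneg k]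
  have hN : Measurable fun p : X × Y => √(leverage b μ lam p.1) * ‖p.2 - g p.1‖ :=
    (hw.comp measurable_fst).sqrt.mul (measurable_snd.sub (hg.comp measurable_fst)).norm
  have hf : ∀ k, Measurable fun p : X × Y => ⟪b k p.1, g p.1 - p.2⟫ := fun k =>
    ((hK.measurable_apply (b k)).comp measurable_fst).inner
      ((hg.comp measurable_fst).sub measurable_snd)
  have hmom := fun l (hl : 2 ≤ l) =>
    lintegral_noise_pow_le (l := l) hK hκ₀.le hb hlam heff hM.le hnoise hl
  have hfN : ∀ (p : X × Y) (A : Finset ι), ∑ k ∈ A, (⟪b k p.1, g p.1 - p.2⟫ / √(μ k + lam)) ^ 2 ≤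
      (√(leverage b μ lam p.1) * ‖p.2 - g p.1‖) ^ 2 := fun p A => by
    rw [mul_pow, Real.sq_sqrt (leverage_nonneg _)]
    calc _ ≤ ∑ k ∈ A, ‖b k p.1‖ ^ 2 / (μ k + lam) * ‖p.2 - g p.1‖ ^ 2 := by
          refine Finset.sum_le_sum fun k _ => ?_
          rw [div_pow, Real.sq_sqrt (hpos k).le, div_mul_eq_mul_div, ← mul_pow, ← sq_abs ⟪_, _⟫,
            norm_sub_rev]
          have := abs_real_inner_le_norm (b k p.1) (g p.1 - p.2)
          have := (hpos k).le
          gcongr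
      _ ≤ _ := by
          rw [← Finset.sum_mul]
          gcongr
          exact hK.sum_le_leverage hb.nonneg hlam p.1 A
  -- The coordinates are dominated by 1 + N², which is integrable by the second moment bound.
  have hN2 : Integrable (fun p : X × Y => 1 + (√(leverage b μ lam p.1) * ‖p.2 - g p.1‖) ^ 2) ρ := by
    refine (integrable_const _).add ⟨(hN.pow_const 2).aestronglyMeasurable, ?_⟩
    rw [hasFiniteIntegral_iff_ofReal (Eventually.of_forall fun p => sq_nonneg _)]
    exact (hmom 2 le_rfl).trans_lt ENNReal.ofReal_lt_top
  have hint : ∀ k, Integrable (fun p : X × Y => ⟪b k p.1, g p.1 - p.2⟫ / √(μ k + lam)) ρ :=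
    fun k => by
      refine hN2.mono' ((hf k).div_const _).aestronglyMeasurable (Eventually.of_forall fun p => ?_)
      have h1 := hfN p {k}
      rw [Finset.sum_singleton, ← sq_abs] at h1
      rw [Real.norm_eq_abs]
      nlinarith [sq_nonneg (|⟪b k p.1, g p.1 - p.2⟫ / √(μ k + lam)| - 1)]
  have hint' : ∀ k, Integrable (fun p : X × Y => ⟪b k p.1, g p.1 - p.2⟫) ρ := fun k => by
    refine ((hint k).mul_const √(μ k + lam)).congr (Eventually.of_forall fun p => ?_)
    exact div_mul_cancel₀ _ (Real.sqrt_pos.mpr (hpos k)).ne'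
  refine measure_sum_sq_gt_le (fun k => (hf k).div_const _) hN (fun p => by positivity)
    (Eventually.of_forall hfN) hint (fun k => ?_) (by positivity) (by positivity) hmom hδ₀ hδ₁ n
  rw [integral_div, integral_inner_noise_eq_zero htrue (hint' k), zero_div]

lemma integrable_leverage [Countable ι] (hK : KernelCondition H₂ (X := X) (Y := Y) κ₀)
    (hb : IsEigenSystem (inclL2 hK ρ.fst) b μ η) (hlam : 0 < lam)
    (heff : effectiveDim (opL hK ρ.fst) lam ≤ ENNReal.ofReal 𝒩) :
    Integrable (fun x : X => leverage b μ lam x) ρ.fst := by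
  refine ⟨hK.measurable_leverage.aestronglyMeasurable, ?_⟩
  rw [hasFiniteIntegral_iff_ofReal (Eventually.of_forall leverage_nonneg),
    lintegral_leverage hK hb hlam]
  exact heff.trans_lt ENNReal.ofReal_lt_top

lemma integral_leverage_le [Countable ι] (hK : KernelCondition H₂ (X := X) (Y := Y) κ₀)
    (hb : IsEigenSystem (inclL2 hK ρ.fst) b μ η) (hlam : 0 < lam) (h𝒩 : 0 < 𝒩)
    (heff : effectiveDim (opL hK ρ.fst) lam ≤ ENNReal.ofReal 𝒩) :
    ∫ x, leverage b μ lam x ∂ρ.fst ≤ 𝒩 := by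
  rw [← ENNReal.ofReal_le_ofReal_iff h𝒩.le, ofReal_integral_eq_lintegral_ofReal
    (integrable_leverage hK hb hlam heff) (Eventually.of_forall leverage_nonneg),
    lintegral_leverage hK hb hlam]
  exact heff

lemma integral_leverage_le_div [Countable ι] (hK : KernelCondition H₂ (X := X) (Y := Y) κ₀)
    (hb : IsEigenSystem (inclL2 hK ρ.fst) b μ η) (hlam : 0 < lam)
    (heff : effectiveDim (opL hK ρ.fst) lam ≤ ENNReal.ofReal 𝒩) :
    ∫ x, leverage b μ lam x ∂ρ.fst ≤ κ₀ ^ 2 / lam := by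
  calc _ ≤ ∫ _, κ₀ ^ 2 / lam ∂ρ.fst :=
        integral_mono (integrable_leverage hK hb hlam heff) (integrable_const _)
          fun x => hK.leverage_le hb.nonneg hlam x
    _ = _ := by simp

/-- Enlarging the index set to a product makes the Cauchy-Schwarz bound factor into leverage times
Tr(K_x†K_x). The sum is part of the squared Hilbert-Schmidt norm of (L+λ)^(-1/2) K_x K_x†. -/
lemma KernelCondition.sum_inner_sq_le (hK : KernelCondition H₂ (X := X) (Y := Y) κ₀)
    (hμ : ∀ k, 0 ≤ μ k) (hlam : 0 < lam) (A : Finset (ι × ι)) (x : X) :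
    ∑ q ∈ A, (⟪b q.1 x, b q.2 x⟫ / √(μ q.1 + lam)) ^ 2 ≤ leverage b μ lam x * κ₀ ^ 2 := by
  classical
  have hpos : ∀ k, 0 < μ k + lam := fun k => by linarith [hμ k]
  calc _ ≤ ∑ q ∈ A.image Prod.fst ×ˢ A.image Prod.snd,
          (⟪b q.1 x, b q.2 x⟫ / √(μ q.1 + lam)) ^ 2 :=
        Finset.sum_le_sum_of_subset_of_nonneg Finset.subset_product fun _ _ _ => sq_nonneg _
    _ ≤ ∑ q ∈ A.image Prod.fst ×ˢ A.image Prod.snd,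
          ‖b q.1 x‖ ^ 2 / (μ q.1 + lam) * ‖b q.2 x‖ ^ 2 := by
        refine Finset.sum_le_sum fun q _ => ?_
        rw [div_pow, Real.sq_sqrt (hpos _).le, div_mul_eq_mul_div, ← mul_pow, ← sq_abs ⟪_, _⟫]
        have := abs_real_inner_le_norm (b q.1 x) (b q.2 x)
        have := (hpos q.1).le
        gcongr
    _ = (∑ k ∈ A.image Prod.fst, ‖b k x‖ ^ 2 / (μ k + lam)) *
          ∑ i ∈ A.image Prod.snd, ‖b i x‖ ^ 2 := by
        rw [Finset.sum_mul_sum, Finset.sum_product]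
    _ ≤ _ := mul_le_mul (hK.sum_le_leverage hμ hlam x _) (hK.sum_norm_sq_le b x _)
        (Finset.sum_nonneg fun _ _ => sq_nonneg _) (leverage_nonneg x)

/-- Jensen's inequality: the entries of L are means of the entries of K_x K_x†. -/
lemma sum_inner_inclL2_sq_le [Countable ι] (hK : KernelCondition H₂ (X := X) (Y := Y) κ₀)
    (hb : IsEigenSystem (inclL2 hK ρ.fst) b μ η) (hlam : 0 < lam)
    (heff : effectiveDim (opL hK ρ.fst) lam ≤ ENNReal.ofReal 𝒩) (A : Finset (ι × ι)) :
    ∑ q ∈ A, (⟪inclL2 hK ρ.fst (b q.1), inclL2 hK ρ.fst (b q.2)⟫ / √(μ q.1 + lam)) ^ 2 ≤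
      (∫ x, leverage b μ lam x ∂ρ.fst) * κ₀ ^ 2 := by
  have hwint := integrable_leverage hK hb hlam heff
  have hG : ∀ q : ι × ι, Integrable (fun x => ⟪b q.1 x, b q.2 x⟫ / √(μ q.1 + lam)) ρ.fst :=
    fun q => (integrable_inner_apply hK _ _ _).div_const _
  have hmean : ∀ q : ι × ι, ∫ x, ⟪b q.1 x, b q.2 x⟫ / √(μ q.1 + lam) ∂ρ.fst =
      ⟪inclL2 hK ρ.fst (b q.1), inclL2 hK ρ.fst (b q.2)⟫ / √(μ q.1 + lam) := fun q => by
    rw [integral_div, inner_inclL2]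
  have hGsq : ∀ q : ι × ι, Integrable
      (fun x => (⟪b q.1 x, b q.2 x⟫ / √(μ q.1 + lam)) ^ 2) ρ.fst := fun q => by
    refine (hwint.mul_const (κ₀ ^ 2)).mono' ((hG q).aestronglyMeasurable.pow 2)
      (Eventually.of_forall fun x => ?_)
    rw [Real.norm_of_nonneg (sq_nonneg _)]
    simpa using hK.sum_inner_sq_le hb.nonneg hlam {q} x
  calc _ ≤ ∑ q ∈ A, ∫ x, (⟪b q.1 x, b q.2 x⟫ / √(μ q.1 + lam)) ^ 2 ∂ρ.fst := by
        refine Finset.sum_le_sum fun q _ => ?_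
        rw [← hmean]
        exact (even_two.convexOn_pow).map_integral_le (continuous_pow 2).continuousOn
          isClosed_univ (Eventually.of_forall fun _ => Set.mem_univ _) (hG q) (hGsq q)
    _ = ∫ x, ∑ q ∈ A, (⟪b q.1 x, b q.2 x⟫ / √(μ q.1 + lam)) ^ 2 ∂ρ.fst :=
        (integral_finsetSum _ fun q _ => hGsq q).symm
    _ ≤ ∫ x, leverage b μ lam x * κ₀ ^ 2 ∂ρ.fst :=
        integral_mono (integrable_finsetSum _ fun q _ => hGsq q) (hwint.mul_const _)
          fun x => hK.sum_inner_sq_le hb.nonneg hlam A x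
    _ = _ := by rw [integral_mul_const]

/-- As for the noise, all but two factors are bounded by 2κ₀²/√λ. The mean w of the leverage appears
because the operators are centred. -/
lemma lintegral_cov_pow_le [Countable ι] (hK : KernelCondition H₂ (X := X) (Y := Y) κ₀)
    (hκ₀ : 0 < κ₀) (hb : IsEigenSystem (inclL2 hK ρ.fst) b μ η) (hlam : 0 < lam) (h𝒩 : 0 < 𝒩)
    (heff : effectiveDim (opL hK ρ.fst) lam ≤ ENNReal.ofReal 𝒩) {w : ℝ}
    (hw' : w = ∫ x, leverage b μ lam x ∂ρ.fst) {l : ℕ} (hl : 2 ≤ l) :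
    ∫⁻ p, ENNReal.ofReal (√(2 * κ₀ ^ 2 * (leverage b μ lam p.1 + w)) ^ l) ∂ρ ≤
      ENNReal.ofReal (1 / 2 * l.factorial * (4 * κ₀ ^ 2 * 𝒩) *
        (2 * κ₀ ^ 2 / √lam) ^ (l - 2)) := by
  have hw : Measurable fun x : X => leverage b μ lam x := hK.measurable_leverage
  have hwint := integrable_leverage hK hb hlam heff
  have hw0 : 0 ≤ w := hw' ▸ integral_nonneg leverage_nonneg
  have hw𝒩 : w ≤ 𝒩 := hw' ▸ integral_leverage_le hK hb hlam h𝒩 heff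
  have hwlam : w ≤ κ₀ ^ 2 / lam := hw' ▸ integral_leverage_le_div hK hb hlam heff
  obtain ⟨k, rfl⟩ := Nat.exists_eq_add_of_le' hl
  rw [Nat.add_sub_cancel]
  have h1 : ∀ p : X × Y, √(2 * κ₀ ^ 2 * (leverage b μ lam p.1 + w)) ^ (k + 2) ≤
      (leverage b μ lam p.1 + w) * (2 * κ₀ ^ 2 * (2 * κ₀ ^ 2 / √lam) ^ k) := fun p => by
    have h2 := leverage_nonneg (b := b) (μ := μ) (lam := lam) p.1
    have h3 : √(2 * κ₀ ^ 2 * (leverage b μ lam p.1 + w)) ≤ 2 * κ₀ ^ 2 / √lam := by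
      refine Real.sqrt_le_iff.mpr ⟨by positivity, ?_⟩
      rw [div_pow, Real.sq_sqrt hlam.le]
      have h4 := hK.leverage_le (b := b) hb.nonneg hlam p.1
      calc _ ≤ 2 * κ₀ ^ 2 * (κ₀ ^ 2 / lam + κ₀ ^ 2 / lam) := by gcongr
        _ = _ := by ring
    rw [pow_add, Real.sq_sqrt (by positivity)]
    calc _ ≤ (2 * κ₀ ^ 2 / √lam) ^ k * (2 * κ₀ ^ 2 * (leverage b μ lam p.1 + w)) := by gcongr
      _ = _ := by ring
  have h2 : ∫⁻ p : X × Y, ENNReal.ofReal (leverage b μ lam p.1 + w) ∂ρ =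
      ENNReal.ofReal (w + w) := by
    have h3 : ∫⁻ x, ENNReal.ofReal (leverage b μ lam x + w) ∂ρ.fst = _ :=
      lintegral_map (hw.add_const w).ennreal_ofReal measurable_fst
    have h4 : Integrable (fun x => leverage b μ lam x + w) ρ.fst := hwint.add (integrable_const w)
    rw [← h3, ← ofReal_integral_eq_lintegral_ofReal h4
      (Eventually.of_forall fun x => add_nonneg (leverage_nonneg x) hw0),
      integral_add hwint (integrable_const w), ← hw']
    simp
  have h3 : Measurable fun p : X × Y => ENNReal.ofReal (leverage b μ lam p.1 + w) :=
    ((hw.comp measurable_fst).add_const w).ennreal_ofReal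
  calc _ ≤ ∫⁻ p : X × Y, ENNReal.ofReal (leverage b μ lam p.1 + w) *
          ENNReal.ofReal (2 * κ₀ ^ 2 * (2 * κ₀ ^ 2 / √lam) ^ k) ∂ρ := by
        refine lintegral_mono fun p => ?_
        rw [← ENNReal.ofReal_mul (add_nonneg (leverage_nonneg _) hw0)]
        exact ENNReal.ofReal_le_ofReal (h1 p)
    _ = ENNReal.ofReal (w + w) * ENNReal.ofReal (2 * κ₀ ^ 2 * (2 * κ₀ ^ 2 / √lam) ^ k) := by
        rw [lintegral_mul_const _ h3, h2]
    _ ≤ _ := by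
        rw [← ENNReal.ofReal_mul (by positivity)]
        refine ENNReal.ofReal_le_ofReal ?_
        have h4 : (2 : ℝ) ≤ (k + 2).factorial := by
          exact_mod_cast (Nat.self_le_factorial (k + 2)).trans' (by omega)
        calc _ ≤ (𝒩 + 𝒩) * (2 * κ₀ ^ 2 * (2 * κ₀ ^ 2 / √lam) ^ k) := by gcongr
          _ = 1 / 2 * 2 * (4 * κ₀ ^ 2 * 𝒩) * (2 * κ₀ ^ 2 / √lam) ^ k := by ring
          _ ≤ _ := by gcongr

lemma measure_cov_gt_le [Countable ι] (hK : KernelCondition H₂ (X := X) (Y := Y) κ₀)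
    (hκ₀ : 0 < κ₀) (hb : IsEigenSystem (inclL2 hK ρ.fst) b μ η) (hlam : 0 < lam)
    (h𝒩 : 0 < 𝒩) (heff : effectiveDim (opL hK ρ.fst) lam ≤ ENNReal.ofReal 𝒩)
    {δ : ℝ} (hδ₀ : 0 < δ) (hδ₁ : δ ≤ 1) (n : ℕ) :
    (Measure.pi fun _ : Fin n => ρ)
      {z | ∃ A : Finset (ι × ι), (2 * Real.log (6 / δ) *
          (2 * (2 * κ₀ ^ 2 / √lam) + √(n * (4 * κ₀ ^ 2 * 𝒩)))) ^ 2 <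
        ∑ q ∈ A, (∑ j, (⟪b q.1 (z j).1, b q.2 (z j).1⟫ -
          ⟪inclL2 hK ρ.fst (b q.1), inclL2 hK ρ.fst (b q.2)⟫) / √(μ q.1 + lam)) ^ 2} ≤
      ENNReal.ofReal (δ / 2) := by
  have hw : Measurable fun x : X => leverage b μ lam x := hK.measurable_leverage
  obtain ⟨w, hw'⟩ : ∃ w, w = ∫ x, leverage b μ lam x ∂ρ.fst := ⟨_, rfl⟩
  have hw0 : 0 ≤ w := hw' ▸ integral_nonneg leverage_nonneg
  have hf : ∀ q : ι × ι, Measurable fun x : X => (⟪b q.1 x, b q.2 x⟫ -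
      ⟪inclL2 hK ρ.fst (b q.1), inclL2 hK ρ.fst (b q.2)⟫) / √(μ q.1 + lam) := fun q =>
    (((hK.measurable_apply (b q.1)).inner (hK.measurable_apply (b q.2))).sub_const _).div_const _
  have hcint : ∀ q : ι × ι, Integrable (fun x : X => (⟪b q.1 x, b q.2 x⟫ -
      ⟪inclL2 hK ρ.fst (b q.1), inclL2 hK ρ.fst (b q.2)⟫) / √(μ q.1 + lam)) ρ.fst := fun q =>
    ((integrable_inner_apply hK _ _ _).sub (integrable_const _)).div_const _
  have hN : Measurable fun p : X × Y => √(2 * κ₀ ^ 2 * (leverage b μ lam p.1 + w)) :=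
    (((hw.comp measurable_fst).add_const w).const_mul _).sqrt
  have hfN : ∀ (p : X × Y) (A : Finset (ι × ι)), ∑ q ∈ A, ((⟪b q.1 p.1, b q.2 p.1⟫ -
      ⟪inclL2 hK ρ.fst (b q.1), inclL2 hK ρ.fst (b q.2)⟫) / √(μ q.1 + lam)) ^ 2 ≤
        √(2 * κ₀ ^ 2 * (leverage b μ lam p.1 + w)) ^ 2 := fun p A => by
    have := leverage_nonneg (b := b) (μ := μ) (lam := lam) p.1
    rw [Real.sq_sqrt (by positivity)]
    calc _ ≤ ∑ q ∈ A, (2 * (⟪b q.1 p.1, b q.2 p.1⟫ / √(μ q.1 + lam)) ^ 2 +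
            2 * (⟪inclL2 hK ρ.fst (b q.1), inclL2 hK ρ.fst (b q.2)⟫ / √(μ q.1 + lam)) ^ 2) := by
          refine Finset.sum_le_sum fun q _ => ?_
          rw [sub_div]
          nlinarith [sq_nonneg (⟪b q.1 p.1, b q.2 p.1⟫ / √(μ q.1 + lam) +
            ⟪inclL2 hK ρ.fst (b q.1), inclL2 hK ρ.fst (b q.2)⟫ / √(μ q.1 + lam))]
      _ ≤ _ := by
          rw [Finset.sum_add_distrib, ← Finset.mul_sum, ← Finset.mul_sum]
          have h1 := hK.sum_inner_sq_le (b := b) hb.nonneg hlam A p.1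
          have h2 := sum_inner_inclL2_sq_le hK hb hlam heff A
          rw [← hw'] at h2
          linarith
  have hmean : ∀ q : ι × ι, ∫ p : X × Y, (⟪b q.1 p.1, b q.2 p.1⟫ -
      ⟪inclL2 hK ρ.fst (b q.1), inclL2 hK ρ.fst (b q.2)⟫) / √(μ q.1 + lam) ∂ρ = 0 := fun q => by
    have h1 : ∫ x, (⟪b q.1 x, b q.2 x⟫ - ⟪inclL2 hK ρ.fst (b q.1), inclL2 hK ρ.fst (b q.2)⟫) /
        √(μ q.1 + lam) ∂ρ.fst = _ :=
      integral_map measurable_fst.aemeasurable (hcint q).aestronglyMeasurable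
    rw [← h1, integral_div, integral_sub (integrable_inner_apply hK _ _ _) (integrable_const _),
      inner_inclL2]
    simp
  exact measure_sum_sq_gt_le (fun q => (hf q).comp measurable_fst) hN
    (fun p => Real.sqrt_nonneg _) (Eventually.of_forall hfN)
    (fun q => (hcint q).comp_measurable measurable_fst) hmean (by positivity)
    (by positivity) (fun l hl => lintegral_cov_pow_le hK hκ₀ hb hlam h𝒩 heff hw' hl) hδ₀ hδ₁ n

end Sampling

end

noncomputable section

/-! ### The high probability event. -/

section Empirical

variable {X Y : Type*} {H₂ : Type*}
  [NormedAddCommGroup Y] [InnerProductSpace ℝ Y] [CompleteSpace Y]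
  [NormedAddCommGroup H₂] [InnerProductSpace ℝ H₂] [CompleteSpace H₂] [RKHS ℝ H₂ X Y]

lemma evalOp_apply (x : X) (h : H₂) : evalOp H₂ (Y := Y) x h = h x := rfl

/-- The empirical mean `(1 / n) ∑ K_{x_j} (g x_j - y_j)`. -/
def empNoise {n : ℕ} (z : Fin n → X × Y) (g : H₂) : H₂ :=
  (n : ℝ)⁻¹ • ∑ j, ((evalOp H₂ (z j).1)†) (g (z j).1 - (z j).2)

/-- The empirical covariance operator `(1 / n) ∑ K_{x_j} K_{x_j}†`. -/
def empCov (H₂ : Type*) {X Y : Type*}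
    [NormedAddCommGroup Y] [InnerProductSpace ℝ Y] [CompleteSpace Y]
    [NormedAddCommGroup H₂] [InnerProductSpace ℝ H₂] [CompleteSpace H₂] [RKHS ℝ H₂ X Y]
    {n : ℕ} (z : Fin n → X × Y) : H₂ →L[ℝ] H₂ :=
  (n : ℝ)⁻¹ • ∑ j, (evalOp H₂ (z j).1)† ∘L evalOp H₂ (z j).1

lemma inner_empNoise {n : ℕ} (z : Fin n → X × Y) (g h : H₂) :
    ⟪h, empNoise z g⟫ = (n : ℝ)⁻¹ * ∑ j, ⟪h (z j).1, g (z j).1 - (z j).2⟫ := by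
  simp only [empNoise, real_inner_smul_right, inner_sum, ContinuousLinearMap.adjoint_inner_right,
    evalOp_apply]

lemma inner_empCov {n : ℕ} (z : Fin n → X × Y) (g h : H₂) :
    ⟪h, empCov H₂ z g⟫ = (n : ℝ)⁻¹ * ∑ j, ⟪h (z j).1, g (z j).1⟫ := by
  simp only [empCov, smul_apply, sum_apply, real_inner_smul_right, inner_sum,
    ContinuousLinearMap.comp_apply, ContinuousLinearMap.adjoint_inner_right, evalOp_apply]

variable [MeasurableSpace X] [MeasurableSpace Y] [BorelSpace Y] [SecondCountableTopology Y]
variable {ι : Type*} {κ₀ : ℝ} {b : HilbertBasis ι ℝ H₂} {μ : ι → ℝ} {lam η 𝒩 : ℝ}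
  {ρ : Measure (X × Y)} [IsProbabilityMeasure ρ]

lemma inner_opL (hK : KernelCondition H₂ (X := X) (Y := Y) κ₀) (m : Measure X)
    [IsFiniteMeasure m] (h g : H₂) :
    ⟪h, opL hK m g⟫ = ⟪inclL2 hK m h, inclL2 hK m g⟫ := by
  rw [opL, ContinuousLinearMap.comp_apply, ContinuousLinearMap.adjoint_inner_right]

/-- With high probability the empirical noise and the empirical covariance operator are small
relative to `L + λ`. -/
lemma exists_event_empirical [SecondCountableTopology H₂]
    (hK : KernelCondition H₂ (X := X) (Y := Y) κ₀)
    (hκ₀ : 0 < κ₀) (hlam : 0 < lam)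
    (h𝒩 : 0 < 𝒩) (heff : effectiveDim (opL hK ρ.fst) lam ≤ ENNReal.ofReal 𝒩)
    {g : H₂} (htrue : ∀ᵐ x ∂ρ.fst, Integrable (fun y => y) (ρ.condKernel x) ∧
      g x = ∫ y, y ∂(ρ.condKernel x))
    {M Sig : ℝ} (hM : 0 < M) (hSig : 0 < Sig) (hnoise : BernsteinNoise ρ (fun x => g x) M Sig)
    {δ : ℝ} (hδ₀ : 0 < δ) (hδ₁ : δ ≤ 1) {n : ℕ} (hn : 0 < n) {s : ℝ}
    (hs₁ : 2 * Real.log (6 / δ) * (2 * (M * (κ₀ / √lam)) + √(n * (Sig ^ 2 * 𝒩))) ≤ n * s)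
    (hs₂ : 2 * Real.log (6 / δ) *
      (2 * (2 * κ₀ ^ 2 / √lam) + √(n * (4 * κ₀ ^ 2 * 𝒩))) ≤ n * s) :
    ∃ E : Set (Fin n → X × Y), MeasurableSet E ∧
      ENNReal.ofReal (1 - δ) ≤ Measure.pi (fun _ : Fin n => ρ) E ∧ ∀ z ∈ E,
        (∀ h : H₂, |⟪h, empNoise z g⟫| ≤
          s * √(‖inclL2 hK ρ.fst h‖ ^ 2 + lam * ‖h‖ ^ 2)) ∧
        ∀ h h' : H₂, |⟪h, (empCov H₂ z - opL hK ρ.fst) h'⟫| ≤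
          s * ‖h'‖ * √(‖inclL2 hK ρ.fst h‖ ^ 2 + lam * ‖h‖ ^ 2) := by
  obtain ⟨ι, b, μ, hb⟩ := exists_isEigenSystem_inclL2 hK ρ.fst hκ₀
  have := b.countable
  have hpos : ∀ k, 0 < μ k + lam := fun k => by linarith [hb.nonneg k]
  have hΛ : 0 ≤ Real.log (6 / δ) := Real.log_nonneg (by rw [le_div_iff₀ hδ₀]; linarith)
  have hn' : (0 : ℝ) < n := by exact_mod_cast hn
  obtain ⟨R₁, hR₁⟩ : ∃ R, R = 2 * Real.log (6 / δ) *
      (2 * (M * (κ₀ / √lam)) + √(n * (Sig ^ 2 * 𝒩))) := ⟨_, rfl⟩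
  obtain ⟨R₂, hR₂⟩ : ∃ R, R = 2 * Real.log (6 / δ) *
      (2 * (2 * κ₀ ^ 2 / √lam) + √(n * (4 * κ₀ ^ 2 * 𝒩))) := ⟨_, rfl⟩
  have h1 := measure_noise_gt_le hK hκ₀ hb hlam h𝒩 heff htrue hM hSig hnoise hδ₀ hδ₁ n
  have h2 := measure_cov_gt_le hK hκ₀ hb hlam h𝒩 heff hδ₀ hδ₁ n
  rw [← hR₁] at h1 hs₁
  rw [← hR₂] at h2 hs₂
  have hR₁0 : 0 ≤ R₁ := by rw [hR₁]; positivity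
  have hR₂0 : 0 ≤ R₂ := by rw [hR₂]; positivity
  have hs0 : 0 ≤ s := nonneg_of_mul_nonneg_right (hR₁0.trans hs₁) hn'
  obtain ⟨F₁, hF₁⟩ : ∃ F : Set (Fin n → X × Y), F = {z | ∃ A : Finset ι, R₁ ^ 2 <
      ∑ k ∈ A, (∑ j, ⟪b k (z j).1, g (z j).1 - (z j).2⟫ / √(μ k + lam)) ^ 2} := ⟨_, rfl⟩
  obtain ⟨F₂, hF₂⟩ : ∃ F : Set (Fin n → X × Y), F = {z | ∃ A : Finset (ι × ι), R₂ ^ 2 <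
      ∑ q ∈ A, (∑ j, (⟪b q.1 (z j).1, b q.2 (z j).1⟫ -
        ⟪inclL2 hK ρ.fst (b q.1), inclL2 hK ρ.fst (b q.2)⟫) / √(μ q.1 + lam)) ^ 2} := ⟨_, rfl⟩
  rw [← hF₁] at h1
  rw [← hF₂] at h2
  have hF : Measure.pi (fun _ : Fin n => ρ) (F₁ ∪ F₂) ≤ ENNReal.ofReal δ := by
    refine (measure_union_le _ _).trans ((add_le_add h1 h2).trans_eq ?_)
    rw [← ENNReal.ofReal_add (by positivity) (by positivity), add_halves]
  -- A measurable hull of the union of the bad sets avoids proving that they are measurable; each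
  -- has measure at most δ/2.
  obtain ⟨G, hFG, hG, hGF⟩ := exists_measurable_superset (Measure.pi fun _ : Fin n => ρ) (F₁ ∪ F₂)
  refine ⟨Gᶜ, hG.compl, ?_, fun z hz => ?_⟩
  · rw [prob_compl_eq_one_sub hG, hGF, ENNReal.ofReal_sub _ hδ₀.le, ENNReal.ofReal_one]
    exact tsub_le_tsub_left hF _
  have hz' : z ∉ F₁ ∪ F₂ := fun h => hz (hFG h)
  have hz₁ : ∀ A : Finset ι, ∑ k ∈ A, (∑ j, ⟪b k (z j).1, g (z j).1 - (z j).2⟫ /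
      √(μ k + lam)) ^ 2 ≤ R₁ ^ 2 := fun A => by
    by_contra h
    exact hz' (Or.inl (by rw [hF₁]; exact ⟨A, not_le.mp h⟩))
  have hz₂ : ∀ A : Finset (ι × ι), ∑ q ∈ A, (∑ j, (⟪b q.1 (z j).1, b q.2 (z j).1⟫ -
      ⟪inclL2 hK ρ.fst (b q.1), inclL2 hK ρ.fst (b q.2)⟫) / √(μ q.1 + lam)) ^ 2 ≤ R₂ ^ 2 :=
    fun A => by
      by_contra h
      exact hz' (Or.inr (by rw [hF₂]; exact ⟨A, not_le.mp h⟩))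
  have hscale : ∀ {R : ℝ}, 0 ≤ R → R ≤ n * s → (n : ℝ)⁻¹ ^ 2 * R ^ 2 ≤ s ^ 2 := fun h0 hR => by
    rw [← mul_pow]
    refine pow_le_pow_left₀ (by positivity) ?_ 2
    rwa [inv_mul_le_iff₀ hn']
  have hQ : ∀ h : H₂, HasSum (fun k => √(μ k + lam) ^ 2 * ⟪b k, h⟫ ^ 2)
      (‖inclL2 hK ρ.fst h‖ ^ 2 + lam * ‖h‖ ^ 2) := fun h => by
    simp only [fun k => Real.sq_sqrt (hpos k).le]
    exact hb.hasSum_add_mul_inner_sq lam h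
  have hp : ∀ k, 0 < √(μ k + lam) := fun k => Real.sqrt_pos.mpr (hpos k)
  refine ⟨fun h => b.abs_inner_le_of_sum_sq_le hp hs0 (fun A => ?_) (hQ h), fun h h' =>
    b.abs_inner_le_of_sum_sq_le hp (by positivity) (fun A => ?_) (hQ h)⟩
  · refine le_trans (le_of_eq ?_) ((mul_le_mul_of_nonneg_left (hz₁ A)
      (sq_nonneg (n : ℝ)⁻¹)).trans (hscale hR₁0 hs₁))
    rw [Finset.mul_sum]
    refine Finset.sum_congr rfl fun k _ => ?_
    rw [inner_empNoise, ← Finset.sum_div, ← mul_pow, mul_div_assoc]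
  · refine b.sum_sq_apply_le (fun A => ?_) h' A
    refine le_trans (le_of_eq ?_) ((mul_le_mul_of_nonneg_left (hz₂ A)
      (sq_nonneg (n : ℝ)⁻¹)).trans (hscale hR₂0 hs₂))
    rw [Finset.mul_sum]
    refine Finset.sum_congr rfl fun q _ => ?_
    rw [sub_apply, inner_sub_right, inner_empCov, inner_opL, ← Finset.sum_div, ← mul_pow,
      ← mul_div_assoc, Finset.sum_sub_distrib, mul_sub]
    simp [hn'.ne']

end Empirical

end

noncomputable section

/-! ### Local behaviour of the nonlinear operator near f†. -/

section Local

variable {H₁ H₂ E : Type*} [NormedAddCommGroup H₁] [InnerProductSpace ℝ H₁]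
  [NormedAddCommGroup H₂] [InnerProductSpace ℝ H₂]
  [NormedAddCommGroup E] [InnerProductSpace ℝ E]
variable {S : H₂ →L[ℝ] E} {dom : Set H₁} {A : H₁ → H₂} {A' : H₁ → H₁ →L[ℝ] H₂}
  {fdag e : H₁} {d Lip α CR CR' : ℝ}

lemma add_mem_ball_inter (hdom : Metric.ball fdag d ⊆ dom) (he : ‖e‖ < d) :
    fdag + e ∈ Metric.ball fdag d ∩ dom := by
  have : fdag + e ∈ Metric.ball fdag d := by simpa [dist_eq_norm] using he
  exact ⟨this, hdom this⟩

lemma FrechetCondition.hasDerivAt_segment (hA : FrechetCondition dom A A' fdag d Lip)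
    (hdom : Metric.ball fdag d ⊆ dom) (he : ‖e‖ < d) {t : ℝ} (ht : t ∈ Set.Icc (0 : ℝ) 1) :
    ‖t • e‖ ≤ ‖e‖ ∧ HasDerivAt (fun t : ℝ => A (fdag + t • e)) (A' (fdag + t • e) e) t := by
  have h1 : ‖t • e‖ ≤ ‖e‖ := by
    rw [norm_smul, Real.norm_of_nonneg ht.1]
    exact mul_le_of_le_one_left (norm_nonneg e) ht.2
  refine ⟨h1, ?_⟩
  have h2 := add_mem_ball_inter hdom (h1.trans_lt he)
  have h3 := (hA.1 _ h2.2).hasFDerivAt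
    (mem_of_superset (Metric.isOpen_ball.mem_nhds h2.1) hdom)
  have h4 : HasDerivAt (fun t : ℝ => fdag + t • e) e t := by
    simpa using ((hasDerivAt_id t).smul_const e).const_add fdag
  exact h3.comp_hasDerivAt t h4

lemma FrechetCondition.norm_sub_le (hA : FrechetCondition dom A A' fdag d Lip)
    (hdom : Metric.ball fdag d ⊆ dom) (he : ‖e‖ < d) :
    ‖A (fdag + e) - A fdag‖ ≤ Lip * ‖e‖ := by
  have h1 := norm_image_sub_le_of_norm_deriv_le_segment_01'
    (f := fun t : ℝ => A (fdag + t • e)) (f' := fun t => A' (fdag + t • e) e) (C := Lip * ‖e‖)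
    (fun t ht => (hA.hasDerivAt_segment hdom he ht).2.hasDerivWithinAt)
    (fun t ht => (ContinuousLinearMap.le_opNorm _ _).trans (by
      gcongr
      exact hA.2 _ (add_mem_ball_inter hdom
        ((hA.hasDerivAt_segment hdom he ⟨ht.1, ht.2.le⟩).1.trans_lt he))))
  simpa using h1

/-- By range invariance, the derivative of t ↦ S A(f† + te) − t Be is (R − I)Be, which is
quadratically small; the mean value inequality finishes. -/
lemma FrechetCondition.norm_comp_sub_le (hA : FrechetCondition dom A A' fdag d Lip)
    (hdom : Metric.ball fdag d ⊆ dom) (hCR : 0 ≤ CR) {R : H₁ → E →L[ℝ] E}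
    (hR : ∀ f ∈ Metric.ball fdag d ∩ dom, S ∘L A' f = R f ∘L (S ∘L A' fdag) ∧ ‖R f‖ ≤ CR' ∧
      ‖R f - ContinuousLinearMap.id ℝ E‖ ≤ CR * ‖f - fdag‖) (he : ‖e‖ < d) :
    ‖S (A (fdag + e) - A fdag) - (S ∘L A' fdag) e‖ ≤ CR * (‖e‖ * ‖(S ∘L A' fdag) e‖) := by
  have h1 := norm_image_sub_le_of_norm_deriv_le_segment_01'
    (f := fun t : ℝ => S (A (fdag + t • e)) - t • (S ∘L A' fdag) e)
    (f' := fun t => S (A' (fdag + t • e) e) - (S ∘L A' fdag) e)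
    (C := CR * (‖e‖ * ‖(S ∘L A' fdag) e‖))
    (fun t ht => by
      have h2 := (hA.hasDerivAt_segment hdom he ht).2
      have h3 := S.hasFDerivAt.comp_hasDerivAt t h2
      have h4 := (hasDerivAt_id t).smul_const ((S ∘L A' fdag) e)
      rw [one_smul] at h4
      exact (h3.sub h4).hasDerivWithinAt)
    (fun t ht => by
      have h2 := (hA.hasDerivAt_segment hdom he ⟨ht.1, ht.2.le⟩).1
      obtain ⟨h3, -, h4⟩ := hR _ (add_mem_ball_inter hdom (h2.trans_lt he))
      have h5 : S (A' (fdag + t • e) e) - (S ∘L A' fdag) e =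
          (R (fdag + t • e) - ContinuousLinearMap.id ℝ E) ((S ∘L A' fdag) e) := by
        rw [sub_apply, ContinuousLinearMap.id_apply]
        congr 1
        exact DFunLike.congr_fun h3 e
      rw [h5, ← mul_assoc]
      refine (ContinuousLinearMap.le_opNorm _ _).trans ?_
      gcongr
      refine h4.trans ?_
      rw [add_sub_cancel_left]
      gcongr)
  have h2 : S (A (fdag + (1 : ℝ) • e)) - (1 : ℝ) • (S ∘L A' fdag) e -
      (S (A (fdag + (0 : ℝ) • e)) - (0 : ℝ) • (S ∘L A' fdag) e) =
        S (A (fdag + e) - A fdag) - (S ∘L A' fdag) e := by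
    rw [one_smul, one_smul, zero_smul, zero_smul, add_zero, sub_zero, map_sub]
    abel
  rwa [h2] at h1

end Local

/-! ### The energy estimate under the tangential cone condition. -/

section Energy

variable {H₁ H₂ E : Type*} [NormedAddCommGroup H₁] [InnerProductSpace ℝ H₁] [CompleteSpace H₁]
  [NormedAddCommGroup H₂] [InnerProductSpace ℝ H₂] [CompleteSpace H₂]
  [NormedAddCommGroup E] [InnerProductSpace ℝ E] [CompleteSpace E]
variable {S : H₂ →L[ℝ] E} {D : H₁ →L[ℝ] H₂} {e : H₁} {h ζ : H₂} {η κ₀ Lip α lam σ : ℝ}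

lemma sqrt_add_mul_sq_le {a b : ℝ} (ha : 0 ≤ a) (hb : 0 ≤ b) (hlam : 0 ≤ lam) :
    √(a ^ 2 + lam * b ^ 2) ≤ a + √lam * b := by
  refine Real.sqrt_le_iff.mpr ⟨by positivity, ?_⟩
  have h1 : (√lam * b) ^ 2 = lam * b ^ 2 := by rw [mul_pow, Real.sq_sqrt hlam]
  have h2 : 0 ≤ a * (√lam * b) := by positivity
  nlinarith

/-- The energy estimate for one step of Landweber iteration with derivative `D` at the current
point, under the tangential cone condition. -/
lemma norm_sq_landweber_step_le (hη₀ : 0 < η) (hκ₀ : 0 ≤ κ₀) (hLip : 0 ≤ Lip)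
    (hη : η * (κ₀ * Lip) ^ 2 ≤ 1) (hα₁ : α < 1 / 2)
    (hS : ‖S‖ ≤ κ₀) (hD : ‖D‖ ≤ Lip) (hlam₀ : 0 ≤ lam) (hlam₁ : lam ≤ 1) (hσ : 0 ≤ σ)
    (hζ : ∀ k, |⟪k, ζ⟫| ≤ σ * √(‖S k‖ ^ 2 + lam * ‖k‖ ^ 2))
    (htcc : ‖S h - S (D e)‖ ≤ α * ‖S h‖) {ε : ℝ} (hε₀ : 0 < ε) (hε : 4 * ε = 1 - 2 * α) :
    ‖e - η • (D†) ((S†) (S h) + ζ)‖ ^ 2 ≤ (1 + η * lam) * ‖e‖ ^ 2 - 2 * ε * η * ‖S h‖ ^ 2 +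
      η * (4 / ε + 2 * Lip ^ 2 + η * (1 + 1 / ε) * (Lip * (κ₀ + 1)) ^ 2) * σ ^ 2 := by
  obtain ⟨F, hF⟩ : ∃ F, F = ‖S h‖ := ⟨_, rfl⟩
  have hF0 : 0 ≤ F := hF ▸ norm_nonneg _
  obtain ⟨u, hu⟩ : ∃ u, u = (D†) ((S†) (S h)) := ⟨_, rfl⟩
  obtain ⟨v, hv⟩ : ∃ v, v = (D†) ζ := ⟨_, rfl⟩
  have hSk : ∀ k, ‖S k‖ ≤ κ₀ * ‖k‖ := fun k => S.le_of_opNorm_le hS k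
  have hDk : ∀ k, ‖D k‖ ≤ Lip * ‖k‖ := fun k => D.le_of_opNorm_le hD k
  -- The cone condition gives the factor 1 + α, which is below 2.
  have hSDe : ‖S (D e)‖ ≤ 2 * F := by
    have h1 := norm_sub_norm_le (S (D e)) (S h)
    rw [norm_sub_rev] at h1
    rw [← hF] at h1 htcc
    nlinarith
  -- The cone condition makes the gradient a descent direction for the error, up to the factor 1 −
  -- α.
  have heu : (1 - α) * F ^ 2 ≤ ⟪e, u⟫ := by
    rw [hu, ContinuousLinearMap.adjoint_inner_right, ContinuousLinearMap.adjoint_inner_right]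
    have h1 := real_inner_le_norm (S h - S (D e)) (S h)
    rw [inner_sub_left, real_inner_self_eq_norm_sq, ← hF] at h1
    have h2 := mul_le_mul_of_nonneg_right htcc hF0
    rw [← hF] at h2
    nlinarith
  have hev : |⟪e, v⟫| ≤ σ * (2 * F + √lam * (Lip * ‖e‖)) := by
    rw [hv, ContinuousLinearMap.adjoint_inner_right]
    refine (hζ _).trans ?_
    gcongr
    refine (sqrt_add_mul_sq_le (norm_nonneg _) (norm_nonneg _) hlam₀).trans ?_
    gcongr
    exact hDk e
  have hnu : ‖u‖ ≤ κ₀ * Lip * F := by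
    refine norm_le_of_abs_inner_le (by positivity) fun x => ?_
    rw [hu, ContinuousLinearMap.adjoint_inner_right, ContinuousLinearMap.adjoint_inner_right]
    calc _ ≤ ‖S (D x)‖ * ‖S h‖ := abs_real_inner_le_norm _ _
      _ ≤ κ₀ * (Lip * ‖x‖) * F := by
        rw [hF]
        gcongr
        exact (hSk _).trans (by gcongr; exact hDk x)
      _ = _ := by ring
  have hnv : ‖v‖ ≤ σ * (Lip * (κ₀ + 1)) := by
    refine norm_le_of_abs_inner_le (by positivity) fun x => ?_
    rw [hv, ContinuousLinearMap.adjoint_inner_right]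
    refine (hζ _).trans ?_
    rw [mul_assoc]
    gcongr
    refine (sqrt_add_mul_sq_le (norm_nonneg _) (norm_nonneg _) hlam₀).trans ?_
    calc _ ≤ κ₀ * (Lip * ‖x‖) + 1 * (Lip * ‖x‖) := by
          have h1 : √lam ≤ 1 := Real.sqrt_le_one.mpr hlam₁
          gcongr
          · exact (hSk _).trans (by gcongr; exact hDk x)
          · exact hDk x
      _ = _ := by ring
  have h1 : e - η • (D†) ((S†) (S h) + ζ) = e - η • (u + v) := by rw [map_add, ← hu, ← hv]
  have h2 : ‖u + v‖ ^ 2 ≤ (1 + ε) * ‖u‖ ^ 2 + (1 + 1 / ε) * ‖v‖ ^ 2 := by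
    rw [norm_add_sq_real]
    have h3 := real_inner_le_norm u v
    have h4 : 0 ≤ (ε * ‖u‖ - ‖v‖) ^ 2 / ε := by positivity
    have h5 : (ε * ‖u‖ - ‖v‖) ^ 2 / ε = ε * ‖u‖ ^ 2 - 2 * (‖u‖ * ‖v‖) + 1 / ε * ‖v‖ ^ 2 := by
      field_simp
      ring
    linarith
  have h3 : η * ‖u‖ ^ 2 ≤ F ^ 2 := by
    calc η * ‖u‖ ^ 2 ≤ η * (κ₀ * Lip * F) ^ 2 := by gcongr
      _ = η * (κ₀ * Lip) ^ 2 * F ^ 2 := by ring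
      _ ≤ 1 * F ^ 2 := by gcongr
      _ = F ^ 2 := one_mul _
  have h4 : ‖v‖ ^ 2 ≤ σ ^ 2 * (Lip * (κ₀ + 1)) ^ 2 := by
    rw [← mul_pow]
    gcongr
  have h5 : -(2 * ⟪e, v⟫) ≤ ε * F ^ 2 + 4 / ε * σ ^ 2 + lam * ‖e‖ ^ 2 + 2 * Lip ^ 2 * σ ^ 2 := by
    have h6 := neg_le_of_abs_le hev
    have h7 : 0 ≤ (ε * F - 2 * σ) ^ 2 / ε := by positivity
    have h8 : (ε * F - 2 * σ) ^ 2 / ε = ε * F ^ 2 - 4 * (σ * F) + 4 / ε * σ ^ 2 := by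
      field_simp
      ring
    have h9 := sq_nonneg (√lam * ‖e‖ - σ * Lip)
    have h10 : (√lam * ‖e‖ - σ * Lip) ^ 2 =
        lam * ‖e‖ ^ 2 - 2 * (σ * (√lam * (Lip * ‖e‖))) + Lip ^ 2 * σ ^ 2 := by
      rw [sub_sq, mul_pow, Real.sq_sqrt hlam₀]
      ring
    have h11 : 0 ≤ Lip ^ 2 * σ ^ 2 := by positivity
    linarith
  -- Balance of the residual terms: the gain 2(1−α)F² minus (1+ε)F² from the quadratic term and εF²
  -- from the noise leaves (1−2α−2ε)F² = 2εF².
  rw [h1, norm_sub_sq_real, norm_smul, Real.norm_of_nonneg hη₀.le, mul_pow,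
    real_inner_smul_right, inner_add_right, ← hF]
  have h6 : η ^ 2 * ‖u + v‖ ^ 2 ≤
      η * ((1 + ε) * F ^ 2 + η * (1 + 1 / ε) * (σ ^ 2 * (Lip * (κ₀ + 1)) ^ 2)) := by
    calc η ^ 2 * ‖u + v‖ ^ 2 ≤ η ^ 2 * ((1 + ε) * ‖u‖ ^ 2 + (1 + 1 / ε) * ‖v‖ ^ 2) := by gcongr
      _ = η * ((1 + ε) * (η * ‖u‖ ^ 2) + η * (1 + 1 / ε) * ‖v‖ ^ 2) := by ring
      _ ≤ _ := by gcongr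
  have h7 := mul_le_mul_of_nonneg_left h5 hη₀.le
  have h8 := mul_le_mul_of_nonneg_left heu hη₀.le
  have h9 : η * F ^ 2 * (4 * ε) = η * F ^ 2 * (1 - 2 * α) := by rw [hε]
  nlinarith

end Energy

end

noncomputable section

/-! ### Nonlinear Landweber iteration as a perturbed linear one. -/

section Reduction

variable {H₁ H₂ E : Type*} [NormedAddCommGroup H₁] [InnerProductSpace ℝ H₁] [CompleteSpace H₁]
  [NormedAddCommGroup H₂] [InnerProductSpace ℝ H₂] [CompleteSpace H₂]
  [NormedAddCommGroup E] [InnerProductSpace ℝ E] [CompleteSpace E]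

/-- Nonlinear Landweber iteration, with data noise `ξ` and a perturbation `Δ` of `S† S`, is a
perturbed linear Landweber iteration. -/
lemma exists_isPerturbedLandweber {S : H₂ →L[ℝ] E} {dom : Set H₁} {A : H₁ → H₂}
    {A' : H₁ → H₁ →L[ℝ] H₂} {fdag : H₁} {d Lip α CR CR' η κ₀ lam s X ε : ℝ} {J : ℕ} {ξ : H₂}
    {Δ : H₂ →L[ℝ] H₂} {e : ℕ → H₁}
    (hη₀ : 0 < η) (hκ₀ : 0 ≤ κ₀) (hLip : 0 ≤ Lip) (hη : η * (κ₀ * Lip) ^ 2 ≤ 1)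
    (hα₁ : α < 1 / 2) (hε₀ : 0 < ε) (hε : 4 * ε = 1 - 2 * α) (hCR : 0 ≤ CR) (hCR' : 0 ≤ CR')
    (hS : ‖S‖ ≤ κ₀) (hdom : Metric.ball fdag d ⊆ dom)
    (hA : FrechetCondition dom A A' fdag d Lip)
    (hNL : NonlinearityCondition S dom A A' fdag d α CR CR')
    (hX₀ : 0 ≤ X) (hX : X < d) (hlam₀ : 0 ≤ lam) (hlam₁ : lam ≤ 1) (hs : 0 ≤ s)
    (hξ : ∀ k, |⟪k, ξ⟫| ≤ s * √(‖S k‖ ^ 2 + lam * ‖k‖ ^ 2))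
    (hΔ : ∀ k h, |⟪k, Δ h⟫| ≤ s * ‖h‖ * √(‖S k‖ ^ 2 + lam * ‖k‖ ^ 2))
    (hJ : η * lam * J ≤ 1)
    (he : ∀ j, e (j + 1) = e j - η • ((A' (fdag + e j))†)
      ((S†) (S (A (fdag + e j) - A fdag)) + (ξ + Δ (A (fdag + e j) - A fdag)))) :
    ∃ (z : ℕ → E) (ν : ℕ → H₁) (ν₀ : H₁),
      IsPerturbedLandweber (S ∘L A' fdag) η lam s X (ε / 2 * η) (CR * (CR' + 1))
        (η * (4 / ε + 2 * Lip ^ 2 + η * (1 + 1 / ε) * (Lip * (κ₀ + 1)) ^ 2) * (1 + Lip * X) ^ 2)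
        (1 + CR + Lip * CR' + 2 * Lip + Lip ^ 2 * X) J e z ν ν₀ := by
  obtain ⟨htcc, R, hR⟩ := hNL
  have hball : ∀ {x : H₁}, ‖x‖ ≤ X → fdag + x ∈ Metric.ball fdag d ∩ dom := fun hx =>
    add_mem_ball_inter hdom (hx.trans_lt hX)
  have h0 : fdag ∈ Metric.ball fdag d ∩ dom := by
    have := hball (x := 0) (by rwa [norm_zero])
    rwa [add_zero] at this
  have hRe : ∀ {x : H₁}, ‖x‖ ≤ X → ‖R (fdag + x) - ContinuousLinearMap.id ℝ E‖ ≤ CR * ‖x‖ :=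
    fun hx => by simpa using (hR _ (hball hx)).2.2
  have hSA : ∀ {x : H₁}, ‖x‖ ≤ X → ∀ y, S (A' (fdag + x) y) = R (fdag + x) ((S ∘L A' fdag) y) :=
    fun hx y => DFunLike.congr_fun (hR _ (hball hx)).1 y
  have hh : ∀ {x : H₁}, ‖x‖ ≤ X → ‖A (fdag + x) - A fdag‖ ≤ Lip * ‖x‖ := fun hx =>
    hA.norm_sub_le hdom (hx.trans_lt hX)
  have hsqrt : ∀ {σ a b : ℝ} (k : H₂), 0 ≤ σ → ‖S k‖ ≤ a → ‖k‖ ≤ b →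
      σ * √(‖S k‖ ^ 2 + lam * ‖k‖ ^ 2) ≤ σ * (a + √lam * b) := fun k hσ ha hb => by
    refine mul_le_mul_of_nonneg_left
      ((sqrt_add_mul_sq_le (norm_nonneg (S k)) (norm_nonneg k) hlam₀).trans ?_) hσ
    gcongr
  obtain ⟨cn, hcn⟩ : ∃ c, c = 1 + CR + Lip * CR' + 2 * Lip + Lip ^ 2 * X := ⟨_, rfl⟩
  have hLX : 0 ≤ Lip ^ 2 * X := by positivity
  have hLC : 0 ≤ Lip * CR' := by positivity
  rw [← hcn]
  -- Since A'(f)†S† = B†R_f†, the whole nonlinear data term lies in the range of B†. The choice of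
  -- ν₀ freezes the derivative at f† and drops Δ.
  refine ⟨fun j => ((R (fdag + e j))†) (S (A (fdag + e j) - A fdag)) - (S ∘L A' fdag) (e j),
    fun j => ((A' (fdag + e j))†) (ξ + Δ (A (fdag + e j) - A fdag)), ((A' fdag)†) ξ,
    ?_, ?_, ?_, ?_, ?_, hJ⟩
  · intro j _ hej
    have h1 : ((A' (fdag + e j))†) ((S†) (S (A (fdag + e j) - A fdag))) =
        ((S ∘L A' fdag)†) (((R (fdag + e j))†) (S (A (fdag + e j) - A fdag))) := by
      refine ext_inner_left ℝ fun y => ?_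
      simp only [ContinuousLinearMap.adjoint_inner_right]
      rw [hSA hej]
    have h2 : ((S ∘L A' fdag)†) (((R (fdag + e j))†) (S (A (fdag + e j) - A fdag)) -
        (S ∘L A' fdag) (e j)) = ((S ∘L A' fdag)†) (((R (fdag + e j))†)
          (S (A (fdag + e j) - A fdag))) - ((S ∘L A' fdag)† ∘L (S ∘L A' fdag)) (e j) :=
      map_sub _ _ _
    rw [he, map_add, h1, h2, sub_apply, one_apply_eq_self, smul_apply]
    module
  · intro j _ hej
    obtain ⟨w, hw⟩ : ∃ w, w = (S ∘L A' fdag) (e j) := ⟨_, rfl⟩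
    have h1 := hA.norm_comp_sub_le hdom hCR hR (hej.trans_lt hX)
    rw [← hw] at h1 ⊢
    have h2 : ((R (fdag + e j))†) (S (A (fdag + e j) - A fdag)) - w =
        ((R (fdag + e j))†) (S (A (fdag + e j) - A fdag) - w) +
          ((R (fdag + e j) - ContinuousLinearMap.id ℝ E)†) w := by
      have h3 : ((ContinuousLinearMap.id ℝ E)†) w = w := by
        refine ext_inner_left ℝ fun y => ?_
        rw [ContinuousLinearMap.adjoint_inner_right, ContinuousLinearMap.id_apply]
      rw [map_sub ((R (fdag + e j))†), map_sub ContinuousLinearMap.adjoint, sub_apply, h3]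
      abel
    rw [h2]
    refine (norm_add_le _ _).trans ?_
    have h3 := ((R (fdag + e j))†).le_opNorm (S (A (fdag + e j) - A fdag) - w)
    have h4 := ((R (fdag + e j) - ContinuousLinearMap.id ℝ E)†).le_opNorm w
    rw [LinearIsometryEquiv.norm_map] at h3 h4
    have h5 : ‖R (fdag + e j)‖ * ‖S (A (fdag + e j) - A fdag) - w‖ ≤
        CR' * (CR * (‖e j‖ * ‖w‖)) := by
      gcongr
      exact (hR _ (hball hej)).2.1
    have h6 := mul_le_mul_of_nonneg_right (hRe hej) (norm_nonneg w)
    calc _ ≤ CR' * (CR * (‖e j‖ * ‖w‖)) + CR * ‖e j‖ * ‖w‖ := by linarith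
      _ = _ := by ring
  · intro j _ hej
    have hhX : ‖A (fdag + e j) - A fdag‖ ≤ Lip * X := (hh hej).trans (by gcongr)
    have hζ : ∀ k, |⟪k, ξ + Δ (A (fdag + e j) - A fdag)⟫| ≤
        s * (1 + Lip * X) * √(‖S k‖ ^ 2 + lam * ‖k‖ ^ 2) := fun k => by
      rw [inner_add_right]
      refine (abs_add_le _ _).trans ((add_le_add (hξ k) (hΔ k _)).trans ?_)
      have : s * ‖A (fdag + e j) - A fdag‖ * √(‖S k‖ ^ 2 + lam * ‖k‖ ^ 2) ≤
          s * (Lip * X) * √(‖S k‖ ^ 2 + lam * ‖k‖ ^ 2) := by gcongr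
      linarith
    -- The energy estimate needs the cone condition linearised at the current iterate.
    have ht := htcc fdag h0 (fdag + e j) (hball hej)
    have h1 : S (A fdag - A (fdag + e j) - A' (fdag + e j) (fdag - (fdag + e j))) =
        -(S (A (fdag + e j) - A fdag) - S (A' (fdag + e j) (e j))) := by
      rw [← map_sub, ← map_neg]
      congr 1
      rw [sub_add_cancel_left, map_neg]
      abel
    have h2 : S (A fdag - A (fdag + e j)) = -S (A (fdag + e j) - A fdag) := by
      rw [← map_neg, neg_sub]
    rw [h1, h2, norm_neg, norm_neg] at ht
    have h3 := norm_sq_landweber_step_le hη₀ hκ₀ hLip hη hα₁ hS (hA.2 _ (hball hej)) hlam₀ hlam₁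
      (by positivity) hζ ht hε₀ hε
    rw [← he] at h3
    -- Linearised at f†, the cone condition passes from the nonlinear residual to ‖B e_j‖ with a
    -- factor 2, which turns 2ε into ε/2.
    have ht' := htcc (fdag + e j) (hball hej) fdag h0
    rw [add_sub_cancel_left, map_sub S] at ht'
    have h4 : ‖(S ∘L A' fdag) (e j)‖ ≤ 2 * ‖S (A (fdag + e j) - A fdag)‖ := by
      have h5 := norm_sub_norm_le (S (A' fdag (e j))) (S (A (fdag + e j) - A fdag))
      rw [norm_sub_rev] at h5
      rw [ContinuousLinearMap.comp_apply]
      nlinarith [norm_nonneg (S (A (fdag + e j) - A fdag))]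
    have h5 : ε / 2 * η * ‖(S ∘L A' fdag) (e j)‖ ^ 2 ≤
        ε / 2 * η * (2 * ‖S (A (fdag + e j) - A fdag)‖) ^ 2 := by gcongr
    rw [mul_pow s] at h3
    linarith
  · intro j _ hej x
    -- Both parts of the deviation are of order ‖e_j‖ in the ‖B x‖ term: the first through R − I,
    -- the second through the size of A(f) − A(f†).
    have h1 : ⟪x, ((A' (fdag + e j))†) (ξ + Δ (A (fdag + e j) - A fdag)) - ((A' fdag)†) ξ⟫ =
        ⟪A' (fdag + e j) x - A' fdag x, ξ⟫ + ⟪A' (fdag + e j) x, Δ (A (fdag + e j) - A fdag)⟫ := by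
      rw [inner_sub_right, ContinuousLinearMap.adjoint_inner_right,
        ContinuousLinearMap.adjoint_inner_right, inner_add_right, inner_sub_left]
      ring
    obtain ⟨w, hw⟩ : ∃ w, w = (S ∘L A' fdag) x := ⟨_, rfl⟩
    have hAx : ‖A' (fdag + e j) x‖ ≤ Lip * ‖x‖ :=
      ContinuousLinearMap.le_of_opNorm_le _ (hA.2 _ (hball hej)) x
    have hAx0 : ‖A' fdag x‖ ≤ Lip * ‖x‖ := ContinuousLinearMap.le_of_opNorm_le _ (hA.2 _ h0) x
    have h2 : ‖S (A' (fdag + e j) x - A' fdag x)‖ ≤ CR * ‖e j‖ * ‖w‖ := by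
      have h3 : S (A' (fdag + e j) x - A' fdag x) =
          (R (fdag + e j) - ContinuousLinearMap.id ℝ E) w := by
        rw [map_sub, hSA hej, ← hw, sub_apply, ContinuousLinearMap.id_apply, hw]
        rfl
      rw [h3]
      exact ContinuousLinearMap.le_of_opNorm_le _ (hRe hej) w
    have h3 : ‖A' (fdag + e j) x - A' fdag x‖ ≤ 2 * Lip * ‖x‖ :=
      (norm_sub_le _ _).trans (by linarith)
    have h4 : ‖S (A' (fdag + e j) x)‖ ≤ CR' * ‖w‖ := by
      rw [hSA hej, ← hw]
      exact ContinuousLinearMap.le_of_opNorm_le _ (hR _ (hball hej)).2.1 w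
    have h5 := (hξ (A' (fdag + e j) x - A' fdag x)).trans (hsqrt _ hs h2 h3)
    have h6 := (hΔ (A' (fdag + e j) x) (A (fdag + e j) - A fdag)).trans
      (hsqrt _ (by positivity) h4 hAx)
    rw [h1, ← hw]
    refine (abs_add_le _ _).trans ((add_le_add h5 h6).trans ?_)
    have h7 : s * ‖A (fdag + e j) - A fdag‖ * (CR' * ‖w‖ + √lam * (Lip * ‖x‖)) ≤
        s * (Lip * ‖e j‖) * (CR' * ‖w‖ + √lam * (Lip * ‖x‖)) := by
      gcongr
      exact hh hej
    have h8 : s * (Lip * ‖e j‖) * (√lam * (Lip * ‖x‖)) ≤ s * (Lip * X) * (√lam * (Lip * ‖x‖)) := by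
      gcongr
    have h9 : 0 ≤ s * (‖e j‖ * ‖w‖) := by positivity
    have h10 : 0 ≤ s * (√lam * ‖x‖) := by positivity
    have h11 : s * (cn * (‖e j‖ * ‖w‖ + √lam * ‖x‖)) =
        cn * (s * (‖e j‖ * ‖w‖)) + cn * (s * (√lam * ‖x‖)) := by ring
    have h12 : (CR + Lip * CR') * (s * (‖e j‖ * ‖w‖)) ≤ cn * (s * (‖e j‖ * ‖w‖)) :=
      mul_le_mul_of_nonneg_right (by rw [hcn]; linarith) h9
    have h13 : (2 * Lip + Lip ^ 2 * X) * (s * (√lam * ‖x‖)) ≤ cn * (s * (√lam * ‖x‖)) :=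
      mul_le_mul_of_nonneg_right (by rw [hcn]; linarith) h10
    rw [h11]
    linarith
  · intro x
    rw [ContinuousLinearMap.adjoint_inner_right]
    refine (hξ _).trans ((hsqrt _ hs le_rfl
      (ContinuousLinearMap.le_of_opNorm_le _ (hA.2 _ h0) x)).trans ?_)
    gcongr
    rw [mul_add]
    have h1 : 1 * ‖S (A' fdag x)‖ ≤ cn * ‖S (A' fdag x)‖ :=
      mul_le_mul_of_nonneg_right (by rw [hcn]; linarith) (norm_nonneg _)
    have h2 : Lip * (√lam * ‖x‖) ≤ cn * (√lam * ‖x‖) :=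
      mul_le_mul_of_nonneg_right (by rw [hcn]; linarith) (by positivity)
    rw [ContinuousLinearMap.comp_apply]
    linarith

end Reduction

end

noncomputable section

/-! ### Gradient descent in terms of the empirical operators. -/

section GradientDescent

variable {X Y H₁ H₂ : Type*}
  [NormedAddCommGroup Y] [InnerProductSpace ℝ Y] [CompleteSpace Y]
  [NormedAddCommGroup H₁] [InnerProductSpace ℝ H₁] [CompleteSpace H₁]
  [NormedAddCommGroup H₂] [InnerProductSpace ℝ H₂] [CompleteSpace H₂] [RKHS ℝ H₂ X Y]

/-- The residual A(f)(x_j) − y_j splits into (A(f) − A(f†))(x_j), which gives the empirical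
covariance, and A(f†)(x_j) − y_j, which gives the noise. -/
lemma gdStep_eq {n : ℕ} (z : Fin n → X × Y) (A : H₁ → H₂) (A' : H₁ → H₁ →L[ℝ] H₂) (η : ℝ)
    (fdag f : H₁) : gdStep z A A' η f =
      f - η • ((A' f)†) (empCov H₂ z (A f - A fdag) + empNoise z (A fdag)) := by
  rw [gdStep]
  congr 2
  refine ext_inner_left ℝ fun y => ?_
  rw [ContinuousLinearMap.adjoint_inner_right, inner_add_right, inner_empCov, inner_empNoise,
    ← mul_add, ← Finset.sum_add_distrib, real_inner_smul_right, inner_sum]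
  congr 1
  refine Finset.sum_congr rfl fun j _ => ?_
  rw [ContinuousLinearMap.adjoint_inner_right, ← inner_add_right, RKHS.coe_sub, Pi.sub_apply,
    sub_add_sub_cancel]
  rfl

end GradientDescent

/-- The Bernstein inequality asks for positive parameters, whereas M and Σ may vanish; they are
enlarged by 1. -/
lemma BernsteinNoise.mono {X Y : Type*} [MeasurableSpace X]
    [NormedAddCommGroup Y] [InnerProductSpace ℝ Y] [CompleteSpace Y]
    [SecondCountableTopology Y] [MeasurableSpace Y] [BorelSpace Y] {ρ : Measure (X × Y)}
    [IsProbabilityMeasure ρ] {g : X → Y} {M M' Sig Sig' : ℝ} (h : BernsteinNoise ρ g M Sig)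
    (hM₀ : 0 ≤ M) (hSig₀ : 0 ≤ Sig) (hM : M ≤ M') (hSig : Sig ≤ Sig') :
    BernsteinNoise ρ g M' Sig' := by
  filter_upwards [h] with x hx l hl
  refine (hx l hl).trans (ENNReal.ofReal_le_ofReal ?_)
  gcongr

/-! ### Balancing the powers of the sample size. -/

section Scalars

/-- With λ = 1/x, the variance term √(n λ^(-ν)) and n λ^(r+1/2) are the same power x^(r+ν+1/2); this
is what fixes the exponent 2r+ν+1. The other term, of order √x, is of lower order. -/
lemma two_mul_log_mul_le {p q a nu r x Λ : ℝ} {n : ℕ} (hr : 0 < r) (hnu : 0 < nu) (hx : 1 ≤ x)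
    (hn : (n : ℝ) = x ^ (2 * r + nu + 1)) (hp : 0 ≤ p) (hq : 0 ≤ q) (ha : 0 ≤ a) (hΛ : 0 ≤ Λ) :
    2 * Λ * (2 * (p / √x⁻¹) + √(n * (q ^ 2 * (a ^ 2 * x⁻¹ ^ (-nu))))) ≤
      n * (2 * (2 * p + q * a) * Λ * x⁻¹ ^ (r + 1 / 2)) := by
  have hx0 : 0 < x := by linarith
  have h1 : (n : ℝ) * x⁻¹ ^ (r + 1 / 2) = x ^ (r + nu + 1 / 2) := by
    rw [hn, Real.inv_rpow hx0.le, ← Real.rpow_neg hx0.le, ← Real.rpow_add hx0]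
    congr 1
    ring
  have h2 : √(n * (q ^ 2 * (a ^ 2 * x⁻¹ ^ (-nu)))) = q * a * x ^ (r + nu + 1 / 2) := by
    have h3 : (n : ℝ) * x⁻¹ ^ (-nu) = x ^ (r + nu + 1 / 2) * x ^ (r + nu + 1 / 2) := by
      rw [hn, Real.inv_rpow hx0.le, ← Real.rpow_neg hx0.le, ← Real.rpow_add hx0,
        ← Real.rpow_add hx0]
      congr 1
      ring
    have h4 : n * (q ^ 2 * (a ^ 2 * x⁻¹ ^ (-nu))) = (q * a * x ^ (r + nu + 1 / 2)) ^ 2 := by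
      calc _ = q ^ 2 * a ^ 2 * (n * x⁻¹ ^ (-nu)) := by ring
        _ = _ := by rw [h3]; ring
    rw [h4, Real.sqrt_sq (by positivity)]
  have h3 : p / √x⁻¹ ≤ p * x ^ (r + nu + 1 / 2) := by
    rw [Real.sqrt_inv, div_inv_eq_mul, Real.sqrt_eq_rpow]
    gcongr
    linarith
  rw [h2]
  calc _ ≤ 2 * Λ * (2 * (p * x ^ (r + nu + 1 / 2)) + q * a * x ^ (r + nu + 1 / 2)) := by gcongr
    _ = 2 * (2 * p + q * a) * Λ * x ^ (r + nu + 1 / 2) := by ring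
    _ = _ := by rw [← h1]; ring

/-- The logarithm from the kernel sum grows slower than any power of x. -/
lemma eventually_rpow_conditions {η r β κ c : ℝ} (hη : 0 < η) (hr : 0 < r) (hβ : 0 < β)
    (hκ : 0 < κ) (L : ℝ) :
    ∀ᶠ n : ℕ in atTop, L ≤ (n : ℝ) ^ (1 / β) ∧
      c * (((n : ℝ) ^ (1 / β))⁻¹ ^ r * (1 + Real.log (η⁻¹ * (n : ℝ) ^ (1 / β)))) ≤ κ := by
  have h1 : Tendsto (fun n : ℕ => (n : ℝ) ^ (1 / β)) atTop atTop :=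
    (tendsto_rpow_atTop (by positivity)).comp tendsto_natCast_atTop_atTop
  have h2 : Tendsto (fun x : ℝ => (1 + Real.log η⁻¹) * x ^ (-r) + Real.log x / x ^ r) atTop
      (𝓝 ((1 + Real.log η⁻¹) * 0 + 0)) :=
    ((tendsto_rpow_neg_atTop hr).const_mul _).add
      (isLittleO_log_rpow_atTop hr).tendsto_div_nhds_zero
  have h3 := h2.const_mul c
  rw [mul_zero, add_zero, mul_zero] at h3
  have h4 : ∀ᶠ x : ℝ in atTop, L ≤ x ∧ c * (x⁻¹ ^ r * (1 + Real.log (η⁻¹ * x))) ≤ κ := by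
    filter_upwards [eventually_ge_atTop L, eventually_gt_atTop 0, h3.eventually_le_const hκ]
      with x hx hx0 hx1
    refine ⟨hx, hx1.trans_eq' ?_⟩
    rw [Real.log_mul (inv_pos.mpr hη).ne' hx0.ne', Real.inv_rpow hx0.le, Real.rpow_neg hx0.le]
    ring
  exact h1.eventually h4

end Scalars

/-! ### An eigenbasis of T. -/

section Operator

universe u

variable {X Y : Type*} {H₁ : Type u} {H₂ : Type*} [MeasurableSpace X]
  [NormedAddCommGroup Y] [InnerProductSpace ℝ Y] [CompleteSpace Y]
  [SecondCountableTopology Y] [MeasurableSpace Y] [BorelSpace Y]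
  [NormedAddCommGroup H₁] [InnerProductSpace ℝ H₁] [CompleteSpace H₁]
  [NormedAddCommGroup H₂] [InnerProductSpace ℝ H₂] [CompleteSpace H₂] [RKHS ℝ H₂ X Y]

lemma exists_isEigenSystem_comp [SecondCountableTopology H₂] {κ₀ Lip η : ℝ}
    (hK : KernelCondition H₂ (X := X) (Y := Y) κ₀) (m : Measure X) [IsProbabilityMeasure m]
    (hκ₀ : 0 ≤ κ₀) (hη₀ : 0 < η) (hη : η * (κ₀ * Lip) ^ 2 ≤ 1) {D : H₁ →L[ℝ] H₂}
    (hD : ‖D‖ ≤ Lip) :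
    ∃ (ι : Type u) (b : HilbertBasis ι ℝ H₁) (μ : ι → ℝ),
      IsEigenSystem (inclL2 hK m ∘L D) b μ η := by
  have hc : IsCompactOperator ((inclL2 hK m ∘L D)† ∘L (inclL2 hK m ∘L D)) :=
    ((isCompactOperator_inclL2 hK m).comp_clm D).clm_comp ((inclL2 hK m ∘L D)†)
  obtain ⟨ι, b, μ, hb⟩ := exists_eigenbasis hc (IsEigenSystem.symm_adjoint_comp _)
  refine ⟨ι, b, μ, hb, hη₀, le_trans ?_ hη⟩
  have h1 : ‖inclL2 hK m ∘L D‖ ≤ κ₀ * Lip := by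
    refine (ContinuousLinearMap.opNorm_comp_le _ _).trans ?_
    have := norm_inclL2_le hK m hκ₀
    gcongr
  gcongr

end Operator

end

/-! ### The main theorem. -/

set_option maxHeartbeats 2000000 in
theorem corollary1
    (r nu u η M Sig κ₀ Lip α CR CR' D Cnu : ℝ)
    (hr : 0 < r) (hnu₀ : 0 < nu) (hnu₁ : nu < 1) (hu : u = 0 ∨ u = 1 / 2)
    (hM : 0 ≤ M) (hSig : 0 ≤ Sig) (hκ₀ : 0 < κ₀) (hLip : 0 < Lip)
    (hη₀ : 0 < η) (hη : η < 1 / (κ₀ * Lip) ^ 2)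
    (hα₀ : 0 < α) (hα₁ : α < 1 / 2) (hCR : 0 < CR) (hCR' : 0 < CR')
    (hD : 0 < D) (hCnu : 0 < Cnu) :
    ∃ C : ℝ, 0 < C ∧ ∀ d : ℝ, 0 < d → ∃ N : ℕ,
      ∀ (X : Type*) [TopologicalSpace X] [PolishSpace X] [MeasurableSpace X] [BorelSpace X]
        (Y : Type*) [NormedAddCommGroup Y] [InnerProductSpace ℝ Y] [CompleteSpace Y]
        [SecondCountableTopology Y] [MeasurableSpace Y] [BorelSpace Y]
        (H₁ : Type*) [NormedAddCommGroup H₁] [InnerProductSpace ℝ H₁] [CompleteSpace H₁]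
        [SecondCountableTopology H₁]
        (H₂ : Type*) [NormedAddCommGroup H₂] [InnerProductSpace ℝ H₂] [CompleteSpace H₂]
        [SecondCountableTopology H₂] [RKHS ℝ H₂ X Y]
        (ρ : Measure (X × Y)) [IsProbabilityMeasure ρ]
        (dom : Set H₁) (A : H₁ → H₂) (A' : H₁ → H₁ →L[ℝ] H₂) (fdag g₁ : H₁)
        (hK : KernelCondition H₂ (X := X) (Y := Y) κ₀),
        IsTrueSolution ρ dom A fdag →
        BernsteinNoise ρ (fun x => A fdag x) M Sig →
        Metric.ball fdag d ⊆ dom →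
        FrechetCondition dom A A' fdag d Lip →
        NonlinearityCondition (inclL2 hK ρ.fst) dom A A' fdag d α CR CR' →
        g₁ ∈ dom →
        (∃ g : H₁, ‖g‖ ≤ D ∧ fdag - g₁ = opPow (opT hK ρ.fst A' fdag) r g) →
        (∀ lam : ℝ, 0 < lam →
          effectiveDim (opL hK ρ.fst) lam ≤ ENNReal.ofReal (Cnu ^ 2 * lam ^ (-nu))) →
        ∀ δ : ℝ, 6 * Real.exp (-(d / C) * η ^ min r (1 / 2)) ≤ δ → δ ≤ 1 →
        ∀ n : ℕ, N ≤ n →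
          ∃ E : Set (Fin n → X × Y), MeasurableSet E ∧
            ENNReal.ofReal (1 - δ) ≤ Measure.pi (fun _ : Fin n => ρ) E ∧
            ∀ z ∈ E,
              (∀ t : ℕ, 1 ≤ t → t ≤ stopTime η r nu n → gdIter z A A' η g₁ t ∈ dom) ∧
              ‖opPow (opT hK ρ.fst A' fdag) u
                  (gdIter z A A' η g₁ (stopTime η r nu n) - fdag)‖ ≤
                C * (1 / (n : ℝ)) ^ ((min r (1 / 2) + u) / (2 * min r (1 / 2) + nu + 1)) *
                  Real.log (6 / δ) := by

  -- The deterministic rates need exponents of at most 1/2, so a smoother source condition is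
  -- weakened to order p.
  obtain ⟨p, hp⟩ : ∃ p, p = min r (1 / 2) := ⟨_, rfl⟩
  have hp₀ : 0 < p := hp ▸ lt_min hr (by norm_num)
  have hpr : p ≤ r := hp ▸ min_le_left _ _
  have hp₁ : p ≤ 1 / 2 := hp ▸ min_le_right _ _
  have hmin : min (2 * r) 1 = 2 * p := by
    rw [hp, mul_min_of_nonneg _ _ zero_le_two]
    norm_num
  obtain ⟨β, hβ⟩ : ∃ β, β = 2 * p + nu + 1 := ⟨_, rfl⟩
  have hβ₀ : 0 < β := by rw [hβ]; positivity
  have hη' : η * (κ₀ * Lip) ^ 2 ≤ 1 := ((lt_div_iff₀ (by positivity)).mp hη).le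
  obtain ⟨ε, hε⟩ : ∃ ε, ε = (1 - 2 * α) / 4 := ⟨_, rfl⟩
  have hε₀ : 0 < ε := by rw [hε]; linarith
  have hε₁ : 4 * ε = 1 - 2 * α := by rw [hε]; ring
  -- From T^r g = T^p (T^(r−p) g), with T bounded by 1/η.
  obtain ⟨W, hW⟩ : ∃ W, W = η⁻¹ ^ (r - p) * D := ⟨_, rfl⟩
  have hW₀ : 0 < W := by rw [hW]; positivity
  -- The a priori bound for all errors. As B₀ ≥ 1, B₀ ≤ B₀², which gives the form needed for the
  -- Gronwall estimate.
  obtain ⟨B₀, hB₀⟩ : ∃ x, x = 3 * ((η⁻¹ ^ p * W) ^ 2 + 1) := ⟨_, rfl⟩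
  have hB₁ : 3 ≤ B₀ := by rw [hB₀]; linarith [sq_nonneg (η⁻¹ ^ p * W)]
  have hB₂ : 3 * ((η⁻¹ ^ p * W) ^ 2 + 1) ≤ B₀ ^ 2 := by rw [← hB₀]; nlinarith
  obtain ⟨cs, hcs⟩ : ∃ c, c = η * (4 / ε + 2 * Lip ^ 2 +
    η * (1 + 1 / ε) * (Lip * (κ₀ + 1)) ^ 2) * (1 + Lip * B₀) ^ 2 := ⟨_, rfl⟩
  obtain ⟨cn, hcn⟩ : ∃ c, c = 1 + CR + Lip * CR' + 2 * Lip + Lip ^ 2 * B₀ := ⟨_, rfl⟩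
  have hB₃ : 0 < B₀ := by linarith
  obtain ⟨K, κ, J₀, hK₀, hκ, hrates⟩ := exists_perturbedLandweber_rates (r := p) (η := η)
    (ce := ε / 2 * η) (cz := CR * (CR' + 1)) (cs := cs) (cn := cn) (X := B₀) (W₀ := W) hp₀ hp₁ hη₀
    (by positivity) (by positivity) (by rw [hcs]; positivity) (by rw [hcn]; positivity) hB₃ hW₀ hB₂
  -- One constant for both noise levels: the first summand is for the data noise, the second for the
  -- covariance.
  obtain ⟨a, ha⟩ : ∃ a, a = 2 * (2 * ((M + 1) * κ₀) + (Sig + 1) * Cnu) +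
    2 * (2 * (2 * κ₀ ^ 2) + 2 * κ₀ * Cnu) := ⟨_, rfl⟩
  have ha₀ : 0 < a := by rw [ha]; positivity
  -- The first two summands serve u = 0 and u = 1/2; the last makes the range of δ empty unless d ≥
  -- B₀ + 1.
  obtain ⟨C, hC⟩ : ∃ C, C = K * ((2 * η) ^ p + a) + K * ((2 * η) ^ (p + 1 / 2) + a) +
    (B₀ + 1) * η ^ p := ⟨_, rfl⟩
  have hC₀ : 0 < C := by rw [hC]; positivity
  refine ⟨C, hC₀, fun d hd => ?_⟩
  obtain ⟨N, hN⟩ := eventually_atTop.mp (eventually_rpow_conditions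
    (c := a * (d / C * η ^ p)) hη₀ hp₀ hβ₀ hκ (max (max 1 κ⁻¹) (η * (J₀ + 4))))
  refine ⟨N, ?_⟩
  intro X _ _ _ _ Y _ _ _ _ _ _ H₁ _ _ _ _ H₂ _ _ _ _ _ ρ _ dom A A' fdag g₁ hK htrue hnoise hdom
    hA hNL hg₁ hsource heff δ hδ₀ hδ₁ n hn
  rw [← hp] at hδ₀
  -- the quantities depending on the sample size and the confidence level
  obtain ⟨hx, hxκ⟩ := hN n hn
  obtain ⟨x, hxn⟩ : ∃ x, x = (n : ℝ) ^ (1 / β) := ⟨_, rfl⟩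
  rw [← hxn] at hx hxκ
  have hx1 : 1 ≤ x := ((le_max_left _ _).trans (le_max_left _ _)).trans hx
  have hx0 : 0 < x := by linarith
  have hκx : κ⁻¹ ≤ x := ((le_max_right _ _).trans (le_max_left _ _)).trans hx
  have hJx : (J₀ : ℝ) + 4 ≤ η⁻¹ * x := by
    rw [← div_eq_inv_mul, le_div_iff₀' hη₀]
    exact (le_max_right _ _).trans hx
  have hlam₀ : 0 < x⁻¹ := inv_pos.mpr hx0
  have hlam₁ : x⁻¹ ≤ 1 := inv_le_one_of_one_le₀ hx1
  have hlamκ : x⁻¹ ≤ κ := inv_le_of_inv_le₀ hκ hκx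
  have hnpos : 0 < n := by
    rcases Nat.eq_zero_or_pos n with rfl | h
    · rw [Nat.cast_zero, Real.zero_rpow (by positivity)] at hxn
      linarith
    · exact h
  have hnx : (n : ℝ) = x ^ (2 * p + nu + 1) := by
    rw [hxn, ← hβ, ← Real.rpow_mul (Nat.cast_nonneg n), one_div_mul_cancel hβ₀.ne', Real.rpow_one]
  have hδ : 0 < δ := lt_of_lt_of_le (by positivity) hδ₀
  obtain ⟨Λ, hΛ⟩ : ∃ Λ, Λ = Real.log (6 / δ) := ⟨_, rfl⟩
  have hΛ₁ : 1 ≤ Λ := by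
    rw [hΛ, Real.le_log_iff_exp_le (by positivity), le_div_iff₀ hδ]
    have h1 := Real.exp_one_lt_d9
    have h2 := mul_le_mul_of_nonneg_left hδ₁ (Real.exp_pos 1).le
    linarith
  -- The lower limit on δ bounds Λ independently of n, so n ≥ N can make the noise as small as
  -- required.
  have hΛd : Λ ≤ d / C * η ^ p := by
    rw [hΛ, Real.log_le_iff_le_exp (by positivity), div_le_iff₀ hδ]
    have h1 : Real.exp (d / C * η ^ p) * (6 * Real.exp (-(d / C) * η ^ p)) = 6 := by
      rw [mul_left_comm, ← Real.exp_add, neg_mul, add_neg_cancel, Real.exp_zero, mul_one]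
    rw [← h1]
    gcongr
  -- As Λ ≥ 1, the range of δ is nonempty only for large d.
  have hBd : B₀ < d := by
    have h1 : 1 ≤ d / C * η ^ p := hΛ₁.trans hΛd
    rw [div_mul_eq_mul_div, one_le_div hC₀] at h1
    have h2 : (B₀ + 1) * η ^ p ≤ d * η ^ p := by
      refine le_trans ?_ h1
      rw [hC]
      have : 0 ≤ K * ((2 * η) ^ p + a) + K * ((2 * η) ^ (p + 1 / 2) + a) := by positivity
      linarith
    have := le_of_mul_le_mul_right h2 (by positivity)
    linarith
  obtain ⟨s, hs⟩ : ∃ s, s = a * Λ * x⁻¹ ^ (p + 1 / 2) := ⟨_, rfl⟩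
  have hs₀ : 0 ≤ s := by rw [hs]; positivity
  have hsqrt : s / √x⁻¹ = a * Λ * x⁻¹ ^ p := by
    rw [hs, Real.rpow_add hlam₀, Real.sqrt_eq_rpow]
    have : 0 < x⁻¹ ^ (1 / 2 : ℝ) := by positivity
    field_simp
  have hs₁ : 2 * Λ * (2 * ((M + 1) * (κ₀ / √x⁻¹)) +
      √(n * ((Sig + 1) ^ 2 * (Cnu ^ 2 * x⁻¹ ^ (-nu))))) ≤ n * s := by
    have h1 := two_mul_log_mul_le (p := (M + 1) * κ₀) (q := Sig + 1) (a := Cnu) (Λ := Λ) hp₀ hnu₀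
      hx1 hnx (by positivity) (by positivity) hCnu.le (by linarith)
    rw [mul_div_assoc] at h1
    refine h1.trans ?_
    rw [hs, ha]
    gcongr
    have : 0 ≤ 2 * (2 * (2 * κ₀ ^ 2) + 2 * κ₀ * Cnu) := by positivity
    linarith
  have hs₂ : 2 * Λ * (2 * (2 * κ₀ ^ 2 / √x⁻¹) +
      √(n * (4 * κ₀ ^ 2 * (Cnu ^ 2 * x⁻¹ ^ (-nu))))) ≤ n * s := by
    have h1 := two_mul_log_mul_le (p := 2 * κ₀ ^ 2) (q := 2 * κ₀) (a := Cnu) (Λ := Λ) hp₀ hnu₀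
      hx1 hnx (by positivity) (by positivity) hCnu.le (by linarith)
    have h2 : (2 * κ₀) ^ 2 = 4 * κ₀ ^ 2 := by ring
    rw [h2] at h1
    refine h1.trans ?_
    rw [hs, ha]
    gcongr
    have : 0 ≤ 2 * (2 * ((M + 1) * κ₀) + (Sig + 1) * Cnu) := by positivity
    linarith
  -- the stopping time
  obtain ⟨J, hJ⟩ : ∃ J, J = stopTime η r nu n - 1 := ⟨_, rfl⟩
  have hTn : stopTime η r nu n = ⌊η⁻¹ * x⌋₊ := by rw [stopTime, hmin, ← hβ, ← hxn]
  have hηx : 0 ≤ η⁻¹ * x := by positivity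
  have hfl := Nat.floor_le hηx
  have hlf := Nat.lt_floor_add_one (η⁻¹ * x)
  rw [← hTn] at hfl hlf
  have hTn1 : 1 ≤ stopTime η r nu n := by
    have : (3 : ℝ) < stopTime η r nu n := by
      have : (0 : ℝ) ≤ J₀ := Nat.cast_nonneg _
      linarith
    exact_mod_cast (by linarith : (1 : ℝ) ≤ stopTime η r nu n)
  have hJs : (J : ℝ) + 1 = stopTime η r nu n := by
    rw [hJ, Nat.cast_sub hTn1]
    simp
  have hJ₀J : J₀ ≤ J := by
    exact_mod_cast (by linarith : (J₀ : ℝ) ≤ J)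
  -- The floor and the shift by one cost at most 2, which is at most half of η⁻¹x ≥ 4.
  have hJlow : (2 * η * x⁻¹)⁻¹ ≤ J := by
    have h1 : (2 * η * x⁻¹)⁻¹ = η⁻¹ * x / 2 := by field_simp
    have : (0 : ℝ) ≤ J₀ := Nat.cast_nonneg _
    rw [h1]
    linarith
  have hJhi : η * x⁻¹ * J ≤ 1 := by
    have h1 : (J : ℝ) ≤ η⁻¹ * x := by linarith
    calc η * x⁻¹ * J ≤ η * x⁻¹ * (η⁻¹ * x) := by gcongr
      _ = 1 := by field_simp
  have hsκ : s / √x⁻¹ * (1 + Real.log (J + 1)) ≤ κ := by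
    have hJ1 : (0 : ℝ) < J + 1 := by positivity
    have h1 : Real.log (J + 1) ≤ Real.log (η⁻¹ * x) := Real.log_le_log hJ1 (by linarith)
    have h2 : 0 ≤ Real.log ((J : ℝ) + 1) := Real.log_nonneg (by linarith [Nat.cast_nonneg (α := ℝ) J])
    calc s / √x⁻¹ * (1 + Real.log (J + 1))
        ≤ a * (d / C * η ^ p) * x⁻¹ ^ p * (1 + Real.log (η⁻¹ * x)) := by rw [hsqrt]; gcongr
      _ ≤ κ := by rw [mul_assoc]; exact hxκ
  -- the event
  obtain ⟨F, hFm, hFδ, hF⟩ := exists_event_empirical hK hκ₀ hlam₀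
    (𝒩 := Cnu ^ 2 * x⁻¹ ^ (-nu)) (by positivity) (heff _ hlam₀) htrue.2
    (M := M + 1) (Sig := Sig + 1) (by positivity) (by positivity)
    (hnoise.mono hM hSig (by linarith) (by linarith)) hδ hδ₁ hnpos
    (by rw [← hΛ]; exact hs₁) (by rw [← hΛ]; exact hs₂)
  refine ⟨F, hFm, hFδ, fun z hz => ?_⟩
  obtain ⟨hξ, hΔ⟩ := hF z hz
  obtain ⟨e, he⟩ : ∃ e : ℕ → H₁, e = fun j => (gdStep z A A' η)^[j] g₁ - fdag := ⟨_, rfl⟩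
  have hiter : ∀ j, (gdStep z A A' η)^[j] g₁ = fdag + e j := fun j => by
    rw [he, add_sub_cancel]
  have hestep : ∀ j, e (j + 1) = e j - η • ((A' (fdag + e j))†)
      (((inclL2 hK ρ.fst)†) (inclL2 hK ρ.fst (A (fdag + e j) - A fdag)) +
        (empNoise z (A fdag) + (empCov H₂ z - opL hK ρ.fst) (A (fdag + e j) - A fdag))) := by
    intro j
    have h1 : e (j + 1) = (gdStep z A A' η)^[j + 1] g₁ - fdag := by rw [he]
    rw [Function.iterate_succ_apply', hiter] at h1
    have h2 : ((inclL2 hK ρ.fst)†) (inclL2 hK ρ.fst (A (fdag + e j) - A fdag)) =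
        opL hK ρ.fst (A (fdag + e j) - A fdag) := rfl
    rw [h1, gdStep_eq z A A' η fdag, h2, sub_apply]
    rw [show opL hK ρ.fst (A (fdag + e j) - A fdag) + (empNoise z (A fdag) +
      (empCov H₂ z (A (fdag + e j) - A fdag) - opL hK ρ.fst (A (fdag + e j) - A fdag))) =
      empCov H₂ z (A (fdag + e j) - A fdag) + empNoise z (A fdag) by abel]
    abel
  obtain ⟨y, ν, ν₀, hL⟩ := exists_isPerturbedLandweber hη₀ hκ₀.le hLip.le hη' hα₁ hε₀ hε₁ hCR.le
    hCR'.le (norm_inclL2_le hK ρ.fst hκ₀.le) hdom hA hNL hB₃.le hBd hlam₀.le hlam₁ hs₀ hξ hΔ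
    hJhi hestep
  rw [← hcs, ← hcn] at hL
  have hfdag : fdag ∈ Metric.ball fdag d ∩ dom :=
    ⟨Metric.mem_ball_self hd, hdom (Metric.mem_ball_self hd)⟩
  obtain ⟨ι, b, μ, hb⟩ := exists_isEigenSystem_comp hK ρ.fst hκ₀.le hη₀ hη' (hA.2 _ hfdag)
  have hpow : ∀ {t : ℝ}, 0 ≤ t → ∀ w, opPow (opT hK ρ.fst A' fdag) t w =
      diagOp b (fun i => μ i ^ t) w := fun ht w =>
    opPow_eq_diagOp b (IsEigenSystem.symm_adjoint_comp _) hb.apply_basis (hb.abs_rpow_le ht) w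
  obtain ⟨g, hg, hgs⟩ := hsource
  have he0 : ∃ w₀, e 0 = diagOp b (fun i => μ i ^ p) w₀ ∧ ‖w₀‖ ≤ W := by
    refine ⟨-diagOp b (fun i => μ i ^ (r - p)) g, ?_, ?_⟩
    · rw [map_neg, hb.pow_pow hp₀.le (by linarith), add_sub_cancel, ← hpow hr.le, ← hgs, he]
      simp
    · rw [norm_neg, hW]
      refine (hb.norm_pow_le (by linarith) g).trans ?_
      gcongr
  obtain ⟨hball, hra, hrb⟩ := hrates hb hL hlam₀ hlamκ hs₀ hsκ hJ₀J he0
  refine ⟨fun t ht1 ht2 => ?_, ?_⟩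
  · rw [gdIter, hiter]
    exact (add_mem_ball_inter hdom ((hball _ (by omega)).trans_lt hBd)).2
  -- The iterates are numbered from t = 1, so g_{T_n} is reached after J = T_n − 1 steps.
  have hlast : gdIter z A A' η g₁ (stopTime η r nu n) - fdag = e J := by
    rw [gdIter, ← hJ, he]
  have hJpow : ∀ {q : ℝ}, 0 ≤ q → (J : ℝ) ^ (-q) ≤ (2 * η) ^ q * x⁻¹ ^ q := fun {q} hq => by
    have h1 : 0 < (2 * η * x⁻¹)⁻¹ := by positivity
    rw [← Real.mul_rpow (by positivity) hlam₀.le]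
    calc (J : ℝ) ^ (-q) ≤ (2 * η * x⁻¹)⁻¹ ^ (-q) :=
          Real.rpow_le_rpow_of_nonpos h1 hJlow (by linarith)
      _ = (2 * η * x⁻¹) ^ q := by
          rw [Real.inv_rpow (by positivity), Real.rpow_neg (by positivity), inv_inv]
  have hbound : ∀ {q : ℝ}, 0 ≤ q →
      K * ((J : ℝ) ^ (-q) + a * Λ * x⁻¹ ^ q) ≤ K * ((2 * η) ^ q + a) * x⁻¹ ^ q * Λ := fun {q} hq => by
    have h1 : (2 * η) ^ q * x⁻¹ ^ q ≤ (2 * η) ^ q * x⁻¹ ^ q * Λ :=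
      le_mul_of_one_le_right (by positivity) hΛ₁
    calc K * ((J : ℝ) ^ (-q) + a * Λ * x⁻¹ ^ q)
        ≤ K * ((2 * η) ^ q * x⁻¹ ^ q * Λ + a * Λ * x⁻¹ ^ q) := by
          gcongr
          exact (hJpow hq).trans h1
      _ = _ := by ring
  have hrate : ∀ q : ℝ, (1 / (n : ℝ)) ^ (q / (2 * p + nu + 1)) = x⁻¹ ^ q := fun q => by
    rw [← hβ, one_div, hxn, ← Real.inv_rpow (Nat.cast_nonneg n),
      ← Real.rpow_mul (by positivity), one_div_mul_eq_div]
  rw [hlast, ← hp, hrate, ← hΛ]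
  have hca : K * ((2 * η) ^ p + a) ≤ C := by
    rw [hC]
    have h1 : 0 ≤ K * ((2 * η) ^ (p + 1 / 2) + a) := by positivity
    have h2 : 0 ≤ (B₀ + 1) * η ^ p := by positivity
    linarith
  have hcb : K * ((2 * η) ^ (p + 1 / 2) + a) ≤ C := by
    rw [hC]
    have h1 : 0 ≤ K * ((2 * η) ^ p + a) := by positivity
    have h2 : 0 ≤ (B₀ + 1) * η ^ p := by positivity
    linarith
  -- For u = 0 the error bound is used; for u = 1/2 the residual bound, since ‖T^(1/2) e‖ = ‖B e‖.
  rcases hu with rfl | rfl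
  · rw [hpow le_rfl, add_zero]
    have h1 := hb.norm_pow_le le_rfl (e J)
    rw [Real.rpow_zero, one_mul] at h1
    rw [hsqrt] at hra
    refine h1.trans (hra.trans ((hbound hp₀.le).trans ?_))
    gcongr
  · rw [hpow (by norm_num), hb.norm_half]
    rw [hs] at hrb
    refine hrb.trans ((hbound (by positivity)).trans ?_)
    gcongr
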